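/- Let $d\ge 1$, $0<\alpha<2$, $\lambda>0$, $\sigma\in\mathbb R$, and let $B=(B(t,x))_{t\ge 0,\,x\in\mathbb R^d}$ be a Brownian sheet on a probability space $(\Omega,\mathcal F,\mathbb P)$: a centred Gaussian process with a.s. continuous paths, $B(0,0)=0$ a.s., and covariance $\mathbb E[B(s,x)B(t,y)]=(s\wedge t)\prod_{i=1}^d\int_{\mathbb R}\theta_{x_i}\theta_{y_i}\,du$, where $\theta_a=1$ on $(0,a]$, $\theta_a=-1$ on $(a,0]$ and $\theta_a=0$ elsewhere. Let $\mathcal S$ be the space of real Schwartz functions on $\mathbb R\times\mathbb R^d$ and $\mathcal S'$ its dual. Almost surely, $B$ (extended by $0$ to $t<0$) defines an element of $\mathcal S'$; let $W=\frac{\partial}{\partial t}\frac{\partial^d}{\partial x_1\cdots\partial x_d}B\in\mathcal S'$ be the time-space white noise. For $f\in L^2((0,\infty)\times\mathbb R^d)$ the Wiener integral $\int f\,dB$ is the $L^2(\mathbb P)$-limit of $\langle W,\varphi_k\rangle$ for any $\varphi_k\in\mathcal S$ with $\varphi_k\to f$ in $L^2((0,\infty)\times\mathbb R^d)$. Consider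 the fractional stochastic heat equation $$\frac{\partial^\alpha}{\partial t^\alpha}Y=\lambda\Delta Y+\sigma W,\qquad Y(0,\cdot)=\delta_0,$$ in the sense of distributions: a solution is a $Y\in\mathcal S'$ that vanishes for $t<0$ and satisfies $D^\alpha Y=\lambda\Delta Y+\sigma W$ in $\mathcal S'$. Here $\Delta$ acts in $x$ and $D^\alpha Y$ is the Caputo derivative in time for the initial value $\delta_0$ (and, when $\alpha>1$, zero initial velocity), $D^\alpha Y=\partial_t^n J^{n-\alpha}\big(Y-\mathbf 1_{\{t>0\}}\otimes\delta_0\big)$ with $n=\lceil\alpha\rceil$ and $J^\beta$ the fractional integral of order $\beta$ in time. By duality, $\langle D^\alpha Y,\varphi\rangle=\langle Y,\psi\rangle-\int_0^\infty\psi(t,0)\,dt$ for all $\varphi,\psi\in\mathcal S$ such that, for $t\ge 0$, $\psi(t,x)=\frac{(-1)^n}{\Gamma(n-\alpha)}\int_t^\infty(u-t)^{n-\alpha-1}\partial_u^n\varphi(u,x)\,du$ (and $\psi=-\partial_t\varphi$ if $\alpha=1$). Let $E_{\alpha,\beta}(z)=\sum_{k\ge0}z^k/\Gamma(\alpha k+\beta)$,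 $E_\alpha=E_{\alpha,1}$, and $\check\varphi(t,y)=(2\pi)^{-d}\int_{\mathbb R^d}e^{ix\cdot y}\varphi(t,x)\,dx$. **Theorem.** There are $I_1\in\mathcal S'$ and a random $I_2:\Omega\to\mathcal S'$ such that almost surely $Y=I_1+I_2$ is a solution, and it is the only solution in $\mathcal S'$ (for that $\omega$). Here $$I_1(t,x)=(2\pi)^{-d}\int_{\mathbb R^d}e^{ix\cdot y}E_\alpha(-\lambda t^\alpha|y|^2)\,dy,$$ $$I_2(t,x)=\sigma(2\pi)^{-d}\int_0^t(t-r)^{\alpha-1}\int_{\mathbb R^d}\Big(\int_{\mathbb R^d}e^{i(x-z)\cdot y}E_{\alpha,\alpha}(-\lambda(t-r)^\alpha|y|^2)\,dy\Big)B(dr,dz)$$ in the sense of distributions. That is, for every $\varphi\in\mathcal S$, $$\langle I_1,\varphi\rangle=\int_0^\infty\!\int_{\mathbb R^d}E_\alpha(-\lambda t^\alpha|y|^2)\,\check\varphi(t,y)\,dy\,dt,$$ and $\langle I_2,\varphi\rangle$ is the Wiener integral of the real function $$(r,z)\mapsto\sigma\int_r^\infty\!\int_{\mathbb R^d}(t-r)^{\alpha-1}e^{-iz\cdot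 y}E_{\alpha,\alpha}(-\lambda(t-r)^\alpha|y|^2)\,\check\varphi(t,y)\,dy\,dt\quad\in L^2((0,\infty)\times\mathbb R^d),$$ all these integrals over $(t,y)$ being absolutely convergent. Moreover, in the mean, $Y$ has the boundary values $\delta_0$ at $t=0$ and $0$ at $|x|=\infty$: for every $\varphi\in\mathcal S$, $$\mathbb E\langle Y,\varepsilon^{-1}\varphi(\cdot/\varepsilon,\cdot)\rangle\to\int_0^\infty\varphi(t,0)\,dt\quad(\varepsilon\downarrow0),\qquad \mathbb E\langle Y,\varphi(\cdot,\cdot-a)\rangle\to0\quad(|a|\to\infty).$$ -/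

import Mathlib

open MeasureTheory ProbabilityTheory Filter Topology Set
open scoped SchwartzMap LineDeriv NNReal ENNReal

noncomputable section

namespace FracHeat

/-- Time-space `ℝ × ℝ^d`, with points `(t, x)`. -/
abbrev TimeSpace (d : ℕ) : Type := ℝ × EuclideanSpace ℝ (Fin d)

/-- Real-valued Schwartz functions on time-space. -/
abbrev TestFn (d : ℕ) : Type := 𝓢(TimeSpace d, ℝ)

/-- Real tempered distributions on time-space: continuous linear functionals on the Schwartz space
of real-valued functions. -/
abbrev TDist (d : ℕ) : Type := TestFn d →L[ℝ] ℝ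

/-- The unit vector of time-space in the direction of time. -/
def timeDir (d : ℕ) : TimeSpace d := (1, 0)

/-- The unit vector of time-space in the direction of the spatial coordinate `x_i`. -/
def spaceDir {d : ℕ} (i : Fin d) : TimeSpace d := (0, EuclideanSpace.single i 1)

/-- The spatial Laplacian `∑ i, ∂²/∂x_i²` on test functions. -/
def laplacianTest (d : ℕ) : TestFn d →L[ℝ] TestFn d :=
  ∑ i : Fin d, (LineDeriv.lineDerivOpCLM ℝ (TestFn d) (spaceDir i)).comp
    (LineDeriv.lineDerivOpCLM ℝ (TestFn d) (spaceDir i))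

/-- The spatial Laplacian of a tempered distribution, `⟨ΔT, φ⟩ = ⟨T, Δφ⟩`. -/
def laplacian {d : ℕ} (T : TDist d) : TDist d := T.comp (laplacianTest d)

/-- The mixed derivative `∂_t ∂_{x_1} ⋯ ∂_{x_d}` of a tempered distribution,
`⟨∂T, φ⟩ = (-1)^(1+d) ⟨T, ∂_t ∂_{x_1} ⋯ ∂_{x_d} φ⟩`. -/
def mixedDeriv {d : ℕ} (T : TDist d) : TDist d :=
  (-1 : ℝ) ^ (d + 1) • T.comp (LineDeriv.iteratedLineDerivOpCLM ℝ (TestFn d)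
    (Fin.cons (timeDir d) (fun i : Fin d => spaceDir i) : Fin (d + 1) → TimeSpace d))

/-- Lebesgue measure on the half space `(0,∞) × ℝ^d`. -/
def halfVolume (d : ℕ) : Measure (TimeSpace d) := volume.restrict {p | 0 < p.1}

/-! ### The Mittag-Leffler function -/

/-- The two-parameter Mittag-Leffler function `E_{α,β}(z) = ∑_k z^k / Γ(α k + β)`,
at real arguments; `E_α = E_{α,1}`. -/
def mittagLeffler (α β z : ℝ) : ℝ := ∑' k : ℕ, z ^ k / Real.Gamma (α * k + β)

/-! ### The Caputo derivative in the sense of distributions -/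

/-- The right-sided (Weyl) fractional integral of order `β ≥ 0`,
`(1/Γ(β)) ∫_t^∞ (u - t)^(β-1) f(u) du`, which is `f` for `β = 0`. -/
def rightFracIntegral (β : ℝ) (f : ℝ → ℝ) (t : ℝ) : ℝ :=
  if β = 0 then f t else (Real.Gamma β)⁻¹ * ∫ u in Ioi t, (u - t) ^ (β - 1) * f u

/-- The right-sided fractional derivative of order `α` in time of a test function,
`(-1)^n` times the right-sided fractional integral of order `n - α` of `∂_t^n φ(·, x)`,
where `n` is the smallest integer `≥ α`. -/
def rightFracDeriv {d : ℕ} (α : ℝ) (φ : TestFn d) (p : TimeSpace d) : ℝ :=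
  (-1 : ℝ) ^ ⌈α⌉₊ *
    rightFracIntegral (⌈α⌉₊ - α) (iteratedDeriv ⌈α⌉₊ (fun t => φ (t, p.2))) p.1

/-- `S` is the Caputo time derivative of order `α` of the tempered distribution `Y`, which lives on
`t ≥ 0`, where the functional `U` is the continuation of the initial value of `Y` to `t ≥ 0` as a
constant in time. That is, `S = ∂_t^n J^(n-α) (Y - U)` with `n` the smallest integer `≥ α` and
`J^β` the (left-sided) fractional integral of order `β` in time. For a function `f` of `t`
with `n` continuous derivatives on `[0,∞)`, initial value `f(0)` and (when `n = 2`) `f'(0) = 0`,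
integration by parts identifies this with `(1/Γ(n-α)) ∫_0^t f^(n)(u) (t-u)^(n-α-1) du`,
respectively `f^(n)` if `α = n`; its Laplace transform is `s^α Lf(s) - s^(α-1) f(0)`.

By duality `⟨S, φ⟩ = ⟨Y - U, ψ⟩` where `ψ` is the right-sided fractional derivative of `φ`.
This function need not decay rapidly for `t → -∞`, so it is replaced by any Schwartz function `ψ`
that agrees with it where `t ≥ 0`. -/
def HasCaputoDeriv {d : ℕ} (α : ℝ) (Y : TDist d) (U : TestFn d → ℝ) (S : TDist d) : Prop :=
  ∀ φ ψ : TestFn d, (∀ p : TimeSpace d, 0 ≤ p.1 → ψ p = rightFracDeriv α φ p) →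
    S φ = Y ψ - U ψ

/-- The initial value `δ_0` (point mass at `x = 0`), continued to `t ≥ 0` as a constant in time:
`ψ ↦ ∫_0^∞ ⟨δ_0, ψ(t,·)⟩ dt = ∫_0^∞ ψ(t,0) dt`. -/
def deltaInitial {d : ℕ} (ψ : TestFn d) : ℝ := ∫ t in Ioi (0 : ℝ), ψ (t, 0)

/-- `Y` is an `𝓢'`-valued solution of `∂^α/∂t^α Y = lam Δ Y + σ w` with `Y(0,·) = δ_0`:
a tempered distribution that vanishes for `t < 0`, whose Caputo derivative of order `α` for the
initial value `δ_0` is `lam Δ Y + σ w`. -/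
structure IsSolution {d : ℕ} (α lam σ : ℝ) (w Y : TDist d) : Prop where
  vanishing : ∀ φ : TestFn d, tsupport φ ⊆ {p : TimeSpace d | p.1 < 0} → Y φ = 0
  equation : HasCaputoDeriv α Y deltaInitial (lam • laplacian Y + σ • w)

/-! ### Brownian sheet, white noise, Wiener integral -/

/-- The function `θ_a`: `1` on `(0,a]`, `-1` on `(a,0]`, and `0` elsewhere. -/
def theta (a s : ℝ) : ℝ :=
  if 0 < s ∧ s ≤ a then 1 else if a < s ∧ s ≤ 0 then -1 else 0

/-- `B = (B(t,x))`, `t ≥ 0`, `x ∈ ℝ^d`, is a time-space Brownian motion (Brownian sheet) under `P`: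
a centred Gaussian process, started at `0`, with almost surely continuous paths and with the
covariance of the Brownian sheet. The values of `B` at `t < 0` play no role. -/
structure IsBrownianSheet {Ω : Type*} [MeasurableSpace Ω] {d : ℕ}
    (B : TimeSpace d → Ω → ℝ) (P : Measure Ω) : Prop where
  start : ∀ᵐ ω ∂P, B (0, 0) ω = 0
  continuousPaths : ∀ᵐ ω ∂P, ContinuousOn (fun p => B p ω) {p | 0 ≤ p.1}
  gaussian : IsGaussianProcess (fun p : {p : TimeSpace d // 0 ≤ p.1} => B p) P
  centred : ∀ p : TimeSpace d, 0 ≤ p.1 → ∫ ω, B p ω ∂P = 0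
  covariance : ∀ p q : TimeSpace d, 0 ≤ p.1 → 0 ≤ q.1 →
    ∫ ω, B p ω * B q ω ∂P =
      (∫ s : ℝ, theta p.1 s * theta q.1 s) *
        ∏ i : Fin d, ∫ s : ℝ, theta (p.2 i) s * theta (q.2 i) s

/-- `w = ∂_t ∂_{x_1} ⋯ ∂_{x_d} b` in the sense of distributions, where the path `b` of the Brownian
sheet is regarded as the tempered distribution given by `b` for `t > 0` and by `0` for `t < 0`. -/
def IsWhiteNoise {d : ℕ} (b : TimeSpace d → ℝ) (w : TDist d) : Prop :=
  ∃ T : TDist d,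
    (∀ φ : TestFn d, Integrable (fun p => b p * φ p) (halfVolume d) ∧
      T φ = ∫ p, b p * φ p ∂(halfVolume d)) ∧
    w = mixedDeriv T

/-- `X` is the Wiener integral `∫_0^∞ ∫_{ℝ^d} f(r,z) B(dr,dz)` of `f ∈ L²((0,∞) × ℝ^d)`, where
`W` is the white noise of `B`: the limit in `L²(P)` of `⟨W, φ_k⟩` for any sequence of Schwartz
functions `φ_k` that converges to `f` in `L²((0,∞) × ℝ^d)`. -/
def IsWienerIntegral {Ω : Type*} [MeasurableSpace Ω] {d : ℕ} (W : Ω → TDist d) (P : Measure Ω)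
    (f : TimeSpace d → ℝ) (X : Ω → ℝ) : Prop :=
  MemLp f 2 (halfVolume d) ∧ MemLp X 2 P ∧
  ∀ φ : ℕ → TestFn d,
    Tendsto (fun k => eLpNorm (fun p => φ k p - f p) 2 (halfVolume d)) atTop (𝓝 0) →
    Tendsto (fun k => eLpNorm (fun ω => W ω (φ k) - X ω) 2 P) atTop (𝓝 0)

/-! ### The two parts of the solution -/

/-- The spatial inverse Fourier transform `(2π)^(-d) ∫ e^{i x·y} φ(t,x) dx` of `φ(t,·)`
at the point `y`. -/
def invFourier {d : ℕ} (φ : TestFn d) (t : ℝ) (y : EuclideanSpace ℝ (Fin d)) : ℂ :=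
  (((2 * Real.pi) ^ d : ℝ) : ℂ)⁻¹ *
    ∫ x : EuclideanSpace ℝ (Fin d), Complex.exp (Complex.I * (inner ℝ x y : ℝ)) * (φ (t, x) : ℂ)

/-- The integrand in the definition of the pairing of `I₁` with `φ`. -/
def I1Integrand {d : ℕ} (α lam : ℝ) (φ : TestFn d) (q : TimeSpace d) : ℂ :=
  (mittagLeffler α 1 (-(lam * q.1 ^ α * ‖q.2‖ ^ 2)) : ℂ) * invFourier φ q.1 q.2

/-- `T` is `I₁(t,x) = (2π)^(-d) ∫ e^{i x·y} E_α(-lam t^α |y|²) dy`, `t > 0`, as a tempered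
distribution on time-space. The integral over `y` is the inverse Fourier transform in the sense
of distributions, so for a test function `φ` the integration over `x` comes first:
`⟨I₁, φ⟩ = ∫_0^∞ ∫ E_α(-lam t^α |y|²) ((2π)^(-d) ∫ e^{i x·y} φ(t,x) dx) dy dt`. -/
def IsI1 {d : ℕ} (α lam : ℝ) (T : TDist d) : Prop :=
  ∀ φ : TestFn d, Integrable (I1Integrand α lam φ) (halfVolume d) ∧
    (T φ : ℂ) = ∫ q, I1Integrand α lam φ q ∂(halfVolume d)

/-- The integrand, as a function of `q = (t,y)`, of the kernel at `p = (r,z)` of the pairing of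
`I₂` with `φ`:
`(t-r)^(α-1) e^{-i z·y} E_{α,α}(-lam (t-r)^α |y|²) ((2π)^(-d) ∫ e^{i x·y} φ(t,x) dx)`. -/
def I2Integrand {d : ℕ} (α lam : ℝ) (φ : TestFn d) (p q : TimeSpace d) : ℂ :=
  (((q.1 - p.1) ^ (α - 1) : ℝ) : ℂ) * Complex.exp (-(Complex.I * (inner ℝ p.2 q.2 : ℝ))) *
    (mittagLeffler α α (-(lam * (q.1 - p.1) ^ α * ‖q.2‖ ^ 2)) : ℂ) * invFourier φ q.1 q.2

/-- `Z` is the random tempered distribution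
`I₂(t,x) = σ (2π)^(-d) ∫_0^t (t-r)^(α-1) ∫ (∫ e^{i(x-z)·y} E_{α,α}(-lam (t-r)^α |y|²) dy) B(dr,dz)`,
where `W` is the white noise of `B`. In the sense of distributions: for each `φ`, the random
variable `⟨I₂, φ⟩` is the Wiener integral of the function which at `(r,z)` is the pairing with
`φ(t,x)`, over `t > r` and `x`, of
`σ (t-r)^(α-1) (2π)^(-d) ∫ e^{i(x-z)·y} E_{α,α}(-lam (t-r)^α |y|²) dy`. -/
def IsI2 {Ω : Type*} [MeasurableSpace Ω] {d : ℕ} (α lam σ : ℝ) (W : Ω → TDist d) (P : Measure Ω)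
    (Z : Ω → TDist d) : Prop :=
  ∀ φ : TestFn d, ∃ f : TimeSpace d → ℝ,
    (∀ p : TimeSpace d, 0 < p.1 →
      IntegrableOn (I2Integrand α lam φ p) {q | p.1 < q.1} ∧
      (f p : ℂ) = (σ : ℂ) * ∫ q in {q : TimeSpace d | p.1 < q.1}, I2Integrand α lam φ p q) ∧
    IsWienerIntegral W P f (fun ω => Z ω φ)

/-! ### Boundary values -/

/-- The test function `(t,x) ↦ φ(t, x - a)`. -/
def spaceShift {d : ℕ} (a : EuclideanSpace ℝ (Fin d)) (φ : TestFn d) : TestFn d :=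
  φ.compSubConstCLM ℝ ((0, a) : TimeSpace d)

/-- For `ε > 0`, the test function `(t,x) ↦ ε⁻¹ φ(t/ε, x)`, which concentrates at `t = 0` as
`ε → 0`. (It is set to `0` for `ε = 0`.) -/
def timeConcentrate {d : ℕ} (ε : ℝ) (φ : TestFn d) : TestFn d :=
  if h : ε = 0 then 0 else
    ε⁻¹ • SchwartzMap.compCLMOfContinuousLinearEquiv ℝ
      ((ContinuousLinearEquiv.unitsEquivAut ℝ (Units.mk0 ε⁻¹ (inv_ne_zero h))).prodCongr
        (ContinuousLinearEquiv.refl ℝ (EuclideanSpace ℝ (Fin d)))) φ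

theorem timeConcentrate_apply {d : ℕ} {ε : ℝ} (h : ε ≠ 0) (φ : TestFn d) (t : ℝ)
    (x : EuclideanSpace ℝ (Fin d)) :
    timeConcentrate ε φ (t, x) = ε⁻¹ * φ (t / ε, x) := by
  simp [timeConcentrate, h, div_eq_mul_inv]

end FracHeat

end

noncomputable section

namespace FracHeat

/-! ### The Mittag-Leffler function -/

/-! The proof is by duality. Let `D*` be the right-sided fractional derivative of order `α` in time,
let `U` be the functional of the initial value, and let `w` be a fixed path of the noise. The
equation says that `Y (D*φ - λΔφ) = U (D*φ) + σ w φ` for all test functions `φ` for which `D*φ` is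
represented on `t ≥ 0` by a Schwartz function. So everything rests on inverting `D* - λΔ` on test
functions. In the spatial Fourier variable `y` this is a scalar problem with `μ = λ|y|²`, and the
inverse is integration of `φ(t + τ)` over the lag `τ > 0` against `τ^(α-1) E_{α,α}(-μ τ^α)`. The
operator `K = duhamel` does this, with a cutoff in the far past so that its values are Schwartz
functions.

On `t ≥ 0`, `K` is a two-sided inverse. The identity `K (D*φ - λΔφ) = φ`
(`duhamel_rightFracDeriv_sub`) shows that `Y = U ∘ (1 + λΔK) + σ w ∘ K` is a solution. The identity
`D* K η = η + λΔKη` (`rightFracDeriv_duhamel`) allows the equation to be tested with `Kη`, which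
gives `Y η = U (η + λΔKη) + σ w (Kη)` for every solution, hence uniqueness. Both identities come
from one fact about the kernels `t^(β-1) E_{α,β}(-μ t^α)`: convolution with `t^(γ-1)/Γ(γ)` raises
`β` by `γ` (`mlKernel_conv`).

The analytic burden is that `K` is continuous on Schwartz functions. For this the symbol
`E_{α,α}(-|y|²)` must have temperate growth, so `E_{α,β}` and all its derivatives need polynomial
bounds on the negative half line. These are obtained without asymptotic expansions. The kernels
solve a Volterra equation, fractional integration of order in `(0,1)` is of positive type, and an
energy estimate then bounds `E_{α,β}` for large `β` and every `α < 2`; the recurrence in `β` and the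
formula for the derivative give the rest. For each lag the multiplier is a dilation of the one
symbol, so its seminorms grow polynomially in `τ`, and the decay of the translated test function
pays for this.

The probability is an isometry. The product of the functions `θ` is a Green's function of the mixed
derivative, so the covariance of the sheet gives `E ⟨W,φ⟩² = ∫ φ²` over `t > 0`. As `Kφ` is a
Schwartz function, `⟨W, Kφ⟩` is its Wiener integral and is defined for each path separately; no
exceptional set depends on `φ`. The noise has mean zero, so the mean of `Y` is `I₁`. Its limit at `t
= 0` is dominated convergence, and its decay at infinity is the Riemann-Lebesgue lemma. -/

theorem gamma_lower_bound {R y : ℝ} (hR : 0 < R) (hy : 1 ≤ y) :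
    R ^ (y - 1) * Real.exp (-(R + 1)) ≤ Real.Gamma y := by
  rw [Real.Gamma_eq_integral (by linarith)]
  have hint := Real.GammaIntegral_convergent (s := y) (by linarith)
  -- Only the mass of the Gamma integral on `(R, R + 1]` is kept. As `R` is free, `Γ` beats every
  -- geometric sequence.
  have hsub : Ioc R (R + 1) ⊆ Ioi 0 := fun x hx => hR.trans hx.1
  calc R ^ (y - 1) * Real.exp (-(R + 1))
      = ∫ _ in Ioc R (R + 1), R ^ (y - 1) * Real.exp (-(R + 1)) := by simp
    _ ≤ ∫ x in Ioc R (R + 1), Real.exp (-x) * x ^ (y - 1) := by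
        refine setIntegral_mono_on (integrableOn_const (by simp)) (hint.mono_set hsub) measurableSet_Ioc ?_
        intro x hx
        rw [mul_comm]
        gcongr
        · exact hx.2
        · exact hx.1.le
    _ ≤ _ := setIntegral_mono_set hint
        (by filter_upwards [ae_restrict_mem measurableSet_Ioi] with x hx
            exact mul_nonneg (Real.exp_pos _).le (Real.rpow_nonneg (le_of_lt hx) _))
        (Eventually.of_forall hsub)

/-- Written for `1/Γ`, the recurrence holds at the poles as well, where `Real.Gamma` has the value
`0`. No parameter has to be excluded below. -/
theorem inv_gamma_eq (s : ℝ) : (Real.Gamma s)⁻¹ = s * (Real.Gamma (s + 1))⁻¹ := by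
  rcases eq_or_ne s 0 with rfl | hs
  · simp
  · rw [Real.Gamma_add_one hs, mul_inv, mul_inv_cancel_left₀ hs]

theorem summable_mittagLeffler_norm {α : ℝ} (hα : 0 < α) (β z : ℝ) :
    Summable fun k : ℕ => |z| ^ k * |(Real.Gamma (α * k + β))⁻¹| := by
  -- With `R = A^(1/α)` the lower bound for `Γ(αk + β)` is a constant times `A^k`, and `|z|/A ≤ 1/2`
  -- makes the majorant geometric.
  set A : ℝ := 2 * (|z| + 1)
  have hA : 0 < A := by positivity
  set R : ℝ := A ^ (α⁻¹)
  have hR : 0 < R := Real.rpow_pos_of_pos hA _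
  have hev : ∀ᶠ k : ℕ in atTop, 1 ≤ α * k + β := by
    filter_upwards [eventually_ge_atTop ⌈(1 - β) / α⌉₊] with k hk
    have := (Nat.le_ceil ((1 - β) / α)).trans (Nat.cast_le.mpr hk)
    rw [div_le_iff₀ hα] at this
    linarith
  refine Summable.of_norm_bounded_eventually_nat
    (g := fun k => (1 / 2 : ℝ) ^ k * (R ^ (1 - β) * Real.exp (R + 1)))
    ((summable_geometric_of_lt_one (by norm_num) (by norm_num)).mul_right _) ?_
  filter_upwards [hev] with k hk
  have hG := gamma_lower_bound hR hk
  have hpos : 0 < R ^ (α * k + β - 1) * Real.exp (-(R + 1)) :=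
    mul_pos (Real.rpow_pos_of_pos hR _) (Real.exp_pos _)
  have hGp := hpos.trans_le hG
  rw [Real.norm_of_nonneg (by positivity), abs_of_pos (inv_pos.mpr hGp)]
  have h1 : (Real.Gamma (α * k + β))⁻¹ ≤ (R ^ (α * k + β - 1) * Real.exp (-(R + 1)))⁻¹ := by
    gcongr
  have h2 : R ^ (α * k + β - 1) = A ^ k * (R ^ (1 - β))⁻¹ := by
    rw [show α * k + β - 1 = α * k - (1 - β) by ring, Real.rpow_sub hR, ← Real.rpow_mul hA.le]
    rw [show α⁻¹ * (α * (k : ℝ)) = k by field_simp, Real.rpow_natCast, div_eq_mul_inv]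
  calc |z| ^ k * (Real.Gamma (α * k + β))⁻¹
      ≤ |z| ^ k * (R ^ (α * k + β - 1) * Real.exp (-(R + 1)))⁻¹ := by gcongr
    _ = (|z| / A) ^ k * (R ^ (1 - β) * Real.exp (R + 1)) := by
        rw [h2, Real.exp_neg, div_pow]
        simp only [mul_inv, inv_inv]
        ring
    _ ≤ _ := by
        have : |z| / A ≤ 1 / 2 := by
          rw [div_le_div_iff₀ hA (by norm_num)]
          simp only [A]
          linarith
        gcongr

theorem summable_mittagLeffler {α : ℝ} (hα : 0 < α) (β z : ℝ) :
    Summable fun k : ℕ => z ^ k / Real.Gamma (α * k + β) := by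
  refine Summable.of_norm ((summable_mittagLeffler_norm hα β z).congr fun k => ?_)
  simp [div_eq_mul_inv]

/-- Splitting off the term `k = 0` trades `β` for `α + β` at the cost of one factor `z`. This is the
Volterra equation of the kernels, and it reduces growth bounds to large `β`. -/
theorem mittagLeffler_succ {α : ℝ} (hα : 0 < α) (β z : ℝ) :
    mittagLeffler α β z = (Real.Gamma β)⁻¹ + z * mittagLeffler α (α + β) z := by
  rw [mittagLeffler, (summable_mittagLeffler hα β z).tsum_eq_zero_add, mittagLeffler,
    ← tsum_mul_left]
  congr 1
  · simp
  · refine tsum_congr fun k => ?_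
    rw [show α * ((k + 1 : ℕ) : ℝ) + β = α * k + (α + β) by push_cast; ring]
    ring

theorem mittagLeffler_zero {α : ℝ} (hα : 0 < α) (β : ℝ) :
    mittagLeffler α β 0 = (Real.Gamma β)⁻¹ := by
  rw [mittagLeffler_succ hα, zero_mul, add_zero]

/-- The factor `k + 1` is `α⁻¹ ((α(k+1) + β - 1) - (β - 1))`, and the first part is absorbed by the
recurrence of `1/Γ`. This form has no division by `z`, so bounds for all `β` pass to all
derivatives. -/
theorem hasDerivAt_mittagLeffler {α : ℝ} (hα : 0 < α) (β z : ℝ) :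
    HasDerivAt (mittagLeffler α β)
      (α⁻¹ * (mittagLeffler α (α + β - 1) z - (β - 1) * mittagLeffler α (α + β) z)) z := by
  set R : ℝ := |z| + 1
  have hterm : ∀ (j : ℕ) (w : ℝ), ((j + 1 : ℕ) : ℝ) * w ^ j / Real.Gamma (α * (j + 1 : ℕ) + β) =
      α⁻¹ * (w ^ j / Real.Gamma (α * j + (α + β - 1)) -
        (β - 1) * (w ^ j / Real.Gamma (α * j + (α + β)))) := by
    intro j w
    have := inv_gamma_eq (α * j + (α + β - 1))
    rw [show α * j + (α + β - 1) + 1 = α * j + (α + β) by ring] at this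
    rw [show α * ((j + 1 : ℕ) : ℝ) + β = α * j + (α + β) by push_cast; ring]
    simp only [div_eq_mul_inv, this]
    push_cast
    field_simp
    ring
  have hu : Summable fun k : ℕ => (k : ℝ) * R ^ (k - 1) * |(Real.Gamma (α * k + β))⁻¹| := by
    rw [← summable_nat_add_iff 1]
    refine ((((summable_mittagLeffler_norm hα (α + β - 1) R)).add
      ((summable_mittagLeffler_norm hα (α + β) R).mul_left |β - 1|)).mul_left α⁻¹).of_nonneg_of_le
      (fun k => by positivity) fun k => ?_
    have h := hterm k R
    have hR : |R| = R := abs_of_nonneg (by positivity)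
    have h1 : ((k + 1 : ℕ) : ℝ) * R ^ (k + 1 - 1) * |(Real.Gamma (α * (k + 1 : ℕ) + β))⁻¹| =
        |((k + 1 : ℕ) : ℝ) * R ^ k / Real.Gamma (α * (k + 1 : ℕ) + β)| := by
      rw [div_eq_mul_inv, abs_mul, abs_of_nonneg (a := _ * _) (by positivity), Nat.add_sub_cancel]
    rw [h1, h, abs_mul, abs_of_pos (inv_pos.mpr hα), hR]
    gcongr
    refine (abs_sub _ _).trans (le_of_eq ?_)
    simp only [abs_mul, div_eq_mul_inv, abs_pow, hR]
  have key := hasDerivAt_tsum_of_isPreconnected (𝕜 := ℝ) (F := ℝ)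
    (g := fun (k : ℕ) (w : ℝ) => w ^ k / Real.Gamma (α * k + β))
    (g' := fun (k : ℕ) (w : ℝ) => k * w ^ (k - 1) / Real.Gamma (α * k + β))
    hu (t := Metric.ball 0 R) Metric.isOpen_ball (convex_ball _ _).isPreconnected
    (fun k w _ => (hasDerivAt_pow k w).div_const _)
    (fun k w hw => by
      rw [mem_ball_zero_iff, Real.norm_eq_abs] at hw
      simp only [div_eq_mul_inv, norm_mul, norm_pow, Real.norm_eq_abs, Nat.abs_cast]
      gcongr)
    (y₀ := 0) (by simp [R]; positivity) (summable_mittagLeffler hα β 0) (y := z)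
    (by simp [R])
  refine key.congr_deriv ?_
  rw [Summable.tsum_eq_zero_add]
  · simp only [Nat.cast_zero, zero_mul, zero_div, zero_add, Nat.add_sub_cancel, hterm]
    rw [tsum_mul_left, Summable.tsum_sub, tsum_mul_left]
    · rfl
    · exact summable_mittagLeffler hα _ z
    · exact (summable_mittagLeffler hα _ z).mul_left _
  · rw [← summable_nat_add_iff 1]
    simp only [Nat.add_sub_cancel, hterm]
    exact ((summable_mittagLeffler hα _ z).sub ((summable_mittagLeffler hα _ z).mul_left _)).mul_left
      _

theorem continuous_mittagLeffler {α : ℝ} (hα : 0 < α) (β : ℝ) : Continuous (mittagLeffler α β) :=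
  continuous_iff_continuousAt.mpr fun z => (hasDerivAt_mittagLeffler hα β z).continuousAt

/-! ### Riemann-Liouville kernels -/

theorem integral_rpow_mul_rpow_sub {a b t : ℝ} (ha : 0 < a) (hb : 0 < b) (ht : 0 < t) :
    ∫ r in 0..t, r ^ (a - 1) * (t - r) ^ (b - 1) =
      t ^ (a + b - 1) * (Real.Gamma a * Real.Gamma b / Real.Gamma (a + b)) := by
  have h := Complex.betaIntegral_scaled (a : ℂ) (b : ℂ) ht
  have h2 : ∫ x in 0..t, ((x : ℂ) ^ ((a : ℂ) - 1) * ((t : ℂ) - x) ^ ((b : ℂ) - 1)) =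
      ∫ x in 0..t, (((x ^ (a - 1) * (t - x) ^ (b - 1) : ℝ)) : ℂ) := by
    rw [intervalIntegral.integral_of_le ht.le, intervalIntegral.integral_of_le ht.le]
    refine setIntegral_congr_fun measurableSet_Ioc fun x hx => ?_
    rw [← Complex.ofReal_one, ← Complex.ofReal_sub, ← Complex.ofReal_sub, ← Complex.ofReal_sub,
      ← Complex.ofReal_cpow hx.1.le, ← Complex.ofReal_cpow (sub_nonneg.mpr hx.2),
      ← Complex.ofReal_mul]
  rw [h2, intervalIntegral.integral_ofReal, Complex.betaIntegral_eq_Gamma_mul_div _ _ (by simpa)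
    (by simpa)] at h
  have h3 : ((t : ℂ)) ^ ((a : ℂ) + b - 1) = ((t ^ (a + b - 1) : ℝ) : ℂ) := by
    rw [Complex.ofReal_cpow ht.le]; push_cast; rfl
  rw [h3, ← Complex.ofReal_add, Complex.Gamma_ofReal, Complex.Gamma_ofReal,
    Complex.Gamma_ofReal] at h
  exact_mod_cast h

theorem intervalIntegrable_rpow_mul_rpow_sub {a b t : ℝ} (ha : 0 < a) (hb : 0 < b) (ht : 0 < t) :
    IntervalIntegrable (fun r => r ^ (a - 1) * (t - r) ^ (b - 1)) volume 0 t := by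
  -- The integral of a function that is not integrable is `0` by convention, whereas the Beta value
  -- is positive.
  by_contra hcon
  have h := intervalIntegral.integral_undef hcon
  rw [integral_rpow_mul_rpow_sub ha hb ht] at h
  have h1 := Real.Gamma_pos_of_pos ha
  have h2 := Real.Gamma_pos_of_pos hb
  have h3 := Real.Gamma_pos_of_pos (add_pos ha hb)
  have : 0 < t ^ (a + b - 1) * (Real.Gamma a * Real.Gamma b / Real.Gamma (a + b)) := by positivity
  exact this.ne' h

/-- The kernel `t^(β-1) E_{α,β}(-μ t^α)`. -/
def mlKernel (α β μ t : ℝ) : ℝ := t ^ (β - 1) * mittagLeffler α β (-(μ * t ^ α))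

theorem mlKernel_eq_tsum {α : ℝ} (β μ : ℝ) {t : ℝ} (ht : 0 < t) :
    mlKernel α β μ t = ∑' k : ℕ, (-μ) ^ k * (t ^ (α * k + β - 1) / Real.Gamma (α * k + β)) := by
  rw [mlKernel, mittagLeffler, ← tsum_mul_left]
  refine tsum_congr fun k => ?_
  rw [← neg_mul, mul_pow, ← Real.rpow_natCast (t ^ α), ← Real.rpow_mul ht.le,
    show α * (k : ℝ) + β - 1 = (β - 1) + α * k by ring, Real.rpow_add ht]
  ring

theorem mlKernel_zero {α : ℝ} (hα : 0 < α) (β t : ℝ) :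
    mlKernel α β 0 t = t ^ (β - 1) / Real.Gamma β := by
  rw [mlKernel, zero_mul, neg_zero, mittagLeffler_zero hα, div_eq_mul_inv]

theorem mlKernel_succ {α : ℝ} (hα : 0 < α) (β μ : ℝ) {t : ℝ} (ht : 0 < t) :
    mlKernel α β μ t = t ^ (β - 1) / Real.Gamma β - μ * mlKernel α (α + β) μ t := by
  rw [mlKernel, mittagLeffler_succ hα, mlKernel,
    show α + β - 1 = (β - 1) + α by ring, Real.rpow_add ht]
  ring

/-- Convolution with a Riemann-Liouville kernel raises the second parameter of `mlKernel`. -/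
theorem mlKernel_conv {α β γ : ℝ} (hα : 0 < α) (hβ : 0 < β) (hγ : 0 < γ) (μ : ℝ) {t : ℝ}
    (ht : 0 < t) :
    ∫ r in 0..t, mlKernel α β μ r * ((t - r) ^ (γ - 1) / Real.Gamma γ) =
      mlKernel α (β + γ) μ t := by
  set F : ℕ → ℝ → ℝ := fun k r => (-μ) ^ k / (Real.Gamma (α * k + β) * Real.Gamma γ) *
    (r ^ (α * k + β - 1) * (t - r) ^ (γ - 1)) with hF
  have hk : ∀ k : ℕ, 0 < α * k + β := fun k => by positivity
  have hGk : ∀ k : ℕ, 0 < Real.Gamma (α * k + β) := fun k => Real.Gamma_pos_of_pos (hk k)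
  have hGγ := Real.Gamma_pos_of_pos hγ
  have hFint : ∀ k, IntegrableOn (F k) (Ioc 0 t) := fun k =>
    ((intervalIntegrable_iff_integrableOn_Ioc_of_le ht.le).mp
      (intervalIntegrable_rpow_mul_rpow_sub (hk k) hγ ht)).const_mul _
  -- The base `c` is left free: `c = -μ` gives the terms of the series, `c = |μ|` the integrals of
  -- their absolute values.
  have hval : ∀ c : ℝ, ∀ k : ℕ, ∫ r in Ioc 0 t, c ^ k / (Real.Gamma (α * k + β) * Real.Gamma γ) *
      (r ^ (α * k + β - 1) * (t - r) ^ (γ - 1)) =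
      c ^ k * (t ^ (α * k + (β + γ) - 1) / Real.Gamma (α * k + (β + γ))) := by
    intro c k
    rw [integral_const_mul, ← intervalIntegral.integral_of_le ht.le,
      integral_rpow_mul_rpow_sub (hk k) hγ ht, add_assoc]
    have := (hGk k).ne'
    field_simp
  have hnorm : ∀ k, ∫ r in Ioc 0 t, ‖F k r‖ =
      |μ| ^ k * (t ^ (α * k + (β + γ) - 1) / Real.Gamma (α * k + (β + γ))) := by
    intro k
    rw [← hval]
    refine setIntegral_congr_fun measurableSet_Ioc fun r hr => ?_
    simp only [hF, norm_mul, norm_div, norm_pow, norm_neg, Real.norm_eq_abs]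
    rw [abs_of_pos (hGk k), abs_of_pos hGγ, abs_of_nonneg (Real.rpow_nonneg hr.1.le _),
      abs_of_nonneg (Real.rpow_nonneg (sub_nonneg.mpr hr.2) _)]
  have hsum : Summable fun k => ∫ r in Ioc 0 t, ‖F k r‖ := by
    simp_rw [hnorm]
    have := (summable_mittagLeffler_norm hα (β + γ) (|μ| * t ^ α)).mul_left (t ^ (β + γ - 1))
    refine this.congr fun k => ?_
    rw [abs_of_nonneg (by positivity), abs_of_pos (inv_pos.mpr (Real.Gamma_pos_of_pos
      (by positivity))), mul_pow, ← Real.rpow_natCast (t ^ α), ← Real.rpow_mul ht.le,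
      show α * (k : ℝ) + (β + γ) - 1 = (β + γ - 1) + α * k by ring, Real.rpow_add ht]
    ring
  have h := hasSum_integral_of_summable_integral_norm (μ := volume.restrict (Ioc 0 t)) hFint hsum
  rw [intervalIntegral.integral_of_le ht.le, mlKernel_eq_tsum _ _ ht]
  simp only [hF, hval] at h
  rw [h.tsum_eq]
  refine setIntegral_congr_fun measurableSet_Ioc fun r hr => ?_
  rw [mlKernel_eq_tsum _ _ hr.1, ← tsum_mul_right]
  refine tsum_congr fun k => ?_
  have := (hGk k).ne'
  field_simp

/-! ### Kernels of positive type -/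

/-- With `V(t) = ∫_0^t e^{sr} u(r) dr` the integrand is the derivative of `e^{-2st} V²/2` plus `s
e^{-2st} V²`, so the double integral is a final energy plus a dissipation. -/
theorem integral_exp_kernel_nonneg {u : ℝ → ℝ} (hu : Continuous u) {T s : ℝ} (hT : 0 ≤ T)
    (hs : 0 ≤ s) : 0 ≤ ∫ t in 0..T, u t * ∫ r in 0..t, u r * Real.exp (-(s * (t - r))) := by
  set V : ℝ → ℝ := fun t => ∫ r in 0..t, Real.exp (s * r) * u r with hVdef
  have hcont : Continuous fun r => Real.exp (s * r) * u r := by fun_prop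
  have hV : ∀ t, HasDerivAt V (Real.exp (s * t) * u t) t := fun t =>
    intervalIntegral.integral_hasDerivAt_right (hcont.intervalIntegrable _ _)
      hcont.aestronglyMeasurable.stronglyMeasurableAtFilter hcont.continuousAt
  have hVc : Continuous V := continuous_iff_continuousAt.mpr fun t => (hV t).continuousAt
  have hinner : ∀ t, ∫ r in 0..t, u r * Real.exp (-(s * (t - r))) = Real.exp (-(s * t)) * V t := by
    intro t
    rw [hVdef, ← intervalIntegral.integral_const_mul]
    refine intervalIntegral.integral_congr fun r _ => ?_
    change u r * Real.exp (-(s * (t - r))) = Real.exp (-(s * t)) * (Real.exp (s * r) * u r)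
    rw [show -(s * (t - r)) = -(s * t) + s * r by ring, Real.exp_add]
    ring
  simp_rw [hinner]
  have hG : ∀ t, HasDerivAt (fun t => Real.exp (-(2 * s * t)) * (V t ^ 2 / 2))
      (u t * (Real.exp (-(s * t)) * V t) - s * (Real.exp (-(2 * s * t)) * V t ^ 2)) t := by
    intro t
    have h1 : HasDerivAt (fun t => Real.exp (-(2 * s * t)))
        (Real.exp (-(2 * s * t)) * -(2 * s)) t := by
      have := ((hasDerivAt_id t).const_mul (2 * s)).neg.exp
      simpa using this
    refine (h1.mul (((hV t).fun_pow 2).div_const 2)).congr_deriv ?_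
    have : Real.exp (-(2 * s * t)) = Real.exp (-(s * t)) * Real.exp (-(s * t)) := by
      rw [← Real.exp_add]; ring_nf
    have h3 : Real.exp (-(s * t)) * Real.exp (s * t) = 1 := by
      rw [← Real.exp_add]; simp
    rw [this]
    push_cast
    linear_combination (Real.exp (-(s * t)) * V t * u t) * h3
  have hint1 : IntervalIntegrable (fun t => u t * (Real.exp (-(s * t)) * V t)) volume 0 T :=
    (by fun_prop : Continuous _).intervalIntegrable _ _
  have hint2 : IntervalIntegrable (fun t => s * (Real.exp (-(2 * s * t)) * V t ^ 2)) volume 0 T :=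
    (by fun_prop : Continuous _).intervalIntegrable _ _
  have hFTC := intervalIntegral.integral_eq_sub_of_hasDerivAt (fun t _ => hG t) (hint1.sub hint2)
  rw [intervalIntegral.integral_sub hint1 hint2] at hFTC
  have hV0 : V 0 = 0 := by simp [hVdef]
  have hpos : 0 ≤ ∫ t in 0..T, s * (Real.exp (-(2 * s * t)) * V t ^ 2) :=
    intervalIntegral.integral_nonneg hT fun t _ => by positivity
  have : 0 ≤ Real.exp (-(2 * s * T)) * (V T ^ 2 / 2) := by positivity
  rw [hV0] at hFTC
  linarith

theorem integral_triangle_eq (f : ℝ → ℝ → ℝ) {T : ℝ} (hT : 0 ≤ T) :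
    ∫ t in Ioc 0 T, ∫ r in Ioc 0 T, (if r < t then f t r else 0) =
      ∫ t in 0..T, ∫ r in 0..t, f t r := by
  rw [intervalIntegral.integral_of_le hT]
  refine setIntegral_congr_fun measurableSet_Ioc fun t ht => ?_
  rw [intervalIntegral.integral_of_le ht.1.le,
    show ∫ r in Ioc 0 t, f t r = ∫ r in Ioo 0 t, f t r from integral_Ioc_eq_integral_Ioo, ← integral_indicator measurableSet_Ioo, ← integral_indicator measurableSet_Ioc]
  refine integral_congr_ae (Eventually.of_forall fun r => ?_)
  have := ht.2
  by_cases h1 : r < t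
  · have h3 : r ≤ T := h1.le.trans this
    by_cases h2 : 0 < r <;> simp [indicator, h1, h2, h3]
  · simp [indicator, h1]

/-- Fractional integration of order in `(0,1)` is an operator of positive type. -/
theorem integral_rpow_kernel_nonneg {u : ℝ → ℝ} (hu : Continuous u) {T γ : ℝ} (hT : 0 ≤ T)
    (hγ₀ : 0 < γ) (hγ₁ : γ < 1) : 0 ≤ ∫ t in 0..T, u t * ∫ r in 0..t, u r * (t - r) ^ (γ - 1) := by
  set μ : Measure ℝ := volume.restrict (Ioc 0 T)
  set ν : Measure ℝ := volume.restrict (Ioi 0)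
  -- The kernel is a positive mixture of exponentials: `Γ(1-γ) τ^(γ-1) = ∫_0^∞ s^(-γ) e^{-τs} ds`.
  -- After Fubini the claim holds for each `s` separately.
  set F : ℝ × ℝ → ℝ → ℝ := fun p s =>
    if p.2 < p.1 then u p.1 * (u p.2 * (s ^ (-γ) * Real.exp (-((p.1 - p.2) * s)))) else 0 with hF
  have hΓ : 0 < Real.Gamma (1 - γ) := Real.Gamma_pos_of_pos (by linarith)
  have hs : ∀ τ : ℝ, 0 < τ → ∫ s in Ioi (0 : ℝ), s ^ (-γ) * Real.exp (-(τ * s)) =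
      τ ^ (γ - 1) * Real.Gamma (1 - γ) := by
    intro τ hτ
    have := Real.integral_rpow_mul_exp_neg_mul_Ioi (a := 1 - γ) (by linarith) hτ
    rw [show 1 - γ - 1 = -γ by ring] at this
    rw [this, one_div, Real.inv_rpow hτ.le, ← Real.rpow_neg hτ.le, neg_sub]
  have hsi : ∀ τ : ℝ, 0 < τ →
      IntegrableOn (fun s => s ^ (-γ) * Real.exp (-(τ * s))) (Ioi 0) := by
    intro τ hτ
    by_contra hcon
    have h := integral_undef hcon
    rw [hs τ hτ] at h
    exact (mul_pos (Real.rpow_pos_of_pos hτ _) hΓ).ne' h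
  obtain ⟨M, hM⟩ := (isCompact_Icc (a := (0 : ℝ)) (b := T)).exists_bound_of_continuousOn
    hu.continuousOn
  have hFmeas : Measurable (Function.uncurry F) := by
    refine Measurable.ite (measurableSet_lt (by fun_prop) (by fun_prop)) ?_ measurable_const
    have := hu.measurable
    fun_prop
  have hFint : Integrable (Function.uncurry F) ((μ.prod μ).prod ν) := by
    rw [integrable_prod_iff hFmeas.aestronglyMeasurable]
    constructor
    · refine Eventually.of_forall fun p => ?_
      by_cases hp : p.2 < p.1
      · simp only [Function.uncurry, hF, hp, if_true]
        exact ((hsi _ (sub_pos.mpr hp)).const_mul _).const_mul _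
      · simp [Function.uncurry, hF, hp]
    -- Once `s` is integrated out, the majorant is a multiple of `(t-r)^(γ-1)` on the triangle. This
    -- is the integrand of a convolution of two integrable functions.
    · have hk : Integrable (fun p : ℝ × ℝ => ContinuousLinearMap.mul ℝ ℝ
          ((Ioc 0 T).indicator (fun _ => (1 : ℝ)) p.2)
          ((Ioc 0 T).indicator (fun τ : ℝ => τ ^ (γ - 1)) (p.1 - p.2)))
          (volume.prod volume) := by
        refine Integrable.convolution_integrand _ ?_ ?_
        · rw [integrable_indicator_iff measurableSet_Ioc]
          exact integrableOn_const (by simp)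
        · rw [integrable_indicator_iff measurableSet_Ioc,
            ← intervalIntegrable_iff_integrableOn_Ioc_of_le hT]
          exact intervalIntegral.intervalIntegrable_rpow' (by linarith)
      have hk' := (hk.integrableOn (s := Ioc 0 T ×ˢ Ioc 0 T)).const_mul (M * M * Real.Gamma (1 - γ))
      change Integrable _ ((volume.prod volume).restrict _) at hk'
      rw [← Measure.prod_restrict] at hk'
      refine hk'.mono' (hFmeas.aestronglyMeasurable.norm.integral_prod_right') ?_
      have hae : ∀ᵐ p : ℝ × ℝ ∂(μ.prod μ), p ∈ Ioc 0 T ×ˢ Ioc 0 T := by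
        rw [Measure.prod_restrict]
        exact ae_restrict_mem (measurableSet_Ioc.prod measurableSet_Ioc)
      filter_upwards [hae] with p hp
      obtain ⟨hp1, hp2⟩ := hp
      rw [Real.norm_of_nonneg (integral_nonneg fun _ => norm_nonneg _)]
      by_cases h : p.2 < p.1
      · have hτ : 0 < p.1 - p.2 := sub_pos.mpr h
        have hmem : p.1 - p.2 ∈ Ioc 0 T := ⟨hτ, by linarith [hp1.2, hp2.1]⟩
        simp only [Function.uncurry, hF, h, if_true, indicator_of_mem hp2, indicator_of_mem hmem,
          ContinuousLinearMap.mul_apply', one_mul, norm_mul]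
        rw [integral_const_mul, integral_const_mul]
        have : ∫ s in Ioi (0 : ℝ), ‖s ^ (-γ)‖ * ‖Real.exp (-((p.1 - p.2) * s))‖ =
            (p.1 - p.2) ^ (γ - 1) * Real.Gamma (1 - γ) := by
          rw [← hs _ hτ]
          refine setIntegral_congr_fun measurableSet_Ioi fun s hs => ?_
          simp [abs_of_nonneg (Real.rpow_nonneg (le_of_lt hs) _)]
        rw [this]
        have h1 := hM p.1 (Ioc_subset_Icc_self hp1)
        have h2 := hM p.2 (Ioc_subset_Icc_self hp2)
        have h3 : 0 ≤ (p.1 - p.2) ^ (γ - 1) := Real.rpow_nonneg hτ.le _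
        have hM0 : 0 ≤ M := (norm_nonneg _).trans h1
        calc _ ≤ M * (M * ((p.1 - p.2) ^ (γ - 1) * Real.Gamma (1 - γ))) := by gcongr
          _ = _ := by ring
      · have hmem : p.1 - p.2 ∉ Ioc 0 T := fun hh => h (sub_pos.mp hh.1)
        simp [Function.uncurry, hF, h]
  have hswap := integral_integral_swap hFint
  have hL : ∫ p, ∫ s, F p s ∂ν ∂(μ.prod μ) = Real.Gamma (1 - γ) *
      ∫ t in 0..T, u t * ∫ r in 0..t, u r * (t - r) ^ (γ - 1) := by
    refine (integral_prod _ hFint.integral_prod_left).trans ?_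
    simp only [Function.uncurry]
    simp_rw [← intervalIntegral.integral_const_mul]
    rw [← integral_triangle_eq _ hT]
    refine integral_congr_ae (Eventually.of_forall fun t => integral_congr_ae
      (Eventually.of_forall fun r => ?_))
    by_cases h : r < t
    · simp only [hF, h, if_true]
      rw [integral_const_mul, integral_const_mul, hs _ (sub_pos.mpr h)]
      ring
    · simp [hF, h]
  have hR : 0 ≤ ∫ s, ∫ p, F p s ∂(μ.prod μ) ∂ν := by
    refine integral_nonneg_of_ae ?_
    filter_upwards [ae_restrict_mem measurableSet_Ioi, hFint.prod_left_ae] with s hs0 hsint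
    change 0 ≤ ∫ p, F p s ∂(μ.prod μ)
    rw [integral_prod (fun p => F p s) hsint]
    have : ∫ t, ∫ r, F (t, r) s ∂μ ∂μ = s ^ (-γ) *
        ∫ t in 0..T, u t * ∫ r in 0..t, u r * Real.exp (-(s * (t - r))) := by
      simp_rw [← intervalIntegral.integral_const_mul]
      rw [← integral_triangle_eq _ hT]
      refine integral_congr_ae (Eventually.of_forall fun t => integral_congr_ae
        (Eventually.of_forall fun r => ?_))
      by_cases h : r < t
      · simp only [hF, h, if_true, mul_comm s]
        ring
      · simp [hF, h]
    rw [this]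
    exact mul_nonneg (Real.rpow_nonneg (le_of_lt hs0) _)
      (integral_exp_kernel_nonneg hu hT (le_of_lt hs0))
  rw [← hswap, hL] at hR
  exact nonneg_of_mul_nonneg_right hR hΓ

/-! ### Bounds for the Mittag-Leffler function on the negative half line -/

theorem continuous_mlKernel {α β : ℝ} (hα : 0 < α) (hβ : 1 ≤ β) (μ : ℝ) :
    Continuous (mlKernel α β μ) := by
  have h1 := Real.continuous_rpow_const (q := β - 1) (by linarith)
  have h2 := Real.continuous_rpow_const (q := α) hα.le
  exact h1.mul ((continuous_mittagLeffler hα β).comp (h2.const_mul μ).neg)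

theorem mlKernel_one (α β μ : ℝ) : mlKernel α β μ 1 = mittagLeffler α β (-μ) := by
  simp [mlKernel]

/-- Energy estimate. The kernel `e` of parameter `β` satisfies `e = g - x J^α e` with `g =
t^(β-1)/Γ(β)`. Pairing with `e` on `[0,1]`, the term with `x` has a favourable sign because `J^α` is
of positive type, and `∫ e² ≤ ∫ e g` bounds `e` in `L²` uniformly in `x`. The integral of `e` over
`[0,1]` is the value with parameter `β + 1`. -/
theorem abs_mittagLeffler_le_of_le_one {α β x : ℝ} (hα₀ : 0 < α) (hα₁ : α ≤ 1) (hβ : 2 ≤ β)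
    (hx : 0 ≤ x) : |mittagLeffler α (β + 1) (-x)| ≤ 1 + ((Real.Gamma β)⁻¹) ^ 2 := by
  have hG : 0 < Real.Gamma β := Real.Gamma_pos_of_pos (by linarith)
  set e := mlKernel α β x with he
  have hec : Continuous e := continuous_mlKernel hα₀ (by linarith) x
  have hec' : Continuous (mlKernel α (α + β) x) := continuous_mlKernel hα₀ (by linarith) x
  have hgc : Continuous fun t : ℝ => t ^ (β - 1) / Real.Gamma β :=
    (Real.continuous_rpow_const (by linarith)).div_const _
  have hpos : 0 ≤ ∫ t in 0..1, e t * mlKernel α (α + β) x t := by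
    have h1 : 0 ≤ ∫ t in 0..1, e t * ∫ r in 0..t, e r * (t - r) ^ (α - 1) := by
      rcases hα₁.lt_or_eq with h | rfl
      · exact integral_rpow_kernel_nonneg hec zero_le_one hα₀ h
      -- For `α = 1` the kernel of `J^α` is constant, the exponential kernel with `s = 0`.
      · simpa using integral_exp_kernel_nonneg hec zero_le_one le_rfl
    have h2 : ∫ t in 0..1, e t * mlKernel α (α + β) x t =
        (Real.Gamma α)⁻¹ * ∫ t in 0..1, e t * ∫ r in 0..t, e r * (t - r) ^ (α - 1) := by
      rw [← intervalIntegral.integral_const_mul, intervalIntegral.integral_of_le zero_le_one,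
        intervalIntegral.integral_of_le zero_le_one]
      refine setIntegral_congr_fun measurableSet_Ioc fun t ht => ?_
      have := mlKernel_conv hα₀ (by linarith : 0 < β) hα₀ x ht.1
      rw [add_comm β α] at this
      rw [← this]
      simp_rw [← mul_div_assoc]
      rw [intervalIntegral.integral_div]
      ring
    rw [h2]
    exact mul_nonneg (inv_nonneg.mpr (Real.Gamma_pos_of_pos hα₀).le) h1
  have hsq : ∫ t in 0..1, e t ^ 2 ≤ ((Real.Gamma β)⁻¹) ^ 2 := by
    have h1 : ∫ t in 0..1, e t ^ 2 = (∫ t in 0..1, e t * (t ^ (β - 1) / Real.Gamma β)) -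
        x * ∫ t in 0..1, e t * mlKernel α (α + β) x t := by
      rw [← intervalIntegral.integral_const_mul, ← intervalIntegral.integral_sub
        ((hec.fun_mul hgc).intervalIntegrable _ _)
        (((hec.fun_mul hec').const_mul x).intervalIntegrable _ _),
        intervalIntegral.integral_of_le zero_le_one,
        intervalIntegral.integral_of_le zero_le_one]
      refine setIntegral_congr_fun measurableSet_Ioc fun t ht => ?_
      have := mlKernel_succ hα₀ β x ht.1
      rw [← he] at this
      linear_combination e t * this
    have h2 : ∫ t in 0..1, e t * (t ^ (β - 1) / Real.Gamma β) ≤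
        ∫ t in (0 : ℝ)..1, (e t ^ 2 / 2 + ((Real.Gamma β)⁻¹) ^ 2 / 2) := by
      refine intervalIntegral.integral_mono_on zero_le_one ((hec.mul hgc).intervalIntegrable _ _)
        ((by fun_prop : Continuous _).intervalIntegrable _ _) fun t ht => ?_
      have h3 : t ^ (β - 1) ≤ 1 := Real.rpow_le_one ht.1 ht.2 (by linarith)
      have h4 : 0 ≤ t ^ (β - 1) := Real.rpow_nonneg ht.1 _
      have h5 : (t ^ (β - 1)) ^ 2 ≤ 1 := pow_le_one₀ h4 h3
      rw [div_eq_mul_inv]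
      set c := (Real.Gamma β)⁻¹
      nlinarith [sq_nonneg (e t - t ^ (β - 1) * c), mul_le_mul_of_nonneg_right h5 (sq_nonneg c)]
    rw [intervalIntegral.integral_add ((by fun_prop : Continuous _).intervalIntegrable _ _)
      (by simp), intervalIntegral.integral_div] at h2
    simp only [intervalIntegral.integral_const, sub_zero, one_smul] at h2
    nlinarith [mul_nonneg hx hpos]
  have hconv := mlKernel_conv hα₀ (by linarith : 0 < β) one_pos x one_pos
  rw [mlKernel_one] at hconv
  simp only [sub_self, Real.rpow_zero, Real.Gamma_one, div_one, mul_one] at hconv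
  rw [← hconv]
  calc |∫ r in 0..1, e r| ≤ ∫ r in (0 : ℝ)..1, (1 + e r ^ 2) := by
        refine (intervalIntegral.abs_integral_le_integral_abs zero_le_one).trans ?_
        refine intervalIntegral.integral_mono_on zero_le_one (hec.abs.intervalIntegrable _ _)
          ((by fun_prop : Continuous _).intervalIntegrable _ _) fun t _ => ?_
        nlinarith [sq_abs (e t), sq_nonneg (|e t| - 1)]
    _ = 1 + ∫ r in (0 : ℝ)..1, e r ^ 2 := by
        rw [intervalIntegral.integral_add (by simp)
          ((by fun_prop : Continuous _).intervalIntegrable _ _)]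
        simp
    _ ≤ _ := by linarith

/-- For `α > 1` the positivity is applied to `J^(α-1)` instead. The kernel `e` of parameter `β + 1`
has derivative `f = g - x J^(α-1) e`, and integrating `e f = (e²/2)'` gives `e(T)²/2 ≤ ∫_0^T e g`
for every `T`. -/
theorem abs_mittagLeffler_le_of_one_lt {α β x : ℝ} (hα₁ : 1 < α) (hα₂ : α < 2) (hβ : 2 ≤ β)
    (hx : 0 ≤ x) : |mittagLeffler α (β + 1) (-x)| ≤ 2 * (Real.Gamma β)⁻¹ := by
  have hα₀ : 0 < α := by linarith
  have hG : 0 < Real.Gamma β := Real.Gamma_pos_of_pos (by linarith)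
  set f := mlKernel α β x with hf
  set e := mlKernel α (β + 1) x with he
  set g : ℝ → ℝ := fun t => t ^ (β - 1) / Real.Gamma β with hg
  have hfc : Continuous f := continuous_mlKernel hα₀ (by linarith) x
  have hec : Continuous e := continuous_mlKernel hα₀ (by linarith) x
  have hec' : Continuous (mlKernel α (α + β) x) := continuous_mlKernel hα₀ (by linarith) x
  have hgc : Continuous g := (Real.continuous_rpow_const (by linarith)).div_const _
  have hconv : ∀ t, 0 ≤ t → e t = ∫ r in 0..t, f r := by
    intro t ht
    rcases ht.eq_or_lt with rfl | ht
    · rw [intervalIntegral.integral_same, he, mlKernel, Real.zero_rpow (by linarith), zero_mul]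
    · have := mlKernel_conv hα₀ (by linarith : 0 < β) one_pos x ht
      simpa using this.symm
  have hpos : ∀ T, 0 ≤ T → 0 ≤ ∫ t in 0..T, e t * mlKernel α (α + β) x t := by
    intro T hT
    have h1 := integral_rpow_kernel_nonneg hec hT (γ := α - 1) (by linarith) (by linarith)
    have h2 : ∫ t in 0..T, e t * mlKernel α (α + β) x t = (Real.Gamma (α - 1))⁻¹ *
        ∫ t in 0..T, e t * ∫ r in 0..t, e r * (t - r) ^ (α - 1 - 1) := by
      rw [← intervalIntegral.integral_const_mul, intervalIntegral.integral_of_le hT,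
        intervalIntegral.integral_of_le hT]
      refine setIntegral_congr_fun measurableSet_Ioc fun t ht => ?_
      have := mlKernel_conv hα₀ (by linarith : 0 < β + 1) (by linarith : 0 < α - 1) x ht.1
      rw [show β + 1 + (α - 1) = α + β by ring] at this
      rw [← this]
      simp_rw [← mul_div_assoc]
      rw [intervalIntegral.integral_div]
      ring
    rw [h2]
    exact mul_nonneg (inv_nonneg.mpr (Real.Gamma_pos_of_pos (by linarith)).le) h1
  have henergy : ∀ T, 0 ≤ T → e T ^ 2 / 2 ≤ ∫ t in 0..T, e t * g t := by
    intro T hT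
    have hd : ∀ t, HasDerivAt (fun t => ∫ r in 0..t, f r) (f t) t := fun t =>
      intervalIntegral.integral_hasDerivAt_right (hfc.intervalIntegrable _ _)
        hfc.aestronglyMeasurable.stronglyMeasurableAtFilter hfc.continuousAt
    have hFTC := intervalIntegral.integral_eq_sub_of_hasDerivAt (a := 0) (b := T)
      (f := fun t => (∫ r in 0..t, f r) ^ 2 / 2) (f' := fun t => (∫ r in 0..t, f r) * f t)
      (fun t _ => (((hd t).fun_pow 2).div_const 2).congr_deriv (by push_cast; ring))
      ((((continuous_iff_continuousAt.mpr fun t => (hd t).continuousAt)).mul hfc).intervalIntegrable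
        _ _)
    simp only [intervalIntegral.integral_same] at hFTC
    rw [← hconv T hT] at hFTC
    have h1 : ∫ t in 0..T, (∫ r in 0..t, f r) * f t = (∫ t in 0..T, e t * g t) -
        x * ∫ t in 0..T, e t * mlKernel α (α + β) x t := by
      rw [← intervalIntegral.integral_const_mul, ← intervalIntegral.integral_sub
        ((hec.fun_mul hgc).intervalIntegrable _ _)
        (((hec.fun_mul hec').const_mul x).intervalIntegrable _ _),
        intervalIntegral.integral_of_le hT, intervalIntegral.integral_of_le hT]
      refine setIntegral_congr_fun measurableSet_Ioc fun t ht => ?_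
      have := mlKernel_succ hα₀ β x ht.1
      rw [← hf] at this
      rw [← hconv t ht.1.le]
      linear_combination e t * this
    rw [h1] at hFTC
    nlinarith [mul_nonneg hx (hpos T hT)]
  -- At a maximum point of `|e|` the energy inequality reads `|e(T)|²/2 ≤ |e(T)|/Γ(β)` and closes on
  -- itself.
  obtain ⟨T, hT, hmax⟩ := (isCompact_Icc (a := (0 : ℝ)) (b := 1)).exists_isMaxOn
    (nonempty_Icc.mpr zero_le_one) hec.abs.continuousOn
  have hle : ∀ t ∈ Icc (0 : ℝ) 1, |e t| ≤ |e T| := fun t ht => hmax ht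
  have hint : ∫ t in 0..T, e t * g t ≤ |e T| * (Real.Gamma β)⁻¹ := by
    calc ∫ t in 0..T, e t * g t ≤ ∫ _ in 0..T, |e T| * (Real.Gamma β)⁻¹ := by
          refine intervalIntegral.integral_mono_on hT.1 ((hec.mul hgc).intervalIntegrable _ _)
            (by simp) fun t ht => ?_
          have ht1 : t ≤ 1 := ht.2.trans hT.2
          have h3 : t ^ (β - 1) ≤ 1 := Real.rpow_le_one ht.1 ht1 (by linarith)
          have h4 : 0 ≤ t ^ (β - 1) := Real.rpow_nonneg ht.1 _
          have h5 : g t ≤ (Real.Gamma β)⁻¹ := by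
            change t ^ (β - 1) / Real.Gamma β ≤ _
            rw [div_eq_mul_inv]
            exact mul_le_of_le_one_left (inv_pos.mpr hG).le h3
          have h6 : 0 ≤ g t := div_nonneg h4 hG.le
          calc e t * g t ≤ |e t| * g t := by gcongr; exact le_abs_self _
            _ ≤ _ := mul_le_mul (hle t ⟨ht.1, ht1⟩) h5 h6 (abs_nonneg _)
      _ ≤ _ := by
          simp only [intervalIntegral.integral_const, sub_zero, smul_eq_mul]
          exact mul_le_of_le_one_left (by positivity) hT.2
  have hfin := (henergy T hT.1).trans hint
  rw [← sq_abs] at hfin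
  have hbound : |e T| ≤ 2 * (Real.Gamma β)⁻¹ := by
    by_contra! hcon
    have hTp : 0 < |e T| := lt_trans (by positivity) hcon
    nlinarith
  rw [← mlKernel_one]
  exact (hle 1 (by simp)).trans hbound

/-- For every `β`, `E_{α,β}` has polynomial growth on the negative half line. -/
theorem exists_abs_mittagLeffler_le {α : ℝ} (hα₀ : 0 < α) (hα₂ : α < 2) (β : ℝ) :
    ∃ (k : ℕ) (C : ℝ), 0 ≤ C ∧ ∀ z ≤ 0, |mittagLeffler α β z| ≤ C * (1 + |z|) ^ k := by
  -- `m` counts the steps `β ↦ α + β` that lead to a parameter `≥ 3`, where the energy estimates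
  -- apply; each step costs one power of `|z|`.
  have main : ∀ (m : ℕ) (β : ℝ), 3 ≤ β + α * m →
      ∃ (k : ℕ) (C : ℝ), 0 ≤ C ∧ ∀ z ≤ 0, |mittagLeffler α β z| ≤ C * (1 + |z|) ^ k := by
    intro m
    induction m with
    | zero =>
      intro β hβ
      rw [Nat.cast_zero, mul_zero, add_zero] at hβ
      rcases le_or_gt α 1 with h | h
      · refine ⟨0, 1 + ((Real.Gamma (β - 1))⁻¹) ^ 2, by positivity, fun z hz => ?_⟩
        have := abs_mittagLeffler_le_of_le_one hα₀ h (by linarith : 2 ≤ β - 1) (neg_nonneg.mpr hz)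
        simpa using this
      · refine ⟨0, 2 * (Real.Gamma (β - 1))⁻¹, by
          have := Real.Gamma_pos_of_pos (by linarith : 0 < β - 1); positivity, fun z hz => ?_⟩
        have := abs_mittagLeffler_le_of_one_lt h hα₂ (by linarith : 2 ≤ β - 1) (neg_nonneg.mpr hz)
        simpa using this
    | succ m ih =>
      intro β hβ
      obtain ⟨k, C, hC, h⟩ := ih (α + β) (by push_cast at hβ; linarith)
      refine ⟨k + 1, |(Real.Gamma β)⁻¹| + C, by positivity, fun z hz => ?_⟩
      rw [mittagLeffler_succ hα₀]
      have h1 : 1 ≤ (1 + |z|) ^ (k + 1) := one_le_pow₀ (by simp)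
      calc |(Real.Gamma β)⁻¹ + z * mittagLeffler α (α + β) z|
          ≤ |(Real.Gamma β)⁻¹| + |z| * |mittagLeffler α (α + β) z| := by
            rw [← abs_mul]; exact abs_add_le _ _
        _ ≤ |(Real.Gamma β)⁻¹| * (1 + |z|) ^ (k + 1) + (1 + |z|) * (C * (1 + |z|) ^ k) := by
            gcongr
            · exact le_mul_of_one_le_right (abs_nonneg _) h1
            · linarith
            · exact h z hz
        _ = _ := by ring
  obtain ⟨m, hm⟩ := exists_nat_ge ((3 - β) / α)
  rw [div_le_iff₀ hα₀] at hm
  exact main m β (by linarith)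

theorem contDiff_mittagLeffler {α : ℝ} (hα : 0 < α) (n : ℕ) :
    ∀ β, ContDiff ℝ n (mittagLeffler α β) := by
  induction n with
  | zero => exact fun β => contDiff_zero.mpr (continuous_mittagLeffler hα β)
  | succ n ih =>
    intro β
    push_cast
    rw [contDiff_succ_iff_deriv]
    refine ⟨fun z => (hasDerivAt_mittagLeffler hα β z).differentiableAt, by simp, ?_⟩
    rw [funext fun z => (hasDerivAt_mittagLeffler hα β z).deriv]
    exact contDiff_const.mul ((ih _).sub (contDiff_const.mul (ih _)))

theorem exists_abs_iteratedDeriv_mittagLeffler_le {α : ℝ} (hα₀ : 0 < α) (hα₂ : α < 2) (n : ℕ) :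
    ∀ β, ∃ (k : ℕ) (C : ℝ), 0 ≤ C ∧
      ∀ z ≤ 0, |iteratedDeriv n (mittagLeffler α β) z| ≤ C * (1 + |z|) ^ k := by
  induction n with
  | zero => simpa using exists_abs_mittagLeffler_le hα₀ hα₂
  | succ n ih =>
    intro β
    obtain ⟨k₁, C₁, hC₁, h₁⟩ := ih (α + β - 1)
    obtain ⟨k₂, C₂, hC₂, h₂⟩ := ih (α + β)
    refine ⟨k₁ + k₂, α⁻¹ * (C₁ + |β - 1| * C₂), by positivity, fun z hz => ?_⟩
    rw [iteratedDeriv_succ', funext fun z => (hasDerivAt_mittagLeffler hα₀ β z).deriv]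
    have e1 := (contDiff_mittagLeffler hα₀ n (α + β - 1)).contDiffAt (x := z)
    have e2 := (contDiff_mittagLeffler hα₀ n (α + β)).contDiffAt (x := z)
    rw [iteratedDeriv_const_mul_field, iteratedDeriv_fun_sub e1 (contDiffAt_const.mul e2),
      iteratedDeriv_const_mul_field, abs_mul, abs_of_pos (inv_pos.mpr hα₀), mul_assoc]
    gcongr
    have hz1 : 1 ≤ 1 + |z| := by simp
    calc _ ≤ |iteratedDeriv n (mittagLeffler α (α + β - 1)) z| +
          |β - 1| * |iteratedDeriv n (mittagLeffler α (α + β)) z| := by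
          rw [← abs_mul]; exact abs_sub _ _
      _ ≤ C₁ * (1 + |z|) ^ (k₁ + k₂) + |β - 1| * (C₂ * (1 + |z|) ^ (k₁ + k₂)) := by
          gcongr
          · exact (h₁ z hz).trans (by gcongr; omega)
          · exact (h₂ z hz).trans (by gcongr; omega)
      _ = _ := by ring

/-- The composition is taken relative to `Iic 0`, the range of `-‖y‖²`, since polynomial bounds are
known only there. -/
theorem hasTemperateGrowth_mittagLeffler_neg_norm_sq {H : Type*} [NormedAddCommGroup H]
    [InnerProductSpace ℝ H] {α : ℝ} (hα₀ : 0 < α) (hα₂ : α < 2) (β : ℝ) :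
    Function.HasTemperateGrowth fun y : H => mittagLeffler α β (-‖y‖ ^ 2) := by
  have hsmooth : ContDiff ℝ (⊤ : ℕ∞) (mittagLeffler α β) :=
    contDiff_infty.mpr fun n => contDiff_mittagLeffler hα₀ n β
  refine Function.HasTemperateGrowth.comp' (t := Iic 0) (g := mittagLeffler α β)
    (f := fun y : H => -‖y‖ ^ 2) ?_ (uniqueDiffOn_Iic 0) hsmooth.contDiffOn ?_
    (Function.hasTemperateGrowth_norm_sq H).neg
  · rintro _ ⟨y, rfl⟩
    simp
  · intro N
    choose k C hC h using fun n => exists_abs_iteratedDeriv_mittagLeffler_le hα₀ hα₂ n β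
    refine ⟨∑ n ∈ Finset.range (N + 1), k n, ∑ n ∈ Finset.range (N + 1), C n,
      Finset.sum_nonneg fun n _ => hC n, fun n hn x hx => ?_⟩
    have hmem : n ∈ Finset.range (N + 1) := Finset.mem_range.mpr (by omega)
    rw [norm_iteratedFDerivWithin_eq_norm_iteratedDerivWithin,
      iteratedDerivWithin_eq_iteratedDeriv (uniqueDiffOn_Iic 0)
        ((contDiff_mittagLeffler hα₀ n β).contDiffAt) hx]
    refine (h n x hx).trans ?_
    have hx1 : 1 ≤ 1 + ‖x‖ := by simp
    have h1 : C n ≤ ∑ n ∈ Finset.range (N + 1), C n :=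
      Finset.single_le_sum (fun i _ => hC i) hmem
    have h2 : k n ≤ ∑ n ∈ Finset.range (N + 1), k n :=
      Finset.single_le_sum (fun i _ => Nat.zero_le _) hmem
    rw [← Real.norm_eq_abs]
    have := hC n
    have := this.trans h1
    gcongr

/-! ### Integrals of families of Schwartz functions -/

section Family

variable {T : Type*} [MeasurableSpace T] {ν : Measure T}
variable {D V E F : Type*} [NormedAddCommGroup D] [NormedSpace ℝ D] [NormedAddCommGroup V]
  [NormedSpace ℝ V] [NormedAddCommGroup E] [NormedSpace ℝ E] [NormedAddCommGroup F]
  [NormedSpace ℝ F]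

/-- Directional derivatives are limits of difference quotients along a sequence; in finite dimension
the derivative is assembled from those along a basis. -/
theorem aestronglyMeasurable_fderiv_family [FiniteDimensional ℝ E] {g : T → E → F}
    (hmeas : ∀ x, AEStronglyMeasurable (fun τ => g τ x) ν)
    (hd : ∀ τ, Differentiable ℝ (g τ)) (x : E) :
    AEStronglyMeasurable (fun τ => fderiv ℝ (g τ) x) ν := by
  set b := Module.finBasis ℝ E
  have hdir : ∀ v, AEStronglyMeasurable (fun τ => fderiv ℝ (g τ) x v) ν := by
    intro v
    refine aestronglyMeasurable_of_tendsto_ae (u := atTop)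
      (f := fun (n : ℕ) τ => ((n : ℝ) + 1) • (g τ (x + ((n : ℝ) + 1)⁻¹ • v) - g τ x)) ?_ ?_
    · exact fun n => ((hmeas _).sub (hmeas _)).const_smul _
    · refine Eventually.of_forall fun τ => ?_
      have h := (hd τ x).hasFDerivAt.lim (v := v) (c := fun n : ℕ => (n : ℝ) + 1)
        (l := atTop) ?_
      · exact h
      · exact tendsto_norm_atTop_atTop.comp
          ((tendsto_natCast_atTop_atTop (R := ℝ)).atTop_add tendsto_const_nhds)
  have hsum : (fun τ => fderiv ℝ (g τ) x) = fun τ => ∑ i,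
      ((b.coord i).toContinuousLinearMap).smulRight (fderiv ℝ (g τ) x (b i)) := by
    ext τ v
    conv_lhs => rw [← b.sum_repr v, map_sum]
    simp
  rw [hsum]
  refine Finset.aestronglyMeasurable_fun_sum _ fun i _ => ?_
  exact (ContinuousLinearMap.smulRightL ℝ E F
    ((b.coord i).toContinuousLinearMap)).continuous.comp_aestronglyMeasurable (hdir _)

theorem aestronglyMeasurable_iteratedFDeriv_family [FiniteDimensional ℝ E] {f : T → 𝓢(E, F)}
    (hmeas : ∀ x, AEStronglyMeasurable (fun τ => f τ x) ν) (n : ℕ) :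
    ∀ x, AEStronglyMeasurable (fun τ => iteratedFDeriv ℝ n (f τ) x) ν := by
  induction n with
  | zero =>
    intro x
    simp only [iteratedFDeriv_zero_eq_comp, Function.comp_def]
    exact (LinearIsometryEquiv.continuous _).comp_aestronglyMeasurable (hmeas x)
  | succ n ih =>
    intro x
    simp only [iteratedFDeriv_succ_eq_comp_left, Function.comp_def]
    refine (LinearIsometryEquiv.continuous _).comp_aestronglyMeasurable
      (aestronglyMeasurable_fderiv_family ih (fun τ => ?_) x)
    exact ((f τ).smooth ⊤).differentiable_iteratedFDeriv (mod_cast ENat.natCast_lt_top _)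

/-- Differentiation under the integral sign, order by order: the bound for order `n + 1` dominates
the derivative of order `n`. -/
theorem hasFTaylorSeriesUpTo_integral_family [FiniteDimensional ℝ E] [CompleteSpace F] {f : T → 𝓢(E, F)}
    (hmeas : ∀ x, AEStronglyMeasurable (fun τ => f τ x) ν)
    {b : ℕ → T → ℝ} (hb : ∀ n, Integrable (b n) ν)
    (hbound : ∀ n, ∀ᵐ τ ∂ν, ∀ x, ‖iteratedFDeriv ℝ n (f τ) x‖ ≤ b n τ) :
    HasFTaylorSeriesUpTo (⊤ : ℕ∞) (fun x => ∫ τ, f τ x ∂ν)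
      (fun x n => ∫ τ, iteratedFDeriv ℝ n (f τ) x ∂ν) := by
  have hmeas' := aestronglyMeasurable_iteratedFDeriv_family hmeas
  have hint : ∀ n x, Integrable (fun τ => iteratedFDeriv ℝ n (f τ) x) ν := fun n x =>
    (hb n).mono' (hmeas' n x) ((hbound n).mono fun τ h => h x)
  have hder : ∀ (m : ℕ) (x : E), HasFDerivAt (fun x => ∫ τ, iteratedFDeriv ℝ m (f τ) x ∂ν)
      (∫ τ, iteratedFDeriv ℝ m.succ (f τ) x ∂ν).curryLeft x := by
    intro m x
    have hd : ∀ τ, Differentiable ℝ (iteratedFDeriv ℝ m (f τ)) := fun τ =>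
      ((f τ).smooth ⊤).differentiable_iteratedFDeriv (mod_cast ENat.natCast_lt_top _)
    have h := hasFDerivAt_integral_of_dominated_of_fderiv_le (μ := ν) (s := univ) (x₀ := x)
      (F := fun x τ => iteratedFDeriv ℝ m (f τ) x)
      (F' := fun x τ => fderiv ℝ (iteratedFDeriv ℝ m (f τ)) x) (bound := b (m + 1))
      univ_mem (Eventually.of_forall fun x => hmeas' m x) (hint m x)
      (aestronglyMeasurable_fderiv_family (hmeas' m) hd x)
      ((hbound (m + 1)).mono fun τ h x _ => by rw [norm_fderiv_iteratedFDeriv]; exact h x)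
      (hb (m + 1)) (Eventually.of_forall fun τ x _ => (hd τ x).hasFDerivAt)
    refine h.congr_fderiv ?_
    let L : (E [×(m + 1)]→L[ℝ] F) →L[ℝ] (E →L[ℝ] (E [×m]→L[ℝ] F)) :=
      ((continuousMultilinearCurryLeftEquiv ℝ (fun _ : Fin (m + 1) => E)
        F).toContinuousLinearEquiv : _ →L[ℝ] _)
    have := ContinuousLinearMap.integral_comp_comm (𝕜 := ℝ) (Fₗ := E →L[ℝ] (E [×m]→L[ℝ] F)) L
      (hint (m + 1) x)
    exact this
  refine ⟨fun x => ?_, fun m _ x => hder m x, fun m _ => ?_⟩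
  · change (continuousMultilinearCurryFin0 ℝ E F).toContinuousLinearEquiv.toContinuousLinearMap
      (∫ τ, iteratedFDeriv ℝ 0 (f τ) x ∂ν) = _
    rw [← ContinuousLinearMap.integral_comp_comm _ (hint _ _)]
    rfl
  · exact continuous_iff_continuousAt.mpr fun x => (hder m x).continuousAt

variable (ν) in
/-- A family of continuous linear operators between Schwartz spaces that is pointwise measurable
and has seminorms bounded by an integrable function. -/
structure IntegrableFamily (A : T → 𝓢(D, V) →L[ℝ] 𝓢(E, F)) : Prop where
  measurable : ∀ φ x, AEStronglyMeasurable (fun τ => A τ φ x) ν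
  bound : ∀ k n : ℕ, ∃ (s : Finset (ℕ × ℕ)) (b : T → ℝ), Integrable b ν ∧ (∀ τ, 0 ≤ b τ) ∧
    ∀ᵐ τ ∂ν, ∀ φ x, ‖x‖ ^ k * ‖iteratedFDeriv ℝ n (A τ φ) x‖ ≤
      b τ * s.sup (schwartzSeminormFamily ℝ D V) φ

namespace IntegrableFamily

variable {A : T → 𝓢(D, V) →L[ℝ] 𝓢(E, F)}

theorem hasFTaylorSeriesUpTo [FiniteDimensional ℝ E] [CompleteSpace F] (hA : IntegrableFamily ν A) (φ : 𝓢(D, V)) :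
    HasFTaylorSeriesUpTo (⊤ : ℕ∞) (fun x => ∫ τ, A τ φ x ∂ν)
      (fun x n => ∫ τ, iteratedFDeriv ℝ n (A τ φ) x ∂ν) := by
  choose s b hb _ hbound using hA.bound 0
  refine hasFTaylorSeriesUpTo_integral_family (hA.measurable φ)
    (b := fun n τ => b n τ * (s n).sup (schwartzSeminormFamily ℝ D V) φ)
    (fun n => (hb n).mul_const _) fun n => ?_
  filter_upwards [hbound n] with τ hτ x
  simpa using hτ φ x

theorem integrable_apply (hA : IntegrableFamily ν A) (φ : 𝓢(D, V)) (x : E) :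
    Integrable (fun τ => A τ φ x) ν := by
  obtain ⟨s, b, hb, _, hbound⟩ := hA.bound 0 0
  refine (hb.mul_const (s.sup (schwartzSeminormFamily ℝ D V) φ)).mono' (hA.measurable φ x) ?_
  filter_upwards [hbound] with τ hτ
  simpa using hτ φ x

theorem integrable_iteratedFDeriv [FiniteDimensional ℝ E] (hA : IntegrableFamily ν A) (φ : 𝓢(D, V)) (n : ℕ) (x : E) :
    Integrable (fun τ => iteratedFDeriv ℝ n (A τ φ) x) ν := by
  obtain ⟨s, b, hb, _, hbound⟩ := hA.bound 0 n
  refine (hb.mul_const (s.sup (schwartzSeminormFamily ℝ D V) φ)).mono'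
    (aestronglyMeasurable_iteratedFDeriv_family (hA.measurable φ) n x) ?_
  filter_upwards [hbound] with τ hτ
  simpa using hτ φ x

variable [FiniteDimensional ℝ E] [CompleteSpace F]

/-- The integral of an integrable family of operators between Schwartz spaces. -/
def integralCLM (hA : IntegrableFamily ν A) : 𝓢(D, V) →L[ℝ] 𝓢(E, F) :=
  SchwartzMap.mkCLM (fun φ x => ∫ τ, A τ φ x ∂ν)
    (fun φ ψ x => by
      simp only [map_add, add_apply]
      exact integral_add (hA.integrable_apply φ x) (hA.integrable_apply ψ x))
    (fun c φ x => by
      simp only [map_smul, smul_apply]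
      exact integral_smul _ _)
    (fun φ => (hA.hasFTaylorSeriesUpTo φ).contDiff)
    (fun ⟨k, n⟩ => by
      obtain ⟨s, b, hb, hb0, hbound⟩ := hA.bound k n
      refine ⟨s, ∫ τ, b τ ∂ν, integral_nonneg hb0, fun φ x => ?_⟩
      rw [← (hA.hasFTaylorSeriesUpTo φ).eq_iteratedFDeriv (mod_cast le_top)]
      simp only
      rw [← integral_mul_const]
      refine (mul_le_mul_of_nonneg_left (norm_integral_le_integral_norm _) (by positivity)).trans ?_
      rw [← integral_const_mul]
      refine integral_mono_ae ((hA.integrable_iteratedFDeriv φ n x).norm.const_mul _)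
        (hb.mul_const _) ?_
      filter_upwards [hbound] with τ hτ using hτ φ x)

theorem integralCLM_apply (hA : IntegrableFamily ν A) (φ : 𝓢(D, V)) (x : E) :
    hA.integralCLM φ x = ∫ τ, A τ φ x ∂ν := rfl

theorem lineDerivOp_integralCLM (hA : IntegrableFamily ν A) (φ : 𝓢(D, V)) (v x : E) :
    (∂_{v} (hA.integralCLM φ)) x = ∫ τ, (∂_{v} (A τ φ)) x ∂ν := by
  have key : ∀ g : 𝓢(E, F), (∂_{v} g) x = iteratedFDeriv ℝ 1 g x fun _ => v := fun g => by
    rw [iteratedFDeriv_one_apply, SchwartzMap.lineDerivOp_apply_eq_fderiv]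
  simp_rw [key]
  have h := (hA.hasFTaylorSeriesUpTo φ).eq_iteratedFDeriv (m := 1) (mod_cast le_top) x
  change iteratedFDeriv ℝ 1 (fun x => ∫ τ, A τ φ x ∂ν) x (fun _ => v) = _
  rw [← h]
  exact ContinuousMultilinearMap.integral_apply (hA.integrable_iteratedFDeriv φ 1 x) _

end IntegrableFamily

end Family

/-! ### Slices of test functions -/

section Slice

variable {X Y F : Type*} [NormedAddCommGroup X] [NormedSpace ℝ X] [NormedAddCommGroup Y]
  [NormedSpace ℝ Y] [NormedAddCommGroup F] [NormedSpace ℝ F]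

/-- The restriction of a Schwartz function on `X × Y` to `X × {y}`. -/
def sliceFst (y : Y) : 𝓢(X × Y, F) →L[ℝ] 𝓢(X, F) :=
  SchwartzMap.compCLM ℝ (g := fun x : X => (x, y))
    (by
      have : (fun x : X => (x, y)) = fun x => ContinuousLinearMap.inl ℝ X Y x + (0, y) := by
        ext x <;> simp
      rw [this]
      fun_prop)
    ⟨1, 1, fun x => by
      rw [one_mul, pow_one]
      exact (norm_fst_le (x, y)).trans (by simp)⟩

/-- The restriction of a Schwartz function on `X × Y` to `{x} × Y`. -/
def sliceSnd (x : X) : 𝓢(X × Y, F) →L[ℝ] 𝓢(Y, F) :=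
  SchwartzMap.compCLM ℝ (g := fun y : Y => (x, y))
    (by
      have : (fun y : Y => (x, y)) = fun y => ContinuousLinearMap.inr ℝ X Y y + (x, 0) := by
        ext y <;> simp
      rw [this]
      fun_prop)
    ⟨1, 1, fun y => by
      rw [one_mul, pow_one]
      exact (norm_snd_le (x, y)).trans (by simp)⟩

@[simp] theorem sliceFst_apply (y : Y) (φ : 𝓢(X × Y, F)) (x : X) : sliceFst y φ x = φ (x, y) := rfl

@[simp] theorem sliceSnd_apply (x : X) (φ : 𝓢(X × Y, F)) (y : Y) : sliceSnd x φ y = φ (x, y) := rfl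

theorem lineDerivOp_sliceFst (y : Y) (φ : 𝓢(X × Y, F)) (v : X) :
    ∂_{v} (sliceFst y φ) = sliceFst y (∂_{((v, 0) : X × Y)} φ) := by
  ext x
  simp only [SchwartzMap.lineDerivOp_apply, sliceFst_apply, lineDeriv]
  simp

theorem lineDerivOp_sliceSnd (x : X) (φ : 𝓢(X × Y, F)) (v : Y) :
    ∂_{v} (sliceSnd x φ) = sliceSnd x (∂_{((0, v) : X × Y)} φ) := by
  ext y
  simp only [SchwartzMap.lineDerivOp_apply, sliceSnd_apply, lineDeriv]
  simp

theorem norm_iteratedFDeriv_sliceFst_le (y : Y) (φ : 𝓢(X × Y, F)) (n : ℕ) (x : X) :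
    ‖iteratedFDeriv ℝ n (sliceFst y φ) x‖ ≤ ‖iteratedFDeriv ℝ n φ (x, y)‖ := by
  have h1 : (sliceFst y φ : X → F) =
      (fun p : X × Y => φ (p + (0, y))) ∘ ContinuousLinearMap.inl ℝ X Y := by
    ext x; simp
  have hs : ContDiff ℝ n (fun p : X × Y => φ (p + (0, y))) :=
    (φ.smooth n).comp (contDiff_id.add contDiff_const)
  rw [h1, ContinuousLinearMap.iteratedFDeriv_comp_right _ hs _ le_rfl, iteratedFDeriv_comp_add_right]
  refine (ContinuousMultilinearMap.norm_compContinuousLinearMap_le _ _).trans ?_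
  have : ∏ _i : Fin n, ‖ContinuousLinearMap.inl ℝ X Y‖ ≤ 1 :=
    Finset.prod_le_one (fun _ _ => norm_nonneg _) fun _ _ => ContinuousLinearMap.norm_inl_le_one _ _ _
  simpa using mul_le_of_le_one_right (norm_nonneg _) this

/-- Schwartz functions and their derivatives decay faster than any power of either variable. -/
theorem exists_slice_bound (k n N : ℕ) : ∃ (s : Finset (ℕ × ℕ)) (C : ℝ), 0 ≤ C ∧
    ∀ (φ : 𝓢(X × Y, F)) (p : X × Y), (1 + ‖p.1‖) ^ k * (1 + ‖p.2‖) ^ N * ‖iteratedFDeriv ℝ n φ p‖ ≤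
      C * s.sup (schwartzSeminormFamily ℝ (X × Y) F) φ := by
  refine ⟨Finset.Iic (k + N, n), 2 ^ (k + N), by positivity, fun φ p => ?_⟩
  refine le_trans ?_ (SchwartzMap.one_add_le_sup_seminorm_apply (𝕜 := ℝ) (m := (k + N, n)) le_rfl
    le_rfl φ p)
  rw [pow_add]
  gcongr
  · exact norm_fst_le p
  · exact norm_snd_le p

end Slice

section

open FourierTransform ComplexConjugate

/-! ### The partial Fourier transform of test functions -/

theorem integrable_inv_one_add_norm_pow {E : Type*} [NormedAddCommGroup E] [NormedSpace ℝ E]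
    [FiniteDimensional ℝ E] [MeasurableSpace E] [BorelSpace E] (μ : Measure E) [μ.IsAddHaarMeasure]
    {N : ℕ} (hN : Module.finrank ℝ E < N) : Integrable (fun x : E => ((1 + ‖x‖) ^ N)⁻¹) μ := by
  refine (integrable_one_add_norm (μ := μ) (r := N) (by exact_mod_cast hN)).congr
    (Eventually.of_forall fun x => ?_)
  simp only
  rw [Real.rpow_neg (by positivity), Real.rpow_natCast]

variable {d : ℕ}

/-- The weight `(2π)^(-d) e^{i x·y}`. -/
def fourierWeight (y x : EuclideanSpace ℝ (Fin d)) : ℂ :=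
  (((2 * Real.pi) ^ d : ℝ) : ℂ)⁻¹ * Complex.exp (Complex.I * (inner ℝ x y : ℝ))

theorem norm_fourierWeight (y x : EuclideanSpace ℝ (Fin d)) :
    ‖fourierWeight y x‖ = ((2 * Real.pi) ^ d)⁻¹ := by
  rw [fourierWeight, norm_mul, mul_comm Complex.I, Complex.norm_exp_ofReal_mul_I, mul_one, norm_inv,
    Complex.norm_real, Real.norm_of_nonneg (by positivity)]

theorem continuous_fourierWeight (y : EuclideanSpace ℝ (Fin d)) : Continuous (fourierWeight y) := by
  unfold fourierWeight
  fun_prop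

/-- Presents `φ ↦ invFourier φ · y` as an integral over `x` of time slices with weights of constant
modulus, which makes it a continuous operator into Schwartz functions of time. Decay of order `d +
1` in `x` gives integrability. -/
theorem integrableFamily_invFourier (y : EuclideanSpace ℝ (Fin d)) :
    IntegrableFamily (volume : Measure (EuclideanSpace ℝ (Fin d)))
      (fun x => (SchwartzMap.postcompCLM
        (ContinuousLinearMap.toSpanSingleton ℝ (fourierWeight y x))).comp
          (sliceFst x : TestFn d →L[ℝ] 𝓢(ℝ, ℝ))) where
  measurable φ t := by
    have h1 : Continuous fun x : EuclideanSpace ℝ (Fin d) => φ (t, x) • fourierWeight y x :=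
      (φ.continuous.comp (by fun_prop)).smul (continuous_fourierWeight y)
    exact h1.aestronglyMeasurable
  bound k n := by
    obtain ⟨s, C, hC, h⟩ := exists_slice_bound (X := ℝ) (Y := EuclideanSpace ℝ (Fin d)) (F := ℝ)
      k n (Module.finrank ℝ (EuclideanSpace ℝ (Fin d)) + 1)
    set N := Module.finrank ℝ (EuclideanSpace ℝ (Fin d)) + 1
    refine ⟨s, fun x => ((2 * Real.pi) ^ d)⁻¹ * C * ((1 + ‖x‖) ^ N)⁻¹,
      (integrable_inv_one_add_norm_pow volume (Nat.lt_succ_self _)).const_mul _,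
      fun x => by positivity, Eventually.of_forall fun x φ t => ?_⟩
    have h1 : ‖iteratedFDeriv ℝ n ((SchwartzMap.postcompCLM
        (ContinuousLinearMap.toSpanSingleton ℝ (fourierWeight y x))) (sliceFst x φ)) t‖ ≤
        ((2 * Real.pi) ^ d)⁻¹ * ‖iteratedFDeriv ℝ n φ (t, x)‖ := by
      refine (ContinuousLinearMap.norm_iteratedFDeriv_comp_left _
        ((sliceFst x φ).contDiffAt (n : ℕ∞)) le_rfl).trans ?_
      rw [ContinuousLinearMap.norm_toSpanSingleton, norm_fourierWeight]
      gcongr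
      exact norm_iteratedFDeriv_sliceFst_le x φ n t
    have h2 := h φ (t, x)
    have h3 : ‖t‖ ^ k ≤ (1 + ‖t‖) ^ k := by gcongr; simp
    have hx : 0 < (1 + ‖x‖) ^ N := by positivity
    simp only [ContinuousLinearMap.comp_apply]
    calc ‖t‖ ^ k * _ ≤ (1 + ‖t‖) ^ k * (((2 * Real.pi) ^ d)⁻¹ * ‖iteratedFDeriv ℝ n φ (t, x)‖) := by
          gcongr
      _ = ((2 * Real.pi) ^ d)⁻¹ * ((1 + ‖x‖) ^ N)⁻¹ *
          ((1 + ‖t‖) ^ k * (1 + ‖x‖) ^ N * ‖iteratedFDeriv ℝ n φ (t, x)‖) := by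
          field_simp
      _ ≤ ((2 * Real.pi) ^ d)⁻¹ * ((1 + ‖x‖) ^ N)⁻¹ *
          (C * s.sup (schwartzSeminormFamily ℝ (TimeSpace d) ℝ) φ) := by gcongr
      _ = _ := by ring

/-- For fixed `y`, the function `t ↦ invFourier φ t y`, as a Schwartz function. -/
def invFourierTime (y : EuclideanSpace ℝ (Fin d)) : TestFn d →L[ℝ] 𝓢(ℝ, ℂ) :=
  (integrableFamily_invFourier y).integralCLM

theorem invFourier_eq_integral (φ : TestFn d) (t : ℝ) (y : EuclideanSpace ℝ (Fin d)) :
    invFourier φ t y = ∫ x, φ (t, x) • fourierWeight y x := by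
  rw [invFourier, ← integral_const_mul]
  refine integral_congr_ae (Eventually.of_forall fun x => ?_)
  simp only [fourierWeight, Complex.real_smul]
  ring

@[simp] theorem invFourierTime_apply (y : EuclideanSpace ℝ (Fin d)) (φ : TestFn d) (t : ℝ) :
    invFourierTime y φ t = invFourier φ t y := by
  rw [invFourier_eq_integral]
  rfl

theorem hasDerivAt_invFourier (φ : TestFn d) (t : ℝ) (y : EuclideanSpace ℝ (Fin d)) :
    HasDerivAt (fun t => invFourier φ t y) (invFourier (∂_{timeDir d} φ) t y) t := by
  have h1 := (integrableFamily_invFourier y).lineDerivOp_integralCLM φ 1 t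
  have h2 : (∂_{(1 : ℝ)} (invFourierTime y φ)) t = invFourier (∂_{timeDir d} φ) t y := by
    rw [invFourier_eq_integral]
    refine h1.trans (integral_congr_ae (Eventually.of_forall fun x => ?_))
    simp only [ContinuousLinearMap.comp_apply]
    set L := ContinuousLinearMap.toSpanSingleton ℝ (fourierWeight y x)
    have h3 : HasDerivAt (fun s => L (sliceFst x φ s)) (L (deriv (sliceFst x φ) t)) t :=
      L.hasFDerivAt.comp_hasDerivAt t (sliceFst x φ).differentiableAt.hasDerivAt
    rw [SchwartzMap.lineDerivOp_apply_eq_fderiv, fderiv_apply_one_eq_deriv]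
    refine h3.deriv.trans ?_
    have h4 := congrArg (fun f : 𝓢(ℝ, ℝ) => f t) (lineDerivOp_sliceFst x φ (1 : ℝ))
    simp only [SchwartzMap.lineDerivOp_apply_eq_fderiv (f := sliceFst x φ),
      fderiv_apply_one_eq_deriv] at h4
    rw [h4]
    rfl
  rw [← h2, SchwartzMap.lineDerivOp_apply_eq_fderiv, fderiv_apply_one_eq_deriv]
  exact ((invFourierTime y φ).hasDerivAt t).congr_of_eventuallyEq
    (Eventually.of_forall fun s => (invFourierTime_apply y φ s).symm)

/-- The complex-valued Schwartz function `φ(t, ·)`. -/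
def spatialSlice (t : ℝ) : TestFn d →L[ℝ] 𝓢(EuclideanSpace ℝ (Fin d), ℂ) :=
  (SchwartzMap.postcompCLM Complex.ofRealCLM).comp (sliceSnd t)

@[simp] theorem spatialSlice_apply (t : ℝ) (φ : TestFn d) (x : EuclideanSpace ℝ (Fin d)) :
    spatialSlice t φ x = φ (t, x) := rfl

theorem lineDerivOp_postcomp_ofReal {E : Type*} [NormedAddCommGroup E] [NormedSpace ℝ E]
    (f : 𝓢(E, ℝ)) (v : E) : ∂_{v} (SchwartzMap.postcompCLM Complex.ofRealCLM f) =
      SchwartzMap.postcompCLM Complex.ofRealCLM (∂_{v} f) := by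
  ext x
  rw [SchwartzMap.lineDerivOp_apply_eq_fderiv, SchwartzMap.postcompCLM_apply,
    SchwartzMap.lineDerivOp_apply_eq_fderiv]
  have h := (Complex.ofRealCLM.hasFDerivAt (x := f x)).comp x (f.hasFDerivAt x)
  exact congrArg (fun L : E →L[ℝ] ℂ => L v) h.fderiv

theorem lineDerivOp_spatialSlice (t : ℝ) (φ : TestFn d) (v : EuclideanSpace ℝ (Fin d)) :
    ∂_{v} (spatialSlice t φ) = spatialSlice t (∂_{((0, v) : TimeSpace d)} φ) := by
  change ∂_{v} (SchwartzMap.postcompCLM Complex.ofRealCLM (sliceSnd t φ)) = _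
  rw [lineDerivOp_postcomp_ofReal, lineDerivOp_sliceSnd]
  rfl

theorem invFourier_eq_fourierInv (φ : TestFn d) (t : ℝ) (y : EuclideanSpace ℝ (Fin d)) :
    invFourier φ t y = (((2 * Real.pi) ^ d : ℝ) : ℂ)⁻¹ *
      𝓕⁻ (spatialSlice t φ) ((2 * Real.pi)⁻¹ • y) := by
  rw [invFourier, SchwartzMap.fourierInv_coe, Real.fourierInv_eq']
  congr 1
  refine integral_congr_ae (Eventually.of_forall fun x => ?_)
  have : 2 * Real.pi * inner ℝ x ((2 * Real.pi)⁻¹ • y) = inner ℝ x y := by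
    rw [inner_smul_right]
    field_simp
  simp only [spatialSlice_apply, this, smul_eq_mul, mul_comm Complex.I]

theorem invFourier_lineDerivOp (φ : TestFn d) (t : ℝ) (y v : EuclideanSpace ℝ (Fin d)) :
    invFourier (∂_{((0, v) : TimeSpace d)} φ) t y =
      -(Complex.I * (inner ℝ y v : ℝ)) * invFourier φ t y := by
  rw [invFourier_eq_fourierInv, invFourier_eq_fourierInv, ← lineDerivOp_spatialSlice,
    SchwartzMap.fourierInv_lineDerivOp_eq, smul_apply,
    SchwartzMap.smulLeftCLM_apply_apply (by fun_prop), inner_smul_left, smul_eq_mul,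
    Complex.real_smul]
  push_cast
  simp only [conj_trivial]
  push_cast
  have : (Real.pi : ℂ) ≠ 0 := by exact_mod_cast Real.pi_ne_zero
  field_simp

theorem invFourier_sum {ι : Type*} (s : Finset ι) (f : ι → TestFn d) (t : ℝ)
    (y : EuclideanSpace ℝ (Fin d)) :
    invFourier (∑ i ∈ s, f i) t y = ∑ i ∈ s, invFourier (f i) t y := by
  simp_rw [← invFourierTime_apply, map_sum]
  rw [sum_apply]

theorem invFourier_add (φ ψ : TestFn d) (t : ℝ) (y : EuclideanSpace ℝ (Fin d)) :
    invFourier (φ + ψ) t y = invFourier φ t y + invFourier ψ t y := by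
  simp_rw [← invFourierTime_apply, map_add]
  rfl

theorem invFourier_smul (c : ℝ) (φ : TestFn d) (t : ℝ) (y : EuclideanSpace ℝ (Fin d)) :
    invFourier (c • φ) t y = c * invFourier φ t y := by
  simp_rw [← invFourierTime_apply, map_smul]
  simp

theorem invFourier_laplacianTest (φ : TestFn d) (t : ℝ) (y : EuclideanSpace ℝ (Fin d)) :
    invFourier (laplacianTest d φ) t y = -(‖y‖ ^ 2 : ℝ) * invFourier φ t y := by
  have h : laplacianTest d φ = ∑ i : Fin d, ∂_{spaceDir i} (∂_{spaceDir i} φ) := by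
    simp [laplacianTest, sum_apply]
  rw [h, invFourier_sum, EuclideanSpace.real_norm_sq_eq]
  simp only [spaceDir, invFourier_lineDerivOp]
  push_cast
  rw [neg_mul, Finset.sum_mul, ← Finset.sum_neg_distrib]
  refine Finset.sum_congr rfl fun i _ => ?_
  rw [EuclideanSpace.inner_single_right]
  simp only [conj_trivial, one_mul]
  linear_combination ((y i : ℂ)) ^ 2 * invFourier φ t y * Complex.I_sq

theorem invFourier_neg_right (φ : TestFn d) (t : ℝ) (y : EuclideanSpace ℝ (Fin d)) :
    invFourier φ t (-y) = conj (invFourier φ t y) := by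
  rw [invFourier, invFourier, map_mul, ← integral_conj]
  congr 1
  · rw [map_inv₀, Complex.conj_ofReal]
  · refine integral_congr_ae (Eventually.of_forall fun x => ?_)
    simp [← Complex.exp_conj]

/-- Fourier inversion in the space variables. -/
theorem integral_exp_mul_invFourier (φ : TestFn d) (t : ℝ) (z : EuclideanSpace ℝ (Fin d)) :
    ∫ y : EuclideanSpace ℝ (Fin d), Complex.exp (-(Complex.I * (inner ℝ z y : ℝ))) *
      invFourier φ t y = φ (t, z) := by
  have h1 : 𝓕 (𝓕⁻ (spatialSlice t φ)) z = φ (t, z) := by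
    rw [fourier_fourierInv_eq, spatialSlice_apply]
  rw [← h1, SchwartzMap.fourier_coe, Real.fourier_eq']
  set G : EuclideanSpace ℝ (Fin d) → ℂ := fun v =>
    Complex.exp ((↑(-2 * Real.pi * inner ℝ v z) : ℂ) * Complex.I) • 𝓕⁻ (spatialSlice t φ) v
  have h2 := Measure.integral_comp_inv_smul_of_nonneg volume G (R := 2 * Real.pi) (by positivity)
  rw [finrank_euclideanSpace_fin] at h2
  have hne : (2 * Real.pi) ^ d ≠ 0 := by positivity
  rw [← inv_smul_eq_iff₀ hne] at h2
  rw [← h2, ← integral_smul]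
  refine integral_congr_ae (Eventually.of_forall fun y => ?_)
  simp only [G, smul_eq_mul, Complex.real_smul, invFourier_eq_fourierInv]
  have : -2 * Real.pi * inner ℝ ((2 * Real.pi)⁻¹ • y) z = -inner ℝ z y := by
    rw [inner_smul_left, real_inner_comm]
    simp only [conj_trivial]
    field_simp
  rw [this]
  push_cast
  rw [show -(Complex.I * (inner ℝ z y : ℂ)) = -(inner ℝ z y : ℂ) * Complex.I by ring]
  ring

/-- `invFourier φ` decays faster than any power of its variables. -/
theorem exists_norm_invFourier_le (k N : ℕ) : ∀ φ : TestFn d, ∃ C, 0 ≤ C ∧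
    ∀ (t : ℝ) (y : EuclideanSpace ℝ (Fin d)),
      ‖invFourier φ t y‖ ≤ C * (((1 + ‖t‖) ^ k)⁻¹ * ((1 + ‖y‖ ^ 2) ^ N)⁻¹) := by
  induction N with
  | zero =>
    intro φ
    obtain ⟨s, C, hC, h⟩ := exists_slice_bound (X := ℝ) (Y := EuclideanSpace ℝ (Fin d)) (F := ℝ)
      k 0 (Module.finrank ℝ (EuclideanSpace ℝ (Fin d)) + 1)
    set N := Module.finrank ℝ (EuclideanSpace ℝ (Fin d)) + 1
    set S := C * s.sup (schwartzSeminormFamily ℝ (TimeSpace d) ℝ) φ with hS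
    have hS0 : 0 ≤ S := mul_nonneg hC (apply_nonneg _ _)
    have hi : Integrable (fun x : EuclideanSpace ℝ (Fin d) => ((1 + ‖x‖) ^ N)⁻¹) :=
      integrable_inv_one_add_norm_pow volume (Nat.lt_succ_self _)
    refine ⟨S * ((2 * Real.pi) ^ d)⁻¹ * ∫ x : EuclideanSpace ℝ (Fin d), ((1 + ‖x‖) ^ N)⁻¹,
      by positivity, fun t y => ?_⟩
    rw [invFourier_eq_integral, pow_zero, inv_one, mul_one]
    have hb : ∀ x, ‖φ (t, x) • fourierWeight y x‖ ≤
        S * ((2 * Real.pi) ^ d)⁻¹ * ((1 + ‖t‖) ^ k)⁻¹ * ((1 + ‖x‖) ^ N)⁻¹ := by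
      intro x
      have h1 := h φ (t, x)
      rw [norm_iteratedFDeriv_zero] at h1
      rw [norm_smul, norm_fourierWeight]
      have h2 : ‖φ (t, x)‖ ≤ S * ((1 + ‖t‖) ^ k)⁻¹ * ((1 + ‖x‖) ^ N)⁻¹ := by
        rw [← div_eq_mul_inv, ← div_eq_mul_inv, le_div_iff₀ (by positivity),
          le_div_iff₀ (by positivity)]
        calc _ = (1 + ‖t‖) ^ k * (1 + ‖x‖) ^ N * ‖φ (t, x)‖ := by ring
          _ ≤ _ := h1
      calc _ ≤ (S * ((1 + ‖t‖) ^ k)⁻¹ * ((1 + ‖x‖) ^ N)⁻¹) * ((2 * Real.pi) ^ d)⁻¹ := by gcongr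
        _ = _ := by ring
    refine (norm_integral_le_of_norm_le (hi.const_mul _) (Eventually.of_forall hb)).trans ?_
    rw [integral_const_mul]
    exact le_of_eq (by ring)
  | succ N ih =>
    intro φ
    -- The transform of `φ - Δφ` is `(1 + |y|²)` times that of `φ`, so each step gains one power.
    obtain ⟨C, hC, h⟩ := ih (φ + (-1 : ℝ) • laplacianTest d φ)
    refine ⟨C, hC, fun t y => ?_⟩
    have h1 := h t y
    rw [invFourier_add, invFourier_smul, invFourier_laplacianTest] at h1
    have h2 : invFourier φ t y + ((-1 : ℝ) : ℂ) * (-((‖y‖ ^ 2 : ℝ) : ℂ) * invFourier φ t y) =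
        ((1 + ‖y‖ ^ 2 : ℝ) : ℂ) * invFourier φ t y := by push_cast; ring
    rw [h2, norm_mul, Complex.norm_real, Real.norm_of_nonneg (by positivity)] at h1
    rw [pow_succ, mul_inv, ← mul_assoc, ← mul_assoc, ← div_eq_mul_inv _ (1 + ‖y‖ ^ 2),
      le_div_iff₀ (by positivity), mul_comm, mul_assoc]
    exact h1

theorem continuous_invFourier (φ : TestFn d) :
    Continuous fun q : TimeSpace d => invFourier φ q.1 q.2 := by
  simp_rw [invFourier_eq_integral]
  obtain ⟨s, C, hC, h⟩ := exists_slice_bound (X := ℝ) (Y := EuclideanSpace ℝ (Fin d)) (F := ℝ)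
      0 0 (Module.finrank ℝ (EuclideanSpace ℝ (Fin d)) + 1)
  set N := Module.finrank ℝ (EuclideanSpace ℝ (Fin d)) + 1
  set S := C * s.sup (schwartzSeminormFamily ℝ (TimeSpace d) ℝ) φ with hS
  refine continuous_of_dominated (bound := fun x => S * ((2 * Real.pi) ^ d)⁻¹ * ((1 + ‖x‖) ^ N)⁻¹)
    (fun q => ?_) (fun q => Eventually.of_forall fun x => ?_)
    ((integrable_inv_one_add_norm_pow volume (Nat.lt_succ_self _)).const_mul _)
    (Eventually.of_forall fun x => ?_)
  · exact ((φ.continuous.comp (by fun_prop)).smul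
      (continuous_fourierWeight q.2)).aestronglyMeasurable
  · have h1 := h φ (q.1, x)
    rw [norm_iteratedFDeriv_zero, pow_zero, one_mul] at h1
    have h2 : ‖φ (q.1, x)‖ ≤ S * ((1 + ‖x‖) ^ N)⁻¹ := by
      rw [← div_eq_mul_inv, le_div_iff₀ (by positivity), mul_comm]
      exact h1
    rw [norm_smul, norm_fourierWeight]
    calc _ ≤ (S * ((1 + ‖x‖) ^ N)⁻¹) * ((2 * Real.pi) ^ d)⁻¹ := by gcongr
      _ = _ := by ring
  · refine (φ.continuous.comp (by fun_prop)).smul ?_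
    unfold fourierWeight
    fun_prop

end

section

open FourierTransform ComplexConjugate

/-! ### Seminorm estimates -/

section Seminorms

variable {D V E F : Type*} [NormedAddCommGroup D] [NormedSpace ℝ D] [NormedAddCommGroup V]
  [NormedSpace ℝ V] [NormedAddCommGroup E] [NormedSpace ℝ E] [NormedAddCommGroup F]
  [NormedSpace ℝ F]

theorem exists_sup_seminorm_le (L : 𝓢(D, V) →L[ℝ] 𝓢(E, F)) (s : Finset (ℕ × ℕ)) :
    ∃ (s' : Finset (ℕ × ℕ)) (C : ℝ), 0 ≤ C ∧ ∀ φ, s.sup (schwartzSeminormFamily ℝ E F) (L φ) ≤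
      C * s'.sup (schwartzSeminormFamily ℝ D V) φ := by
  have hb : Seminorm.IsBounded (schwartzSeminormFamily ℝ D V) (schwartzSeminormFamily ℝ E F)
      (L : 𝓢(D, V) →ₗ[ℝ] 𝓢(E, F)) := fun i => by
    obtain ⟨s', C, _, h⟩ := Seminorm.bound_of_continuous (schwartz_withSeminorms ℝ D V)
      ((schwartzSeminormFamily ℝ E F i).comp (L : 𝓢(D, V) →ₗ[ℝ] 𝓢(E, F)))
      (((schwartz_withSeminorms ℝ E F).continuous_seminorm i).comp L.continuous)
    exact ⟨s', C, h⟩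
  obtain ⟨C, s', h⟩ := Seminorm.isBounded_sup hb s
  exact ⟨s', C, C.2, fun φ => h φ⟩

theorem pow_mul_norm_iteratedFDeriv_smul_le {g : E → ℝ} (hg : ContDiff ℝ (⊤ : ℕ∞) g)
    (f : 𝓢(E, F)) (x : E) {k n K : ℕ} {G S : ℝ} (hG : 0 ≤ G)
    (hgx : ∀ i ≤ n, ‖iteratedFDeriv ℝ i g x‖ ≤ G * (1 + ‖x‖) ^ K)
    (hfx : ∀ j ≤ n, (1 + ‖x‖) ^ (k + K) * ‖iteratedFDeriv ℝ j f x‖ ≤ S) :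
    ‖x‖ ^ k * ‖iteratedFDeriv ℝ n (fun y => g y • f y) x‖ ≤ 2 ^ n * (G * S) := by
  have h1 := norm_iteratedFDeriv_smul_le (n := n) hg (f.smooth ⊤) x (mod_cast le_top)
  have h2 : ‖x‖ ^ k ≤ (1 + ‖x‖) ^ k := by gcongr; simp
  calc ‖x‖ ^ k * ‖iteratedFDeriv ℝ n (fun y => g y • f y) x‖
      ≤ (1 + ‖x‖) ^ k * ∑ i ∈ Finset.range (n + 1),
        (n.choose i : ℝ) * ‖iteratedFDeriv ℝ i g x‖ * ‖iteratedFDeriv ℝ (n - i) f x‖ := by gcongr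
    _ = ∑ i ∈ Finset.range (n + 1), (n.choose i : ℝ) * ((1 + ‖x‖) ^ k *
        (‖iteratedFDeriv ℝ i g x‖ * ‖iteratedFDeriv ℝ (n - i) f x‖)) := by
        rw [Finset.mul_sum]
        exact Finset.sum_congr rfl fun i _ => by ring
    _ ≤ ∑ i ∈ Finset.range (n + 1), (n.choose i : ℝ) * (G * S) := by
        refine Finset.sum_le_sum fun i hi => mul_le_mul_of_nonneg_left ?_ (by positivity)
        have hi' : i ≤ n := Nat.lt_succ_iff.mp (Finset.mem_range.mp hi)
        calc (1 + ‖x‖) ^ k * (‖iteratedFDeriv ℝ i g x‖ * ‖iteratedFDeriv ℝ (n - i) f x‖)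
            ≤ (1 + ‖x‖) ^ k * ((G * (1 + ‖x‖) ^ K) * ‖iteratedFDeriv ℝ (n - i) f x‖) := by
              gcongr
              exact hgx i hi'
          _ = G * ((1 + ‖x‖) ^ (k + K) * ‖iteratedFDeriv ℝ (n - i) f x‖) := by ring
          _ ≤ G * S := by
              gcongr
              exact hfx _ (Nat.sub_le _ _)
    _ = 2 ^ n * (G * S) := by
        rw [← Finset.sum_mul]
        congr 1
        exact_mod_cast Nat.sum_range_choose n

theorem norm_iteratedFDeriv_comp_smul_le {g : E → F} (hg : ContDiff ℝ (⊤ : ℕ∞) g) {σ : ℝ}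
    (hσ : 0 ≤ σ) (i : ℕ) (x : E) :
    ‖iteratedFDeriv ℝ i (fun y => g (σ • y)) x‖ ≤ σ ^ i * ‖iteratedFDeriv ℝ i g (σ • x)‖ := by
  set L : E →L[ℝ] E := σ • ContinuousLinearMap.id ℝ E
  have h1 : (fun y => g (σ • y)) = g ∘ L := by ext y; simp [L]
  rw [h1, ContinuousLinearMap.iteratedFDeriv_comp_right L hg x (i := i) (mod_cast le_top)]
  refine (ContinuousMultilinearMap.norm_compContinuousLinearMap_le _ _).trans ?_
  have hL : ‖L‖ ≤ σ := by
    rw [norm_smul, Real.norm_of_nonneg hσ]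
    exact mul_le_of_le_one_right hσ ContinuousLinearMap.norm_id_le
  have h2 : ∏ _j : Fin i, ‖L‖ ≤ σ ^ i := by
    rw [Finset.prod_const, Finset.card_univ, Fintype.card_fin]
    gcongr
  rw [mul_comm]
  have h3 : L x = σ • x := by simp [L]
  rw [h3]
  gcongr

theorem hasTemperateGrowth_comp_smul {g : E → ℝ} (hg : g.HasTemperateGrowth) (σ : ℝ) :
    Function.HasTemperateGrowth fun y => g (σ • y) :=
  hg.comp (by fun_prop)

/-- Multiplication by the dilations of a function of temperate growth is bounded polynomially in
the dilation factor. -/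
theorem exists_seminorm_smulLeftCLM_dilation_le {g : E → ℝ} (hg : g.HasTemperateGrowth)
    (s : Finset (ℕ × ℕ)) :
    ∃ (s' : Finset (ℕ × ℕ)) (C : ℝ) (M : ℕ), 0 ≤ C ∧ ∀ (σ : ℝ), 0 ≤ σ → ∀ f : 𝓢(E, F),
      s.sup (schwartzSeminormFamily ℝ E F) (SchwartzMap.smulLeftCLM F (fun y => g (σ • y)) f) ≤
        C * (1 + σ) ^ M * s'.sup (schwartzSeminormFamily ℝ E F) f := by
  have single : ∀ i : ℕ × ℕ, ∃ (s' : Finset (ℕ × ℕ)) (C : ℝ) (M : ℕ), 0 ≤ C ∧ ∀ (σ : ℝ), 0 ≤ σ →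
      ∀ f : 𝓢(E, F), schwartzSeminormFamily ℝ E F i
        (SchwartzMap.smulLeftCLM F (fun y => g (σ • y)) f) ≤
        C * (1 + σ) ^ M * s'.sup (schwartzSeminormFamily ℝ E F) f := by
    rintro ⟨k, n⟩
    obtain ⟨K, C, hC, h⟩ := hg.norm_iteratedFDeriv_le_uniform n
    -- The chain rule contributes at most `(1+σ)^n`, and growth of order `K` at the point `σx`
    -- contributes `(1+σ)^K`.
    refine ⟨Finset.Iic (k + K, n), 2 ^ n * (C * 2 ^ (k + K)), n + K, by positivity,
      fun σ hσ f => ?_⟩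
    refine SchwartzMap.seminorm_le_bound ℝ k n _ (by positivity) fun x => ?_
    have hfun : ⇑(SchwartzMap.smulLeftCLM F (fun y => g (σ • y)) f) =
        fun y => g (σ • y) • f y := by
      ext y
      exact SchwartzMap.smulLeftCLM_apply_apply (hasTemperateGrowth_comp_smul hg σ) f y
    rw [hfun]
    refine (pow_mul_norm_iteratedFDeriv_smul_le (K := K) (G := C * (1 + σ) ^ (n + K))
      (S := 2 ^ (k + K) * (Finset.Iic (k + K, n)).sup (schwartzSeminormFamily ℝ E F) f)
      (hasTemperateGrowth_comp_smul hg σ).1 f x (by positivity) (fun i hi => ?_)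
      (fun j hj => ?_)).trans (le_of_eq (by ring))
    · refine (norm_iteratedFDeriv_comp_smul_le hg.1 hσ i x).trans ?_
      have h1 := h i hi (σ • x)
      rw [norm_smul, Real.norm_of_nonneg hσ] at h1
      have h2 : 1 + σ * ‖x‖ ≤ (1 + σ) * (1 + ‖x‖) := by nlinarith [norm_nonneg x]
      have h4 : 0 ≤ σ * ‖x‖ := by positivity
      calc σ ^ i * ‖iteratedFDeriv ℝ i g (σ • x)‖
          ≤ (1 + σ) ^ i * (C * ((1 + σ) * (1 + ‖x‖)) ^ K) := by
            gcongr
            · linarith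
            · exact h1.trans (by gcongr)
        _ ≤ (1 + σ) ^ n * (C * ((1 + σ) * (1 + ‖x‖)) ^ K) := by
            gcongr
            linarith
        _ = C * (1 + σ) ^ (n + K) * (1 + ‖x‖) ^ K := by rw [mul_pow]; ring
    · exact SchwartzMap.one_add_le_sup_seminorm_apply (𝕜 := ℝ) (m := (k + K, n)) le_rfl hj f x
  choose s' C M hC h using single
  refine ⟨s.biUnion s', ∑ i ∈ s, C i, ∑ i ∈ s, M i, Finset.sum_nonneg fun i _ => hC i,
    fun σ hσ f => ?_⟩
  refine Seminorm.finset_sup_apply_le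
    (mul_nonneg (mul_nonneg (Finset.sum_nonneg fun i _ => hC i) (by positivity)) (apply_nonneg _ _))
    fun i hi => ?_
  refine (h i σ hσ f).trans ?_
  have h1 : (s' i).sup (schwartzSeminormFamily ℝ E F) f ≤
      (s.biUnion s').sup (schwartzSeminormFamily ℝ E F) f :=
    Seminorm.le_def.mp (Finset.sup_mono (Finset.subset_biUnion_of_mem s' hi)) f
  have h2 : C i ≤ ∑ i ∈ s, C i := Finset.single_le_sum (fun i _ => hC i) hi
  have h3 : M i ≤ ∑ i ∈ s, M i := Finset.single_le_sum (fun i _ => Nat.zero_le _) hi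
  have h4 : 0 ≤ (s' i).sup (schwartzSeminormFamily ℝ E F) f := apply_nonneg _ _
  have h5 := hC i
  have h6 : (0 : ℝ) ≤ ∑ i ∈ s, C i := h5.trans h2
  have h7 : 1 ≤ 1 + σ := by linarith
  gcongr

end Seminorms

/-! ### Fourier multipliers in the space variables -/

section Multiplier

variable {d : ℕ}

instance : (volume : Measure (TimeSpace d)).IsAddHaarMeasure :=
  Measure.prod.instIsAddHaarMeasure _ _

/-- Time-space with the Euclidean norm. -/
abbrev EuclTimeSpace (d : ℕ) : Type := WithLp 2 (ℝ × EuclideanSpace ℝ (Fin d))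

/-- Complexification of test functions, with time-space regarded as a Euclidean space. -/
def toEucl (d : ℕ) : TestFn d →L[ℝ] 𝓢(EuclTimeSpace d, ℂ) :=
  (SchwartzMap.compCLMOfContinuousLinearEquiv ℝ
    (WithLp.prodContinuousLinearEquiv 2 ℝ ℝ (EuclideanSpace ℝ (Fin d)))).comp
    (SchwartzMap.postcompCLM Complex.ofRealCLM)

/-- The composition of a Schwartz function on Euclidean time-space with a real-linear map. -/
def ofEucl (d : ℕ) (L : ℂ →L[ℝ] ℝ) : 𝓢(EuclTimeSpace d, ℂ) →L[ℝ] TestFn d :=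
  (SchwartzMap.postcompCLM L).comp (SchwartzMap.compCLMOfContinuousLinearEquiv ℝ
    (WithLp.prodContinuousLinearEquiv 2 ℝ ℝ (EuclideanSpace ℝ (Fin d))).symm)

theorem toEucl_ofEucl (f : 𝓢(EuclTimeSpace d, ℂ)) :
    toEucl d (ofEucl d Complex.reCLM f) + Complex.I • toEucl d (ofEucl d Complex.imCLM f) = f := by
  ext w
  have : ∀ L, toEucl d (ofEucl d L f) w = (L (f w) : ℂ) := fun L => rfl
  rw [add_apply, smul_apply, this, this, smul_eq_mul, mul_comm]
  exact Complex.re_add_im _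

/-- The Fourier transform in time of the spatial Fourier transform is the full one. -/
theorem fourier_invFourierTime (φ : TestFn d) (y : EuclideanSpace ℝ (Fin d)) (ω : ℝ) :
    𝓕 (invFourierTime y φ) ω = (((2 * Real.pi) ^ d : ℝ) : ℂ)⁻¹ *
      𝓕 (toEucl d φ) (WithLp.toLp 2 (ω, -((2 * Real.pi)⁻¹ • y))) := by
  rw [SchwartzMap.fourier_coe, SchwartzMap.fourier_coe, Real.fourier_eq', Real.fourier_eq']
  set G : TimeSpace d → ℂ := fun p => Complex.exp ((↑(-2 * Real.pi * (p.1 * ω)) : ℂ) * Complex.I) *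
    (Complex.exp (Complex.I * (inner ℝ p.2 y : ℝ)) * φ p) with hG
  have h1 : ∫ v : EuclTimeSpace d, Complex.exp ((↑(-2 * Real.pi *
      inner ℝ v (WithLp.toLp 2 (ω, -((2 * Real.pi)⁻¹ • y)))) : ℂ) * Complex.I) • toEucl d φ v =
      ∫ p, G p := by
    rw [← (WithLp.volume_preserving_toLp ℝ (EuclideanSpace ℝ (Fin d))).integral_comp
      (MeasurableEquiv.toLp 2 _).measurableEmbedding]
    refine integral_congr_ae (Eventually.of_forall fun p => ?_)
    have h2 : toEucl d φ (WithLp.toLp 2 p) = φ p := rfl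
    simp only [WithLp.prod_inner_apply, h2, smul_eq_mul, hG]
    rw [← mul_assoc, ← Complex.exp_add]
    congr 2
    simp only [inner_neg_right, inner_smul_right]
    push_cast
    have : (Real.pi : ℂ) ≠ 0 := by exact_mod_cast Real.pi_ne_zero
    simp only [RCLike.inner_apply, conj_trivial]
    push_cast
    field_simp
    ring
  have hGint : Integrable G := by
    refine (φ.integrable (μ := volume)).norm.mono' (by
      have := φ.continuous
      exact (by fun_prop : Continuous G).aestronglyMeasurable) (Eventually.of_forall fun p => ?_)
    rw [hG, norm_mul, norm_mul, Complex.norm_exp_ofReal_mul_I, mul_comm Complex.I,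
      Complex.norm_exp_ofReal_mul_I, Complex.norm_real]
    simp
  rw [h1, Measure.volume_eq_prod, integral_prod _ (by rwa [← Measure.volume_eq_prod]),
    ← integral_const_mul]
  refine integral_congr_ae (Eventually.of_forall fun t => ?_)
  simp only [invFourierTime_apply, hG, smul_eq_mul]
  rw [integral_const_mul, invFourier]
  have : inner ℝ t ω = t * ω := by simp [mul_comm]
  rw [this]
  ring

/-- The Fourier multiplier in the space variables with symbol `y ↦ m(σ y)`. -/
def spatialMultiplier (m : EuclideanSpace ℝ (Fin d) → ℝ) (σ : ℝ) : TestFn d →L[ℝ] TestFn d :=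
  (ofEucl d Complex.reCLM).comp ((fourierInvCLM ℝ _).comp
    ((SchwartzMap.smulLeftCLM ℂ (fun w : EuclTimeSpace d =>
      (fun w : EuclTimeSpace d => m ((2 * Real.pi) • w.snd)) (σ • w))).comp
        ((fourierCLM ℝ _).comp (toEucl d))))

theorem hasTemperateGrowth_symbol {m : EuclideanSpace ℝ (Fin d) → ℝ} (hm : m.HasTemperateGrowth) :
    Function.HasTemperateGrowth fun w : EuclTimeSpace d => m ((2 * Real.pi) • w.snd) := by
  have : (fun w : EuclTimeSpace d => m ((2 * Real.pi) • w.snd)) =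
      m ∘ ((2 * Real.pi) • (ContinuousLinearMap.snd ℝ ℝ (EuclideanSpace ℝ (Fin d))).comp
        (WithLp.prodContinuousLinearEquiv 2 ℝ ℝ
          (EuclideanSpace ℝ (Fin d))).toContinuousLinearMap) := by
    ext w
    rfl
  rw [this]
  exact hm.comp (ContinuousLinearMap.hasTemperateGrowth _)

/-- The multiplier acts on the full Fourier side, so the identity is checked after a further
transform in time, which is injective. It is first obtained for the complex function `f = a + i b`.
Evenness of `m` then removes `b`: one averages the identity at `y` with the conjugate of the
identity at `-y`. -/
theorem invFourier_spatialMultiplier {m : EuclideanSpace ℝ (Fin d) → ℝ}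
    (hm : m.HasTemperateGrowth) (hmeven : ∀ y, m (-y) = m y) (σ : ℝ) (φ : TestFn d) (t : ℝ)
    (y : EuclideanSpace ℝ (Fin d)) :
    invFourier (spatialMultiplier m σ φ) t y = m (σ • y) * invFourier φ t y := by
  set g : EuclTimeSpace d → ℝ := fun w => (fun w : EuclTimeSpace d => m ((2 * Real.pi) • w.snd))
    (σ • w) with hg
  have hgt : g.HasTemperateGrowth := hasTemperateGrowth_comp_smul (hasTemperateGrowth_symbol hm) σ
  set f : 𝓢(EuclTimeSpace d, ℂ) := 𝓕⁻ (SchwartzMap.smulLeftCLM ℂ g (𝓕 (toEucl d φ))) with hf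
  set a := ofEucl d Complex.reCLM f
  set b := ofEucl d Complex.imCLM f
  have ha : spatialMultiplier m σ φ = a := rfl
  have hFf : ∀ w, 𝓕 f w = g w * 𝓕 (toEucl d φ) w := by
    intro w
    rw [hf, fourier_fourierInv_eq, SchwartzMap.smulLeftCLM_apply_apply hgt, Complex.real_smul]
  have hsum : ∀ y : EuclideanSpace ℝ (Fin d), invFourierTime y a + Complex.I • invFourierTime y b =
      (m (σ • y) : ℂ) • invFourierTime y φ := by
    intro y
    have hinj : ∀ u v : 𝓢(ℝ, ℂ), 𝓕 u = 𝓕 v → u = v := fun u v h => by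
      rw [← fourierInv_fourier_eq (E := 𝓢(ℝ, ℂ)) (F := 𝓢(ℝ, ℂ)) u, h, fourierInv_fourier_eq]
    apply hinj
    ext ω
    have hval : g (WithLp.toLp 2 (ω, -((2 * Real.pi)⁻¹ • y))) = m (σ • y) := by
      rw [hg]
      simp only [WithLp.smul_snd]
      rw [← hmeven]
      congr 1
      change -((2 * Real.pi) • σ • (-((2 * Real.pi)⁻¹ • y))) = σ • y
      rw [smul_neg, smul_neg, neg_neg, smul_comm σ, smul_inv_smul₀ (by positivity)]
    have hsplit := hFf (WithLp.toLp 2 (ω, -((2 * Real.pi)⁻¹ • y)))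
    rw [← toEucl_ofEucl f, FourierAdd.fourier_add, FourierTransform.fourier_smul, add_apply,
      smul_apply, hval] at hsplit
    rw [FourierAdd.fourier_add, FourierTransform.fourier_smul, FourierTransform.fourier_smul,
      add_apply, smul_apply, smul_apply, fourier_invFourierTime, fourier_invFourierTime,
      fourier_invFourierTime]
    simp only [smul_eq_mul] at hsplit ⊢
    linear_combination (((2 * Real.pi) ^ d : ℝ) : ℂ)⁻¹ * hsplit
  have h1 : ∀ y, invFourier a t y + Complex.I * invFourier b t y =
      m (σ • y) * invFourier φ t y := by
    intro y
    have := congrArg (fun u : 𝓢(ℝ, ℂ) => u t) (hsum y)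
    simpa using this
  have h2 := congrArg conj (h1 (-y))
  simp only [map_add, map_mul, invFourier_neg_right, Complex.conj_conj, Complex.conj_I,
    Complex.conj_ofReal, smul_neg, hmeven] at h2
  rw [ha]
  linear_combination (1 / 2 : ℂ) * h1 y + (1 / 2 : ℂ) * h2

theorem exists_seminorm_spatialMultiplier_le {m : EuclideanSpace ℝ (Fin d) → ℝ}
    (hm : m.HasTemperateGrowth) (s : Finset (ℕ × ℕ)) :
    ∃ (s' : Finset (ℕ × ℕ)) (C : ℝ) (M : ℕ), 0 ≤ C ∧ ∀ (σ : ℝ), 0 ≤ σ → ∀ φ : TestFn d,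
      s.sup (schwartzSeminormFamily ℝ (TimeSpace d) ℝ) (spatialMultiplier m σ φ) ≤
        C * (1 + σ) ^ M * s'.sup (schwartzSeminormFamily ℝ (TimeSpace d) ℝ) φ := by
  obtain ⟨s₁, C₁, hC₁, h₁⟩ := exists_sup_seminorm_le
    ((ofEucl d Complex.reCLM).comp (fourierInvCLM ℝ 𝓢(EuclTimeSpace d, ℂ))) s
  obtain ⟨s₂, C₂, M, hC₂, h₂⟩ := exists_seminorm_smulLeftCLM_dilation_le (F := ℂ)
    (hasTemperateGrowth_symbol hm) s₁
  obtain ⟨s₃, C₃, hC₃, h₃⟩ := exists_sup_seminorm_le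
    ((fourierCLM ℝ 𝓢(EuclTimeSpace d, ℂ)).comp (toEucl d)) s₂
  refine ⟨s₃, C₁ * (C₂ * C₃), M, by positivity, fun σ hσ φ => ?_⟩
  refine (h₁ _).trans ?_
  calc _ ≤ C₁ * (C₂ * (1 + σ) ^ M * (C₃ * s₃.sup (schwartzSeminormFamily ℝ (TimeSpace d) ℝ) φ)) := by
        gcongr
        exact (h₂ σ hσ _).trans (by gcongr; exact h₃ φ)
    _ = _ := by ring

end Multiplier

end

/-! ### Translation in time with a cutoff -/

theorem integrableOn_rpow_mul_one_add_pow_inv {a : ℝ} {N : ℕ} (ha : 0 < a) (hN : a < N) :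
    IntegrableOn (fun τ : ℝ => τ ^ (a - 1) * ((1 + τ) ^ N)⁻¹) (Ioi 0) := by
  have hmeas : Measurable fun τ : ℝ => τ ^ (a - 1) * ((1 + τ) ^ N)⁻¹ := by fun_prop
  rw [← Ioc_union_Ioi_eq_Ioi zero_le_one]
  refine IntegrableOn.union ?_ ?_
  · have h1 : IntegrableOn (fun τ : ℝ => τ ^ (a - 1)) (Ioc 0 1) :=
      (intervalIntegrable_iff_integrableOn_Ioc_of_le zero_le_one).mp
        (intervalIntegral.intervalIntegrable_rpow' (by linarith))
    refine h1.mono' hmeas.aestronglyMeasurable ?_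
    refine (ae_restrict_iff' measurableSet_Ioc).mpr (Eventually.of_forall fun τ hτ => ?_)
    have h2 : 0 ≤ τ ^ (a - 1) := Real.rpow_nonneg hτ.1.le _
    have h3 : (1 : ℝ) ≤ (1 + τ) ^ N := one_le_pow₀ (by linarith [hτ.1])
    rw [Real.norm_of_nonneg (by positivity)]
    exact mul_le_of_le_one_right h2 (inv_le_one_of_one_le₀ h3)
  · refine (integrableOn_Ioi_rpow_of_lt (a := a - 1 - N) (by linarith) zero_lt_one).mono'
      hmeas.aestronglyMeasurable ?_
    refine (ae_restrict_iff' measurableSet_Ioi).mpr (Eventually.of_forall fun τ hτ => ?_)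
    have hτ' : 0 < τ := zero_lt_one.trans hτ
    have h2 : 0 ≤ τ ^ (a - 1) := Real.rpow_nonneg hτ'.le _
    rw [Real.norm_of_nonneg (by positivity), Real.rpow_sub hτ' (a - 1), Real.rpow_natCast,
      div_eq_mul_inv]
    gcongr
    linarith

/-- A smooth cutoff, `0` for `t ≤ -2` and `1` for `t ≥ -1`. -/
def cutoff (t : ℝ) : ℝ := Real.smoothTransition (t + 2)

theorem cutoff_of_ge {t : ℝ} (ht : -1 ≤ t) : cutoff t = 1 :=
  Real.smoothTransition.one_of_one_le (by linarith)

theorem cutoff_of_le {t : ℝ} (ht : t ≤ -2) : cutoff t = 0 :=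
  Real.smoothTransition.zero_of_nonpos (by linarith)

theorem contDiff_cutoff : ContDiff ℝ (⊤ : ℕ∞) cutoff :=
  Real.smoothTransition.contDiff.comp (contDiff_id.add contDiff_const)

theorem hasTemperateGrowth_cutoff : cutoff.HasTemperateGrowth := by
  refine Function.HasTemperateGrowth.of_fderiv (k := 0) (C := 1) ?_
    (contDiff_cutoff.differentiable (by simp)) fun t => ?_
  · refine HasCompactSupport.hasTemperateGrowth ?_ (contDiff_cutoff.fderiv_right (m := (⊤ : ℕ∞)) (by simp))
    refine HasCompactSupport.intro (isCompact_Icc (a := (-2 : ℝ)) (b := -1)) fun t ht => ?_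
    rw [mem_Icc, not_and_or, not_le, not_le] at ht
    have h0 : ∀ c : ℝ, cutoff =ᶠ[𝓝 t] (fun _ => c) → fderiv ℝ cutoff t = 0 := fun c h => by
      rw [h.fderiv_eq]
      simp
    rcases ht with ht | ht
    · exact h0 0 ((eventually_lt_nhds ht).mono fun s hs => cutoff_of_le hs.le)
    · exact h0 1 ((eventually_gt_nhds ht).mono fun s hs => cutoff_of_ge hs.le)
  · simp only [pow_zero, mul_one, cutoff]
    rw [Real.norm_of_nonneg (Real.smoothTransition.nonneg _)]
    exact Real.smoothTransition.le_one _

variable {d : ℕ}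

theorem hasTemperateGrowth_cutoff_fst :
    Function.HasTemperateGrowth fun p : TimeSpace d => cutoff p.1 :=
  hasTemperateGrowth_cutoff.comp
    (ContinuousLinearMap.fst ℝ ℝ (EuclideanSpace ℝ (Fin d))).hasTemperateGrowth

/-- The operator taking `φ` to the test function `(t, x) ↦ cutoff t * φ (t + τ, x)`. -/
def cutShift (τ : ℝ) : TestFn d →L[ℝ] TestFn d :=
  (SchwartzMap.smulLeftCLM ℝ fun p : TimeSpace d => cutoff p.1).comp
    (SchwartzMap.compSubConstCLM ℝ (-(τ, 0) : TimeSpace d))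

theorem cutShift_apply (τ : ℝ) (φ : TestFn d) (p : TimeSpace d) :
    cutShift τ φ p = cutoff p.1 * φ (p.1 + τ, p.2) := by
  rw [cutShift, ContinuousLinearMap.comp_apply,
    SchwartzMap.smulLeftCLM_apply_apply hasTemperateGrowth_cutoff_fst,
    SchwartzMap.compSubConstCLM_apply, smul_eq_mul]
  congr 2
  ext <;> simp

theorem invFourier_cutShift (τ : ℝ) (φ : TestFn d) (t : ℝ) (y : EuclideanSpace ℝ (Fin d)) :
    invFourier (cutShift τ φ) t y = cutoff t * invFourier φ (t + τ) y := by
  simp only [invFourier_eq_integral, cutShift_apply]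
  rw [← integral_const_mul]
  refine integral_congr_ae (Eventually.of_forall fun x => ?_)
  simp only [Complex.real_smul]
  push_cast
  ring

/-- The cutoff restricts to `t ≥ -2`. There `τ` is bounded by the size of the shifted point, so the
decay of `φ` becomes decay in `τ`. -/
theorem exists_seminorm_cutShift_le (N : ℕ) (s : Finset (ℕ × ℕ)) :
    ∃ (s' : Finset (ℕ × ℕ)) (C : ℝ), 0 ≤ C ∧ ∀ (τ : ℝ), 0 ≤ τ → ∀ φ : TestFn d,
      s.sup (schwartzSeminormFamily ℝ (TimeSpace d) ℝ) (cutShift τ φ) ≤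
        C * ((1 + τ) ^ N)⁻¹ * s'.sup (schwartzSeminormFamily ℝ (TimeSpace d) ℝ) φ := by
  have single : ∀ i : ℕ × ℕ, ∃ (s' : Finset (ℕ × ℕ)) (C : ℝ), 0 ≤ C ∧ ∀ (τ : ℝ), 0 ≤ τ →
      ∀ φ : TestFn d, schwartzSeminormFamily ℝ (TimeSpace d) ℝ i (cutShift τ φ) ≤
        C * ((1 + τ) ^ N)⁻¹ * s'.sup (schwartzSeminormFamily ℝ (TimeSpace d) ℝ) φ := by
    rintro ⟨k, n⟩
    obtain ⟨K, C, hC, h⟩ := (hasTemperateGrowth_cutoff_fst (d := d)).norm_iteratedFDeriv_le_uniform n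
    set m : ℕ × ℕ := (k + K + N, n)
    refine ⟨Finset.Iic m, 2 ^ n * (C * (3 ^ (k + K + N) * 2 ^ (k + K + N))), by positivity,
      fun τ hτ φ => ?_⟩
    have hsup : 0 ≤ (Finset.Iic m).sup (schwartzSeminormFamily ℝ (TimeSpace d) ℝ) φ :=
      apply_nonneg _ _
    refine SchwartzMap.seminorm_le_bound ℝ k n _ (by positivity) fun x => ?_
    set f : TestFn d := SchwartzMap.compSubConstCLM ℝ (-(τ, 0) : TimeSpace d) φ with hf
    have hfun : ⇑(cutShift τ φ) = fun p => cutoff p.1 • f p := by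
      ext p
      exact SchwartzMap.smulLeftCLM_apply_apply hasTemperateGrowth_cutoff_fst f p
    by_cases hx : x.1 < -2
    · have h0 : ⇑(cutShift τ φ) =ᶠ[𝓝 x] fun _ => 0 := by
        have : ∀ᶠ p : TimeSpace d in 𝓝 x, p.1 < -2 :=
          continuous_fst.continuousAt.eventually (eventually_lt_nhds hx)
        filter_upwards [this] with p hp
        rw [cutShift_apply, cutoff_of_le hp.le, zero_mul]
      rw [(h0.iteratedFDeriv ℝ n).eq_of_nhds]
      simp only [iteratedFDeriv_fun_zero, Pi.zero_apply, norm_zero, mul_zero]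
      positivity
    · rw [not_lt] at hx
      rw [hfun]
      refine (pow_mul_norm_iteratedFDeriv_smul_le (K := K) (G := C)
        (S := 3 ^ (k + K + N) * (2 ^ (k + K + N) *
          (Finset.Iic m).sup (schwartzSeminormFamily ℝ (TimeSpace d) ℝ) φ) * ((1 + τ) ^ N)⁻¹)
        hasTemperateGrowth_cutoff_fst.1 f x hC (fun i hi => h i hi x)
        (fun j hj => ?_)).trans (le_of_eq (by ring))
      set x' : TimeSpace d := x - (-(τ, 0)) with hx'
      -- Both `1 + τ` and `1 + ‖x‖` are at most `3 (1 + ‖x'‖)` at the shifted point `x'`, since `-2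
      -- ≤ t`.
      have h1 : iteratedFDeriv ℝ j f x = iteratedFDeriv ℝ j φ x' := by
        have : (f : TimeSpace d → ℝ) = fun z => φ (z - (-(τ, 0))) := by
          ext z
          rw [hf, SchwartzMap.compSubConstCLM_apply]
        rw [this, iteratedFDeriv_comp_sub]
      have h2 := SchwartzMap.one_add_le_sup_seminorm_apply (𝕜 := ℝ) (m := m) le_rfl hj φ x'
      have hx1 : x'.1 = x.1 + τ := by simp [hx']
      have hx2 : x'.2 = x.2 := by simp [hx']
      have hn1 : |x.1 + τ| ≤ ‖x'‖ := by rw [← hx1]; exact norm_fst_le x'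
      have hn2 : ‖x.2‖ ≤ ‖x'‖ := by rw [← hx2]; exact norm_snd_le x'
      have h3 : 1 + τ ≤ 3 * (1 + ‖x'‖) := by
        have := le_abs_self (x.1 + τ)
        linarith [norm_nonneg x']
      have h4 : 1 + ‖x‖ ≤ 3 * (1 + ‖x'‖) := by
        have : ‖x‖ ≤ 2 + ‖x'‖ := by
          rw [Prod.norm_def]
          refine max_le ?_ (by linarith)
          rw [Real.norm_eq_abs]
          have := le_abs_self (x.1 + τ)
          exact abs_le.mpr ⟨by linarith [norm_nonneg x'], by linarith⟩
        linarith [norm_nonneg x']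
      rw [h1, ← div_eq_mul_inv, le_div_iff₀ (by positivity)]
      calc (1 + ‖x‖) ^ (k + K) * ‖iteratedFDeriv ℝ j φ x'‖ * (1 + τ) ^ N
          ≤ (3 * (1 + ‖x'‖)) ^ (k + K) * ‖iteratedFDeriv ℝ j φ x'‖ * (3 * (1 + ‖x'‖)) ^ N := by
            gcongr
        _ = 3 ^ (k + K + N) * ((1 + ‖x'‖) ^ (k + K + N) * ‖iteratedFDeriv ℝ j φ x'‖) := by
            rw [mul_pow, mul_pow]; ring
        _ ≤ _ := mul_le_mul_of_nonneg_left h2 (by positivity)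
  choose s' C hC h using single
  refine ⟨s.biUnion s', ∑ i ∈ s, C i, Finset.sum_nonneg fun i _ => hC i, fun τ hτ φ => ?_⟩
  refine Seminorm.finset_sup_apply_le
    (mul_nonneg (mul_nonneg (Finset.sum_nonneg fun i _ => hC i) (by positivity)) (apply_nonneg _ _))
    fun i hi => ?_
  refine (h i τ hτ φ).trans ?_
  have h1 : (s' i).sup (schwartzSeminormFamily ℝ (TimeSpace d) ℝ) φ ≤
      (s.biUnion s').sup (schwartzSeminormFamily ℝ (TimeSpace d) ℝ) φ :=
    Seminorm.le_def.mp (Finset.sup_mono (Finset.subset_biUnion_of_mem s' hi)) φ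
  have h2 : C i ≤ ∑ i ∈ s, C i := Finset.single_le_sum (fun i _ => hC i) hi
  have h4 : 0 ≤ (s' i).sup (schwartzSeminormFamily ℝ (TimeSpace d) ℝ) φ := apply_nonneg _ _
  have h6 : (0 : ℝ) ≤ ∑ i ∈ s, C i := (hC i).trans h2
  gcongr

/-! ### The dual Duhamel operator -/

/-- The symbol `E_{α,α}(-‖y‖²)`. -/
def duhamelSymbol (d : ℕ) (α : ℝ) (y : EuclideanSpace ℝ (Fin d)) : ℝ :=
  mittagLeffler α α (-‖y‖ ^ 2)

/-- The contribution of the time lag `τ` to the operator dual to the Duhamel formula. -/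
def duhamelFamily (d : ℕ) (α lam τ : ℝ) : TestFn d →L[ℝ] TestFn d :=
  τ ^ (α - 1) • (spatialMultiplier (duhamelSymbol d α) (√lam * τ ^ (α / 2))).comp (cutShift τ)

variable {α lam : ℝ}

theorem hasTemperateGrowth_duhamelSymbol (hα₀ : 0 < α) (hα₂ : α < 2) :
    (duhamelSymbol d α).HasTemperateGrowth :=
  hasTemperateGrowth_mittagLeffler_neg_norm_sq hα₀ hα₂ α

/-- For each lag the symbol is a dilation of the single function `duhamelSymbol`, with factor `√λ
τ^(α/2)`, so one estimate for dilations covers the whole family. -/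
theorem duhamelSymbol_smul (hlam : 0 < lam) {τ : ℝ} (hτ : 0 < τ) (y : EuclideanSpace ℝ (Fin d)) :
    duhamelSymbol d α ((√lam * τ ^ (α / 2)) • y) =
      mittagLeffler α α (-(lam * ‖y‖ ^ 2 * τ ^ α)) := by
  rw [duhamelSymbol, norm_smul, Real.norm_of_nonneg (by positivity)]
  congr 2
  rw [mul_pow, mul_pow, Real.sq_sqrt hlam.le, ← Real.rpow_natCast (τ ^ (α / 2)),
    ← Real.rpow_mul hτ.le]
  rw [show α / 2 * (2 : ℕ) = α by push_cast; ring]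
  ring

theorem invFourier_duhamelFamily (hα₀ : 0 < α) (hα₂ : α < 2) (hlam : 0 < lam) {τ : ℝ} (hτ : 0 < τ)
    (φ : TestFn d) (t : ℝ) (y : EuclideanSpace ℝ (Fin d)) :
    invFourier (duhamelFamily d α lam τ φ) t y =
      (mlKernel α α (lam * ‖y‖ ^ 2) τ : ℂ) * (cutoff t * invFourier φ (t + τ) y) := by
  have h1 : duhamelFamily d α lam τ φ = τ ^ (α - 1) •
      spatialMultiplier (duhamelSymbol d α) (√lam * τ ^ (α / 2)) (cutShift τ φ) := rfl
  rw [h1, invFourier_smul, invFourier_spatialMultiplier (hasTemperateGrowth_duhamelSymbol hα₀ hα₂)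
    (fun y => by simp [duhamelSymbol]), invFourier_cutShift, duhamelSymbol_smul hlam hτ, mlKernel]
  push_cast
  ring

theorem measurable_mlKernel (hα : 0 < α) (β : ℝ) :
    Measurable fun q : ℝ × ℝ => mlKernel α β q.1 q.2 := by
  have := continuous_mittagLeffler hα β
  unfold mlKernel
  fun_prop

theorem duhamelFamily_apply (hα₀ : 0 < α) (hα₂ : α < 2) (hlam : 0 < lam) {τ : ℝ} (hτ : 0 < τ)
    (φ : TestFn d) (p : TimeSpace d) :
    (duhamelFamily d α lam τ φ p : ℂ) = ∫ y : EuclideanSpace ℝ (Fin d),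
      Complex.exp (-(Complex.I * (inner ℝ p.2 y : ℝ))) *
        ((mlKernel α α (lam * ‖y‖ ^ 2) τ : ℂ) * (cutoff p.1 * invFourier φ (p.1 + τ) y)) := by
  rw [← integral_exp_mul_invFourier]
  refine integral_congr_ae (Eventually.of_forall fun y => ?_)
  simp only [invFourier_duhamelFamily hα₀ hα₂ hlam hτ]

/-- Joint measurability in the lag and the point is not visible from the operators; it is read off
from the explicit Fourier integral. -/
theorem aestronglyMeasurable_duhamelFamily (hα₀ : 0 < α) (hα₂ : α < 2) (hlam : 0 < lam)
    (φ : TestFn d) : ∃ g : ℝ × TimeSpace d → ℝ, Measurable g ∧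
      ∀ τ > 0, ∀ p, duhamelFamily d α lam τ φ p = g (τ, p) := by
  set G : (ℝ × TimeSpace d) × EuclideanSpace ℝ (Fin d) → ℂ := fun q =>
    Complex.exp (-(Complex.I * (inner ℝ q.1.2.2 q.2 : ℝ))) *
      ((mlKernel α α (lam * ‖q.2‖ ^ 2) q.1.1 : ℂ) *
        (cutoff q.1.2.1 * invFourier φ (q.1.2.1 + q.1.1) q.2)) with hG
  have hGm : Measurable G := by
    have h1 : Continuous fun q : (ℝ × TimeSpace d) × EuclideanSpace ℝ (Fin d) =>
        Complex.exp (-(Complex.I * (inner ℝ q.1.2.2 q.2 : ℝ))) := by fun_prop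
    have h2 : Continuous fun q : (ℝ × TimeSpace d) × EuclideanSpace ℝ (Fin d) =>
        ((cutoff q.1.2.1 : ℂ) * invFourier φ (q.1.2.1 + q.1.1) q.2) :=
      (Complex.continuous_ofReal.comp (contDiff_cutoff.continuous.comp (by fun_prop))).mul
        ((continuous_invFourier φ).comp (f := fun q : (ℝ × TimeSpace d) × EuclideanSpace ℝ (Fin d) =>
          (q.1.2.1 + q.1.1, q.2)) (by fun_prop))
    have h3 : Measurable fun q : (ℝ × TimeSpace d) × EuclideanSpace ℝ (Fin d) =>
        (mlKernel α α (lam * ‖q.2‖ ^ 2) q.1.1 : ℂ) :=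
      Complex.measurable_ofReal.comp ((measurable_mlKernel hα₀ α).comp
        (f := fun q : (ℝ × TimeSpace d) × EuclideanSpace ℝ (Fin d) => (lam * ‖q.2‖ ^ 2, q.1.1))
        (by fun_prop))
    exact h1.measurable.mul (h3.mul h2.measurable)
  refine ⟨fun q => (∫ y, G (q, y)).re, Complex.measurable_re.comp
    hGm.stronglyMeasurable.integral_prod_right'.measurable, fun τ hτ p => ?_⟩
  simp only [hG]
  rw [← duhamelFamily_apply hα₀ hα₂ hlam hτ, Complex.ofReal_re]

theorem exists_seminorm_duhamelFamily_le (hα₀ : 0 < α) (hα₂ : α < 2) (hlam : 0 < lam)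
    (s : Finset (ℕ × ℕ)) : ∃ (s' : Finset (ℕ × ℕ)) (C : ℝ), 0 ≤ C ∧ ∀ τ > 0, ∀ φ : TestFn d,
      s.sup (schwartzSeminormFamily ℝ (TimeSpace d) ℝ) (duhamelFamily d α lam τ φ) ≤
        C * (τ ^ (α - 1) * ((1 + τ) ^ 2)⁻¹) *
          s'.sup (schwartzSeminormFamily ℝ (TimeSpace d) ℝ) φ := by
  obtain ⟨s₁, C₁, M, hC₁, h₁⟩ := exists_seminorm_spatialMultiplier_le
    (hasTemperateGrowth_duhamelSymbol (d := d) hα₀ hα₂) s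
  -- `M` powers of decay absorb the growth of the dilations, since `τ^(α/2) ≤ 1 + τ`; the other two
  -- make `τ^(α-1)` integrable at infinity, as `α < 2`.
  obtain ⟨s₂, C₂, hC₂, h₂⟩ := exists_seminorm_cutShift_le (d := d) (M + 2) s₁
  refine ⟨s₂, C₁ * (1 + √lam) ^ M * C₂, by positivity, fun τ hτ φ => ?_⟩
  have e1 : duhamelFamily d α lam τ φ = τ ^ (α - 1) •
      spatialMultiplier (duhamelSymbol d α) (√lam * τ ^ (α / 2)) (cutShift τ φ) := rfl
  have e2 : 0 < τ ^ (α - 1) := Real.rpow_pos_of_pos hτ _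
  have e3 : τ ^ (α / 2) ≤ 1 + τ := by
    calc τ ^ (α / 2) ≤ (1 + τ) ^ (α / 2) := by
          apply Real.rpow_le_rpow hτ.le (by linarith) (by linarith)
      _ ≤ (1 + τ) ^ (1 : ℝ) := Real.rpow_le_rpow_of_exponent_le (by linarith) (by linarith)
      _ = 1 + τ := Real.rpow_one _
  have e4 : 1 + √lam * τ ^ (α / 2) ≤ (1 + √lam) * (1 + τ) := by
    have : √lam * τ ^ (α / 2) ≤ √lam * (1 + τ) := by gcongr
    nlinarith
  have e5 : 0 < τ ^ (α / 2) := Real.rpow_pos_of_pos hτ _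
  rw [e1, map_smul_eq_mul, Real.norm_of_nonneg e2.le]
  calc τ ^ (α - 1) * s.sup (schwartzSeminormFamily ℝ (TimeSpace d) ℝ)
        (spatialMultiplier (duhamelSymbol d α) (√lam * τ ^ (α / 2)) (cutShift τ φ))
      ≤ τ ^ (α - 1) * (C₁ * ((1 + √lam) * (1 + τ)) ^ M * (C₂ * ((1 + τ) ^ (M + 2))⁻¹ *
          s₂.sup (schwartzSeminormFamily ℝ (TimeSpace d) ℝ) φ)) := by
        refine mul_le_mul_of_nonneg_left ((h₁ _ (by positivity) _).trans ?_) e2.le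
        gcongr
        exact h₂ τ hτ.le φ
    _ = _ := by
        rw [mul_pow, pow_add]
        have : (1 + τ) ^ M ≠ 0 := by positivity
        field_simp

theorem integrableFamily_duhamelFamily (hα₀ : 0 < α) (hα₂ : α < 2) (hlam : 0 < lam) :
    IntegrableFamily (volume.restrict (Ioi 0)) (duhamelFamily d α lam) where
  measurable φ p := by
    obtain ⟨g, hg, h⟩ := aestronglyMeasurable_duhamelFamily hα₀ hα₂ hlam φ
    have h1 : Measurable fun τ => g (τ, p) := by fun_prop
    refine h1.aestronglyMeasurable.congr ?_
    exact (ae_restrict_iff' measurableSet_Ioi).mpr (Eventually.of_forall fun τ hτ => (h τ hτ p).symm)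
  bound k n := by
    obtain ⟨s, C, hC, h⟩ := exists_seminorm_duhamelFamily_le (d := d) hα₀ hα₂ hlam {(k, n)}
    refine ⟨s, fun τ => C * |τ ^ (α - 1) * ((1 + τ) ^ 2)⁻¹|, ?_, fun τ => by positivity, ?_⟩
    · exact (integrableOn_rpow_mul_one_add_pow_inv hα₀ (by exact_mod_cast hα₂)).norm.const_mul C
    · refine (ae_restrict_iff' measurableSet_Ioi).mpr (Eventually.of_forall fun τ hτ φ x => ?_)
      have h1 := h τ hτ φ
      rw [Finset.sup_singleton] at h1
      have h0 : 0 ≤ τ ^ (α - 1) := Real.rpow_nonneg (le_of_lt hτ) _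
      have h2 : 0 < 1 + τ := by have : 0 < τ := hτ; linarith
      beta_reduce
      rw [abs_of_nonneg (a := τ ^ (α - 1) * ((1 + τ) ^ 2)⁻¹) (by positivity)]
      exact (SchwartzMap.le_seminorm ℝ k n _ x).trans h1

/-- The operator dual to the Duhamel formula: it multiplies, in Fourier variables, with the
Mittag-Leffler kernel, integrated over the time lag, and agrees with the true dual for `t ≥ -1`. -/
def duhamel (d : ℕ) (hα₀ : 0 < α) (hα₂ : α < 2) (hlam : 0 < lam) : TestFn d →L[ℝ] TestFn d :=
  (integrableFamily_duhamelFamily hα₀ hα₂ hlam).integralCLM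

theorem IntegrableFamily.invFourier_integralCLM {T : Type*} [MeasurableSpace T] {ν : Measure T}
    [SFinite ν] {A : T → TestFn d →L[ℝ] TestFn d} (hA : IntegrableFamily ν A) (φ : TestFn d) (t : ℝ)
    (hm : AEStronglyMeasurable (fun q : EuclideanSpace ℝ (Fin d) × T => A q.2 φ (t, q.1))
      (volume.prod ν)) (y : EuclideanSpace ℝ (Fin d)) :
    invFourier (hA.integralCLM φ) t y = ∫ τ, invFourier (A τ φ) t y ∂ν := by
  set N := Module.finrank ℝ (EuclideanSpace ℝ (Fin d)) + 1
  obtain ⟨s₀, b₀, hb₀, hb₀', h₀⟩ := hA.bound 0 0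
  obtain ⟨s₁, b₁, hb₁, hb₁', h₁⟩ := hA.bound N 0
  set S₀ := s₀.sup (schwartzSeminormFamily ℝ (TimeSpace d) ℝ) φ
  set S₁ := s₁.sup (schwartzSeminormFamily ℝ (TimeSpace d) ℝ) φ
  have hswap : Integrable (Function.uncurry fun (x : EuclideanSpace ℝ (Fin d)) (τ : T) =>
      A τ φ (t, x) • fourierWeight y x) (volume.prod ν) := by
    -- Fubini needs a joint majorant in `x` and `τ`. The seminorm bounds with weights `1` and
    -- `‖x‖^N` combine to one with `(1 + ‖x‖)^N`.
    have hb : Integrable (fun q : EuclideanSpace ℝ (Fin d) × T => (2 ^ (N - 1) *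
        ((2 * Real.pi) ^ d)⁻¹) * (((1 + ‖q.1‖) ^ N)⁻¹ * (b₀ q.2 * S₀ + b₁ q.2 * S₁)))
        (volume.prod ν) :=
      ((integrable_inv_one_add_norm_pow volume (Nat.lt_succ_self _)).mul_prod
        ((hb₀.mul_const _).add (hb₁.mul_const _))).const_mul _
    refine hb.mono' ?_ ?_
    · exact hm.smul ((continuous_fourierWeight y).measurable.comp measurable_fst).aestronglyMeasurable
    · filter_upwards [Measure.quasiMeasurePreserving_snd.ae h₀,
        Measure.quasiMeasurePreserving_snd.ae h₁] with q hq₀ hq₁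
      have h2 := hq₀ φ (t, q.1)
      have h3 := hq₁ φ (t, q.1)
      rw [norm_iteratedFDeriv_zero] at h2 h3
      rw [pow_zero, one_mul] at h2
      have h4 : ‖q.1‖ ≤ ‖((t, q.1) : TimeSpace d)‖ := norm_snd_le (t, q.1)
      have h5 : (1 + ‖q.1‖) ^ N ≤ 2 ^ (N - 1) * (1 + ‖((t, q.1) : TimeSpace d)‖ ^ N) := by
        calc (1 + ‖q.1‖) ^ N ≤ (1 + ‖((t, q.1) : TimeSpace d)‖) ^ N := by gcongr
          _ ≤ 2 ^ (N - 1) * (1 ^ N + ‖((t, q.1) : TimeSpace d)‖ ^ N) :=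
            add_pow_le zero_le_one (norm_nonneg _) N
          _ = _ := by rw [one_pow]
      have h6 : (1 + ‖q.1‖) ^ N * ‖A q.2 φ (t, q.1)‖ ≤
          2 ^ (N - 1) * (b₀ q.2 * S₀ + b₁ q.2 * S₁) := by
        calc (1 + ‖q.1‖) ^ N * ‖A q.2 φ (t, q.1)‖
            ≤ 2 ^ (N - 1) * (1 + ‖((t, q.1) : TimeSpace d)‖ ^ N) * ‖A q.2 φ (t, q.1)‖ := by gcongr
          _ = 2 ^ (N - 1) * (‖A q.2 φ (t, q.1)‖ +
              ‖((t, q.1) : TimeSpace d)‖ ^ N * ‖A q.2 φ (t, q.1)‖) := by ring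
          _ ≤ _ := by gcongr
      rw [mul_comm ((1 + ‖q.1‖) ^ N), ← le_div_iff₀ (by positivity), div_eq_mul_inv] at h6
      simp only [Function.uncurry]
      rw [norm_smul, norm_fourierWeight]
      calc _ ≤ _ * ((2 * Real.pi) ^ d)⁻¹ := mul_le_mul_of_nonneg_right h6 (by positivity)
        _ = _ := by ring
  have h1 : invFourier (hA.integralCLM φ) t y =
      ∫ x, ∫ τ, A τ φ (t, x) • fourierWeight y x ∂ν := by
    rw [invFourier_eq_integral]
    refine integral_congr_ae (Eventually.of_forall fun x => ?_)
    simp only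
    rw [integral_smul_const]
    rfl
  rw [h1, integral_integral_swap hswap]
  simp only [invFourier_eq_integral]

theorem ae_prod_restrict_Ioi_snd_pos {X : Type*} [MeasurableSpace X] {μ : Measure X} :
    ∀ᵐ q : X × ℝ ∂(μ.prod (volume.restrict (Ioi (0 : ℝ)))), 0 < q.2 :=
  Measure.quasiMeasurePreserving_snd.ae (ae_restrict_mem measurableSet_Ioi)

theorem invFourier_duhamel (hα₀ : 0 < α) (hα₂ : α < 2) (hlam : 0 < lam) (φ : TestFn d) {t : ℝ}
    (ht : -1 ≤ t) (y : EuclideanSpace ℝ (Fin d)) :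
    invFourier (duhamel d hα₀ hα₂ hlam φ) t y =
      ∫ τ in Ioi 0, (mlKernel α α (lam * ‖y‖ ^ 2) τ : ℂ) * invFourier φ (t + τ) y := by
  obtain ⟨g, hg, hgeq⟩ := aestronglyMeasurable_duhamelFamily hα₀ hα₂ hlam φ
  rw [duhamel, IntegrableFamily.invFourier_integralCLM]
  · refine setIntegral_congr_fun measurableSet_Ioi fun τ hτ => ?_
    rw [invFourier_duhamelFamily hα₀ hα₂ hlam hτ, cutoff_of_ge ht]
    simp
  · have hm : Measurable fun q : EuclideanSpace ℝ (Fin d) × ℝ => g (q.2, (t, q.1)) :=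
      hg.comp (by fun_prop)
    refine hm.aestronglyMeasurable.congr ?_
    filter_upwards [ae_prod_restrict_Ioi_snd_pos] with q hq
    rw [hgeq _ hq]

/-! ### Integrals over a time lag -/

/-- A measurable kernel on `(0, ∞)` with an integrable singularity at `0` and polynomial growth. -/
structure IsLagKernel (k : ℝ → ℝ) : Prop where
  measurable : Measurable k
  bound : ∃ (a C : ℝ) (M : ℕ), 0 < a ∧ 0 ≤ C ∧ ∀ τ > 0, |k τ| ≤ C * (τ ^ (a - 1) * (1 + τ) ^ M)

/-- A measurable function that decays rapidly on `[0, ∞)`. -/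
structure RapidDecay (h : ℝ → ℂ) : Prop where
  measurable : Measurable h
  bound : ∀ N : ℕ, ∃ C : ℝ, 0 ≤ C ∧ ∀ t ≥ 0, ‖h t‖ ≤ C * ((1 + t) ^ N)⁻¹

/-- The integral `∫_0^∞ k(τ) h(t + τ) dτ`. -/
def lagIntegral (k : ℝ → ℝ) (h : ℝ → ℂ) (t : ℝ) : ℂ := ∫ τ in Ioi 0, (k τ : ℂ) * h (t + τ)

theorem RapidDecay.comp_add {h : ℝ → ℂ} (hh : RapidDecay h) {t : ℝ} (ht : 0 ≤ t) :
    RapidDecay fun s => h (t + s) where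
  measurable := hh.measurable.comp (by fun_prop)
  bound N := by
    obtain ⟨C, hC, hb⟩ := hh.bound N
    refine ⟨C, hC, fun s hs => (hb (t + s) (by linarith [hs.le])).trans ?_⟩
    gcongr
    linarith

theorem rapidDecay_schwartz (f : 𝓢(ℝ, ℂ)) : RapidDecay f where
  measurable := f.continuous.measurable
  bound N := by
    refine ⟨2 ^ N * (Finset.Iic (N, 0)).sup (schwartzSeminormFamily ℝ ℝ ℂ) f,
      mul_nonneg (by positivity) (apply_nonneg _ _), fun t ht => ?_⟩
    have h := SchwartzMap.one_add_le_sup_seminorm_apply (𝕜 := ℝ) (m := (N, 0)) le_rfl le_rfl f t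
    rw [norm_iteratedFDeriv_zero, Real.norm_of_nonneg ht] at h
    rw [← div_eq_mul_inv, le_div_iff₀ (by positivity), mul_comm]
    exact h

/-- The dependence on `μ` is kept explicit and polynomial, because `μ = λ|y|²` is later integrated
against rapidly decaying functions of `y`. -/
theorem exists_abs_mlKernel_le {α : ℝ} (hα₀ : 0 < α) (hα₂ : α < 2) (β : ℝ) :
    ∃ (k : ℕ) (C : ℝ), 0 ≤ C ∧ ∀ μ ≥ 0, ∀ τ > 0,
      |mlKernel α β μ τ| ≤ C * (1 + μ) ^ k * (τ ^ (β - 1) * (1 + τ) ^ (2 * k)) := by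
  obtain ⟨k, C, hC, h⟩ := exists_abs_mittagLeffler_le hα₀ hα₂ β
  refine ⟨k, C, hC, fun μ hμ τ hτ => ?_⟩
  have e0 : 0 ≤ τ ^ α := Real.rpow_nonneg hτ.le _
  have e1 : τ ^ α ≤ (1 + τ) ^ 2 := by
    calc τ ^ α ≤ (1 + τ) ^ α := Real.rpow_le_rpow hτ.le (by linarith) hα₀.le
      _ ≤ (1 + τ) ^ (2 : ℝ) := Real.rpow_le_rpow_of_exponent_le (by linarith) hα₂.le
      _ = (1 + τ) ^ 2 := by norm_num
  have e2 : 1 + μ * τ ^ α ≤ (1 + μ) * (1 + τ) ^ 2 := by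
    have : μ * τ ^ α ≤ μ * (1 + τ) ^ 2 := by gcongr
    nlinarith
  have h0 : 0 ≤ μ * τ ^ α := mul_nonneg hμ e0
  have h1 := h (-(μ * τ ^ α)) (by linarith)
  rw [abs_neg, abs_of_nonneg h0] at h1
  rw [mlKernel, abs_mul, abs_of_nonneg (Real.rpow_nonneg hτ.le _)]
  calc τ ^ (β - 1) * |mittagLeffler α β (-(μ * τ ^ α))|
      ≤ τ ^ (β - 1) * (C * ((1 + μ) * (1 + τ) ^ 2) ^ k) := by
        gcongr
        exact h1.trans (by gcongr)
    _ = _ := by rw [mul_pow, ← pow_mul]; ring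

theorem isLagKernel_mlKernel {α β μ : ℝ} (hα₀ : 0 < α) (hα₂ : α < 2) (hβ : 0 < β) (hμ : 0 ≤ μ) :
    IsLagKernel (mlKernel α β μ) where
  measurable := (measurable_mlKernel hα₀ β).comp (f := fun t : ℝ => (μ, t)) (by fun_prop)
  bound := by
    obtain ⟨k, C, hC, h⟩ := exists_abs_mlKernel_le hα₀ hα₂ β
    exact ⟨β, C * (1 + μ) ^ k, 2 * k, hβ, by positivity, fun τ hτ => h μ hμ τ hτ⟩

/-- The majorants of kernels are integrable against rapidly decaying ones. -/
theorem exists_integrableOn_majorant {k : ℝ → ℝ} (hk : IsLagKernel k) : ∃ N : ℕ,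
    IntegrableOn (fun τ => k τ * ((1 + τ) ^ N)⁻¹) (Ioi 0) := by
  obtain ⟨a, C, M, ha, hC, h⟩ := hk.bound
  obtain ⟨n, hn⟩ := exists_nat_gt a
  refine ⟨n + M, ((integrableOn_rpow_mul_one_add_pow_inv ha hn).const_mul C).mono'
    (hk.measurable.mul (by fun_prop)).aestronglyMeasurable ?_⟩
  refine (ae_restrict_iff' measurableSet_Ioi).mpr (Eventually.of_forall fun τ hτ => ?_)
  have hτ' : 0 < τ := hτ
  rw [norm_mul, Real.norm_eq_abs, Real.norm_of_nonneg (by positivity)]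
  calc |k τ| * ((1 + τ) ^ (n + M))⁻¹ ≤ C * (τ ^ (a - 1) * (1 + τ) ^ M) * ((1 + τ) ^ (n + M))⁻¹ := by
        gcongr
        exact h τ hτ
    _ = _ := by
        rw [pow_add]
        field_simp

theorem integrableOn_lag_prod {k l : ℝ → ℝ} {h : ℝ → ℂ} (hk : IsLagKernel k) (hl : IsLagKernel l)
    (hh : RapidDecay h) : IntegrableOn (fun q : ℝ × ℝ => (k q.1 : ℂ) * l q.2 * h (q.1 + q.2))
      (Ioi 0 ×ˢ Ioi 0) := by
  obtain ⟨N₁, h₁⟩ := exists_integrableOn_majorant hk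
  obtain ⟨N₂, h₂⟩ := exists_integrableOn_majorant hl
  obtain ⟨C, hC, hb⟩ := hh.bound (N₁ + N₂)
  have hi := (h₁.norm.mul_prod h₂.norm).const_mul C
  rw [Measure.prod_restrict] at hi
  refine hi.mono' ?_ ?_
  · have m1 := hk.measurable
    have m2 := hl.measurable
    have m3 := hh.measurable
    exact (by fun_prop : Measurable fun q : ℝ × ℝ =>
      (k q.1 : ℂ) * l q.2 * h (q.1 + q.2)).aestronglyMeasurable
  · refine (ae_restrict_iff' (measurableSet_Ioi.prod measurableSet_Ioi)).mpr
      (Eventually.of_forall fun q hq => ?_)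
    have hq1 : 0 < q.1 := hq.1
    have hq2 : 0 < q.2 := hq.2
    simp only [norm_mul, Complex.norm_real]
    have h3 := hb (q.1 + q.2) (by linarith)
    have h4 : ((1 + (q.1 + q.2)) ^ (N₁ + N₂))⁻¹ ≤ ((1 + q.1) ^ N₁)⁻¹ * ((1 + q.2) ^ N₂)⁻¹ := by
      rw [← mul_inv, pow_add]
      gcongr <;> linarith
    rw [Real.norm_of_nonneg (r := ((1 + q.1) ^ N₁)⁻¹) (by positivity),
      Real.norm_of_nonneg (r := ((1 + q.2) ^ N₂)⁻¹) (by positivity)]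
    calc ‖k q.1‖ * ‖l q.2‖ * ‖h (q.1 + q.2)‖
        ≤ ‖k q.1‖ * ‖l q.2‖ * (C * (((1 + q.1) ^ N₁)⁻¹ * ((1 + q.2) ^ N₂)⁻¹)) := by
          gcongr
          exact h3.trans (by gcongr)
      _ = _ := by ring

theorem integrableOn_lag {k : ℝ → ℝ} {h : ℝ → ℂ} (hk : IsLagKernel k) (hh : RapidDecay h) :
    IntegrableOn (fun τ => (k τ : ℂ) * h τ) (Ioi 0) := by
  obtain ⟨N, h₁⟩ := exists_integrableOn_majorant hk
  obtain ⟨C, hC, hb⟩ := hh.bound N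
  refine (h₁.norm.const_mul C).mono' ?_ ?_
  · have m1 := hk.measurable
    have m3 := hh.measurable
    exact (by fun_prop : Measurable fun q : ℝ => (k q : ℂ) * h q).aestronglyMeasurable
  · refine (ae_restrict_iff' measurableSet_Ioi).mpr (Eventually.of_forall fun τ hτ => ?_)
    have hτ' : 0 < τ := hτ
    simp only [norm_mul, Complex.norm_real]
    rw [Real.norm_of_nonneg (r := ((1 + τ) ^ N)⁻¹) (by positivity)]
    calc ‖k τ‖ * ‖h τ‖ ≤ ‖k τ‖ * (C * ((1 + τ) ^ N)⁻¹) := by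
          gcongr
          exact hb τ hτ'.le
      _ = _ := by ring

/-- Fubini after the shear `(s, r) ↦ (s, s + r)`: composing two lag integrals convolves their
kernels. -/
theorem integral_lag_lag {k l : ℝ → ℝ} {h : ℝ → ℂ} (hk : IsLagKernel k) (hl : IsLagKernel l)
    (hh : RapidDecay h) :
    ∫ s in Ioi 0, (k s : ℂ) * ∫ r in Ioi 0, (l r : ℂ) * h (s + r) =
      ∫ v in Ioi 0, ((∫ s in 0..v, k s * l (v - s) : ℝ) : ℂ) * h v := by
  set H : ℝ × ℝ → ℂ := fun z => (Ioi (0 : ℝ)).indicator (fun _ => (1 : ℂ)) z.1 *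
    (Ioi (0 : ℝ)).indicator (fun _ => (1 : ℂ)) (z.2 - z.1) * ((k z.1 : ℂ) * l (z.2 - z.1) * h z.2)
    with hH
  have hshear : ∀ q : ℝ × ℝ, H (q.1, q.1 + q.2) = (Ioi (0 : ℝ) ×ˢ Ioi (0 : ℝ)).indicator
      (fun q : ℝ × ℝ => (k q.1 : ℂ) * l q.2 * h (q.1 + q.2)) q := by
    rintro ⟨s, r⟩
    by_cases hs : 0 < s <;> by_cases hr : 0 < r <;> simp [hH, indicator, hs, hr]
  have hi0 : Integrable ((Ioi (0 : ℝ) ×ˢ Ioi (0 : ℝ)).indicator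
      (fun q : ℝ × ℝ => (k q.1 : ℂ) * l q.2 * h (q.1 + q.2))) (volume.prod volume) :=
    (integrable_indicator_iff (measurableSet_Ioi.prod measurableSet_Ioi)).mpr
      (integrableOn_lag_prod hk hl hh)
  have hmp := measurePreserving_prod_add (volume : Measure ℝ) (volume : Measure ℝ)
  have hemb : MeasurableEmbedding fun z : ℝ × ℝ => (z.1, z.1 + z.2) :=
    (MeasurableEquiv.shearAddRight ℝ).measurableEmbedding
  have hHi : Integrable H (volume.prod volume) := by
    rw [← hmp.integrable_comp_emb hemb]
    exact hi0.congr (Eventually.of_forall fun q => (hshear q).symm)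
  have h1 : ∫ s, ∫ v, H (s, v) = ∫ s in Ioi 0, (k s : ℂ) * ∫ r in Ioi 0, (l r : ℂ) * h (s + r) := by
    rw [← integral_indicator measurableSet_Ioi]
    refine integral_congr_ae (Eventually.of_forall fun s => ?_)
    simp only
    rw [← integral_add_left_eq_self (fun v => H (s, v)) s]
    by_cases hs : 0 < s
    · rw [indicator_of_mem (show s ∈ Ioi (0 : ℝ) from hs), ← integral_const_mul,
        ← integral_indicator measurableSet_Ioi]
      refine integral_congr_ae (Eventually.of_forall fun r => ?_)
      by_cases hr : 0 < r <;> simp [hH, indicator, hs, hr, mul_assoc]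
    · rw [indicator_of_notMem (show s ∉ Ioi (0 : ℝ) from hs)]
      simp [hH, indicator, hs]
  have h2 : ∫ v, ∫ s, H (s, v) =
      ∫ v in Ioi 0, ((∫ s in 0..v, k s * l (v - s) : ℝ) : ℂ) * h v := by
    rw [← integral_indicator measurableSet_Ioi]
    refine integral_congr_ae (Eventually.of_forall fun v => ?_)
    by_cases hv : 0 < v
    · rw [indicator_of_mem (show v ∈ Ioi (0 : ℝ) from hv), intervalIntegral.integral_of_le hv.le,
        integral_Ioc_eq_integral_Ioo, ← integral_complex_ofReal, ← integral_mul_const,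
        ← integral_indicator measurableSet_Ioo]
      refine integral_congr_ae (Eventually.of_forall fun s => ?_)
      by_cases hs : 0 < s <;> by_cases hr : s < v <;> simp [hH, indicator, hs, hr]
    · rw [indicator_of_notMem (show v ∉ Ioi (0 : ℝ) from hv)]
      refine integral_eq_zero_of_ae (Eventually.of_forall fun s => ?_)
      by_cases hs : 0 < s
      · have : ¬ s < v := by linarith
        simp [hH, indicator, this]
      · simp [hH, indicator, hs]
  rw [← h1, ← h2, integral_integral_swap hHi]

/-! ### Lag integrals with Mittag-Leffler kernels -/

section MittagLeffler

variable {α β γ μ : ℝ} {h : ℝ → ℂ} {t : ℝ}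

/-- For `μ = 0` the kernel is that of Riemann-Liouville, so this is `mlKernel_conv` in dual form. It
is needed with the factors in either order, once for each side of the inverse. -/
theorem lagIntegral_mlKernel_mlKernel_zero (hα₀ : 0 < α) (hα₂ : α < 2) (hβ : 0 < β) (hγ : 0 < γ)
    (hμ : 0 ≤ μ) (hh : RapidDecay h) (ht : 0 ≤ t) :
    lagIntegral (mlKernel α β μ) (lagIntegral (mlKernel α γ 0) h) t =
      lagIntegral (mlKernel α (β + γ) μ) h t := by
  have h1 := integral_lag_lag (isLagKernel_mlKernel hα₀ hα₂ hβ hμ)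
    (isLagKernel_mlKernel hα₀ hα₂ hγ le_rfl) (hh.comp_add ht)
  simp only [lagIntegral]
  simp only [← add_assoc] at h1
  rw [h1]
  refine setIntegral_congr_fun measurableSet_Ioi fun v hv => ?_
  congr 2
  rw [← mlKernel_conv hα₀ hβ hγ μ hv]
  simp only [mlKernel_zero hα₀]

theorem lagIntegral_mlKernel_zero_mlKernel (hα₀ : 0 < α) (hα₂ : α < 2) (hβ : 0 < β) (hγ : 0 < γ)
    (hμ : 0 ≤ μ) (hh : RapidDecay h) (ht : 0 ≤ t) :
    lagIntegral (mlKernel α γ 0) (lagIntegral (mlKernel α β μ) h) t =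
      lagIntegral (mlKernel α (β + γ) μ) h t := by
  have h1 := integral_lag_lag (isLagKernel_mlKernel hα₀ hα₂ hγ le_rfl)
    (isLagKernel_mlKernel hα₀ hα₂ hβ hμ) (hh.comp_add ht)
  simp only [lagIntegral]
  simp only [← add_assoc] at h1
  rw [h1]
  refine setIntegral_congr_fun measurableSet_Ioi fun v hv => ?_
  congr 2
  rw [← mlKernel_conv hα₀ hβ hγ μ hv]
  have := intervalIntegral.integral_comp_sub_left (a := 0) (b := v)
    (fun r => mlKernel α γ 0 (v - r) * mlKernel α β μ r) v
  simp only [sub_sub_cancel, sub_self, sub_zero] at this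
  rw [this]
  simp only [mlKernel_zero hα₀, mul_comm]

theorem integrableOn_lagIntegrand (hα₀ : 0 < α) (hα₂ : α < 2) (hβ : 0 < β) (hμ : 0 ≤ μ)
    (hh : RapidDecay h) (ht : 0 ≤ t) :
    IntegrableOn (fun τ => (mlKernel α β μ τ : ℂ) * h (t + τ)) (Ioi 0) :=
  integrableOn_lag (isLagKernel_mlKernel hα₀ hα₂ hβ hμ) (hh.comp_add ht)

theorem lagIntegral_mlKernel_eq_sub (hα₀ : 0 < α) (hα₂ : α < 2) (hβ : 0 < β) (hμ : 0 ≤ μ)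
    (hh : RapidDecay h) (ht : 0 ≤ t) :
    lagIntegral (mlKernel α β μ) h t = lagIntegral (mlKernel α β 0) h t -
      μ * lagIntegral (mlKernel α (α + β) μ) h t := by
  have i1 := integrableOn_lagIntegrand hα₀ hα₂ hβ le_rfl hh ht
  have i2 := integrableOn_lagIntegrand hα₀ hα₂ (add_pos hα₀ hβ) hμ hh ht
  rw [lagIntegral, lagIntegral, lagIntegral, ← integral_const_mul,
    ← integral_sub i1 (i2.const_mul _)]
  refine setIntegral_congr_fun measurableSet_Ioi fun τ hτ => ?_
  rw [mlKernel_succ hα₀ β μ hτ, mlKernel_zero hα₀]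
  push_cast
  ring

theorem lagIntegral_mlKernel_one_zero (hα₀ : 0 < α) (h : ℝ → ℂ) (t : ℝ) :
    lagIntegral (mlKernel α 1 0) h t = ∫ τ in Ioi 0, h (t + τ) := by
  simp [lagIntegral, mlKernel_zero hα₀]

theorem lagIntegral_deriv (hα₀ : 0 < α) (f : 𝓢(ℝ, ℂ)) (t : ℝ) :
    lagIntegral (mlKernel α 1 0) (deriv f) t = -f t := by
  rw [lagIntegral_mlKernel_one_zero hα₀]
  have hd : ∀ τ ∈ Ici (0 : ℝ), HasDerivAt (fun τ => f (t + τ)) (deriv f (t + τ)) τ := fun τ _ =>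
    HasDerivAt.comp_const_add t τ f.differentiableAt.hasDerivAt
  have hi : Integrable fun τ => deriv f (t + τ) :=
    ((SchwartzMap.derivCLM ℝ ℂ f).integrable (μ := volume)).comp_add_left t
  have hlim : Tendsto (fun τ => f (t + τ)) atTop (𝓝 0) :=
    (f.tendsto_cocompact.mono_left atTop_le_cocompact).comp (tendsto_atTop_add_const_left _ t tendsto_id)
  rw [integral_Ioi_of_hasDerivAt_of_tendsto' hd hi.integrableOn hlim]
  simp

/-- The extra unit of the parameter is an integration in time, which undoes the derivative. -/
theorem lagIntegral_mlKernel_add_one_deriv (hα₀ : 0 < α) (hα₂ : α < 2) (hβ : 0 < β) (hμ : 0 ≤ μ)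
    (f : 𝓢(ℝ, ℂ)) (ht : 0 ≤ t) : lagIntegral (mlKernel α (β + 1) μ) (deriv f) t =
      -lagIntegral (mlKernel α β μ) f t := by
  change lagIntegral _ (SchwartzMap.derivCLM ℝ ℂ f) t = _
  rw [← lagIntegral_mlKernel_mlKernel_zero hα₀ hα₂ hβ zero_lt_one hμ
    (rapidDecay_schwartz (SchwartzMap.derivCLM ℝ ℂ f)) ht]
  have : lagIntegral (mlKernel α 1 0) (SchwartzMap.derivCLM ℝ ℂ f) = fun t => -f t :=
    funext fun t => lagIntegral_deriv hα₀ f t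
  rw [this, lagIntegral, lagIntegral, ← integral_neg]
  simp

/-- The preceding identity would need `β = 0`, where the Riemann-Liouville kernel degenerates to a
point mass. The Volterra equation separates that part first, and it becomes the boundary term `f t`.
-/
theorem lagIntegral_mlKernel_one_deriv (hα₀ : 0 < α) (hα₂ : α < 2) (hμ : 0 ≤ μ)
    (f : 𝓢(ℝ, ℂ)) (ht : 0 ≤ t) : lagIntegral (mlKernel α 1 μ) (deriv f) t =
      -(f t - μ * lagIntegral (mlKernel α α μ) f t) := by
  change lagIntegral _ (SchwartzMap.derivCLM ℝ ℂ f) t = _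
  rw [lagIntegral_mlKernel_eq_sub hα₀ hα₂ zero_lt_one hμ
    (rapidDecay_schwartz (SchwartzMap.derivCLM ℝ ℂ f)) ht]
  change lagIntegral _ (deriv f) t - _ * lagIntegral _ (deriv f) t = _
  rw [lagIntegral_deriv hα₀, lagIntegral_mlKernel_add_one_deriv hα₀ hα₂ hα₀ hμ f ht]
  ring

end MittagLeffler

/-! ### The fractional derivative on test functions -/

instance hasTemperateGrowth_restrict {E : Type*} [NormedAddCommGroup E] [MeasurableSpace E]
    (μ : Measure E) [hμ : μ.HasTemperateGrowth] (s : Set E) : (μ.restrict s).HasTemperateGrowth := by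
  obtain ⟨n, hn⟩ := hμ.exists_integrable
  exact ⟨n, hn.integrableOn⟩

variable {d : ℕ} {α lam : ℝ}

/-- The family of operators whose integral over `τ > 0` is the right-sided fractional integral of
order `β`, up to a cutoff. -/
def weylFamily (d : ℕ) (β τ : ℝ) : TestFn d →L[ℝ] TestFn d :=
  (τ ^ (β - 1) / Real.Gamma β) • cutShift τ

theorem weylFamily_apply (β τ : ℝ) (φ : TestFn d) (p : TimeSpace d) :
    weylFamily d β τ φ p = τ ^ (β - 1) / Real.Gamma β * (cutoff p.1 * φ (p.1 + τ, p.2)) := by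
  rw [← cutShift_apply]
  rfl

theorem measurable_weylFamily (β : ℝ) (φ : TestFn d) :
    Measurable fun q : ℝ × TimeSpace d => weylFamily d β q.1 φ q.2 := by
  simp only [weylFamily_apply]
  have h1 : Continuous fun q : ℝ × TimeSpace d => cutoff q.2.1 * φ (q.2.1 + q.1, q.2.2) :=
    (contDiff_cutoff.continuous.comp (by fun_prop)).mul (φ.continuous.comp (by fun_prop))
  exact Measurable.mul (by fun_prop) h1.measurable

theorem integrableFamily_weylFamily {β : ℝ} (hβ : 0 < β) :
    IntegrableFamily (volume.restrict (Ioi 0)) (weylFamily d β) where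
  measurable φ p := ((measurable_weylFamily β φ).comp
    (f := fun τ : ℝ => (τ, p)) (by fun_prop)).aestronglyMeasurable
  bound k n := by
    obtain ⟨N, hN⟩ := exists_nat_gt β
    obtain ⟨s, C, hC, h⟩ := exists_seminorm_cutShift_le (d := d) N {(k, n)}
    refine ⟨s, fun τ => C * (Real.Gamma β)⁻¹ * |τ ^ (β - 1) * ((1 + τ) ^ N)⁻¹|,
      (integrableOn_rpow_mul_one_add_pow_inv hβ hN).norm.const_mul _,
      fun τ => ?_, ?_⟩
    · have := Real.Gamma_pos_of_pos hβ
      positivity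
    · refine (ae_restrict_iff' measurableSet_Ioi).mpr (Eventually.of_forall fun τ hτ φ x => ?_)
      have hΓ := Real.Gamma_pos_of_pos hβ
      have hτ0 : 0 < τ := hτ
      have h1 := h τ hτ0.le φ
      rw [Finset.sup_singleton] at h1
      have h0 : 0 ≤ τ ^ (β - 1) := Real.rpow_nonneg (le_of_lt hτ) _
      beta_reduce
      rw [abs_of_nonneg (a := τ ^ (β - 1) * ((1 + τ) ^ N)⁻¹) (by positivity)]
      refine (SchwartzMap.le_seminorm ℝ k n _ x).trans ?_
      have e1 : weylFamily d β τ φ = (τ ^ (β - 1) / Real.Gamma β) • cutShift τ φ := rfl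
      rw [e1, map_smul_eq_mul, Real.norm_of_nonneg (by positivity)]
      calc _ ≤ τ ^ (β - 1) / Real.Gamma β * _ := mul_le_mul_of_nonneg_left h1 (by positivity)
        _ = _ := by ring

/-- A test function that agrees for `t ≥ -1` with the right-sided fractional integral. -/
def weylIntegral (β : ℝ) (φ : TestFn d) : TestFn d :=
  if hβ : 0 < β then (integrableFamily_weylFamily hβ).integralCLM φ else φ

theorem weylIntegral_apply {β : ℝ} (hβ : 0 ≤ β) (φ : TestFn d) {p : TimeSpace d} (hp : 0 ≤ p.1) :
    weylIntegral β φ p = rightFracIntegral β (fun t => φ (t, p.2)) p.1 := by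
  rcases hβ.eq_or_lt with rfl | hβ
  · simp [weylIntegral, rightFracIntegral]
  · rw [weylIntegral, dif_pos hβ, rightFracIntegral, if_neg hβ.ne',
      IntegrableFamily.integralCLM_apply, ← integral_const_mul]
    have h1 : Ioi (0 : ℝ) = (fun τ => τ + p.1) ⁻¹' (Ioi p.1) := by
      ext τ; simp
    rw [h1, ← (measurePreserving_add_right volume p.1).setIntegral_preimage_emb
      (MeasurableEquiv.addRight p.1).measurableEmbedding
      (fun u => (Real.Gamma β)⁻¹ * ((u - p.1) ^ (β - 1) * φ (u, p.2)))]
    refine integral_congr_ae (Eventually.of_forall fun τ => ?_)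
    simp only [weylFamily_apply, cutoff_of_ge (show -1 ≤ p.1 by linarith), add_sub_cancel_right]
    rw [add_comm p.1 τ]
    ring

theorem invFourier_weylIntegral (hα₀ : 0 < α) {β : ℝ} (hβ : 0 < β) (φ : TestFn d) {t : ℝ}
    (ht : 0 ≤ t) (y : EuclideanSpace ℝ (Fin d)) :
    invFourier (weylIntegral β φ) t y =
      lagIntegral (mlKernel α β 0) (fun s => invFourier φ s y) t := by
  rw [weylIntegral, dif_pos hβ, IntegrableFamily.invFourier_integralCLM, lagIntegral]
  · refine integral_congr_ae (Eventually.of_forall fun τ => ?_)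
    have h1 : weylFamily d β τ φ = (τ ^ (β - 1) / Real.Gamma β) • cutShift τ φ := rfl
    simp only [h1, invFourier_smul, invFourier_cutShift, cutoff_of_ge (show -1 ≤ t by linarith),
      mlKernel_zero hα₀]
    simp
  · exact ((measurable_weylFamily β φ).comp (f := fun q : EuclideanSpace ℝ (Fin d) × ℝ =>
      (q.2, ((t, q.1) : TimeSpace d))) (by fun_prop)).aestronglyMeasurable

/-- The iterated time derivative of a test function. -/
def timeDeriv (n : ℕ) (φ : TestFn d) : TestFn d := (fun φ : TestFn d => ∂_{timeDir d} φ)^[n] φ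

theorem hasDerivAt_fst (φ : TestFn d) (x : EuclideanSpace ℝ (Fin d)) (t : ℝ) :
    HasDerivAt (fun t => φ (t, x)) ((∂_{timeDir d} φ) (t, x)) t := by
  have h := (sliceFst x φ).hasDerivAt t
  rw [← fderiv_apply_one_eq_deriv, ← SchwartzMap.lineDerivOp_apply_eq_fderiv,
    lineDerivOp_sliceFst] at h
  exact h

theorem iteratedDeriv_fst (n : ℕ) (φ : TestFn d) (x : EuclideanSpace ℝ (Fin d)) :
    iteratedDeriv n (fun t => φ (t, x)) = fun t => timeDeriv n φ (t, x) := by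
  induction n generalizing φ with
  | zero => rfl
  | succ n ih =>
    rw [iteratedDeriv_succ', show deriv (fun t => φ (t, x)) = fun t => (∂_{timeDir d} φ) (t, x) from
      funext fun t => (hasDerivAt_fst φ x t).deriv, ih]
    rfl

/-- A test function that agrees with `rightFracDeriv α φ` for `t ≥ 0`. -/
def weylDeriv (α : ℝ) (φ : TestFn d) : TestFn d :=
  (-1 : ℝ) ^ ⌈α⌉₊ • weylIntegral (⌈α⌉₊ - α) (timeDeriv ⌈α⌉₊ φ)

theorem weylDeriv_apply (φ : TestFn d) {p : TimeSpace d} (hp : 0 ≤ p.1) :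
    weylDeriv α φ p = rightFracDeriv α φ p := by
  rw [weylDeriv, rightFracDeriv, smul_apply, smul_eq_mul,
    weylIntegral_apply (sub_nonneg.mpr (Nat.le_ceil α)) _ hp, iteratedDeriv_fst]

theorem coe_invFourierTime (φ : TestFn d) (y : EuclideanSpace ℝ (Fin d)) :
    (invFourierTime y φ : ℝ → ℂ) = fun t => invFourier φ t y :=
  funext fun t => invFourierTime_apply y φ t

theorem rapidDecay_invFourier (φ : TestFn d) (y : EuclideanSpace ℝ (Fin d)) :
    RapidDecay fun t => invFourier φ t y := by
  rw [← coe_invFourierTime]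
  exact rapidDecay_schwartz _

theorem deriv_invFourierTime (φ : TestFn d) (y : EuclideanSpace ℝ (Fin d)) :
    deriv (invFourierTime y φ) = fun t => invFourier (∂_{timeDir d} φ) t y := by
  rw [coe_invFourierTime]
  exact funext fun t => (hasDerivAt_invFourier φ t y).deriv

theorem ceil_eq_one_or_two (hα₀ : 0 < α) (hα₂ : α < 2) : ⌈α⌉₊ = 1 ∨ ⌈α⌉₊ = 2 := by
  have h1 : 0 < ⌈α⌉₊ := Nat.ceil_pos.mpr hα₀
  have h2 : ⌈α⌉₊ ≤ 2 := Nat.ceil_le.mpr (by exact_mod_cast hα₂.le)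
  omega

/-- The scalar core of the inversion. Each derivative lowers the second parameter by one, from `⌈α⌉`
to `1`, and the last one produces the boundary term. The signs of the integrations by parts cancel
`(-1)^⌈α⌉`. -/
theorem lagIntegral_timeDeriv (hα₀ : 0 < α) (hα₂ : α < 2) {μ : ℝ} (hμ : 0 ≤ μ) (φ : TestFn d)
    {t : ℝ} (ht : 0 ≤ t) (y : EuclideanSpace ℝ (Fin d)) :
    (-1) ^ ⌈α⌉₊ * lagIntegral (mlKernel α ⌈α⌉₊ μ)
      (fun s => invFourier (timeDeriv ⌈α⌉₊ φ) s y) t =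
    invFourier φ t y - μ * lagIntegral (mlKernel α α μ) (fun s => invFourier φ s y) t := by
  have h1 := lagIntegral_mlKernel_one_deriv hα₀ hα₂ hμ (invFourierTime y φ) ht
  have h2 := lagIntegral_mlKernel_add_one_deriv hα₀ hα₂ zero_lt_one hμ
    (invFourierTime y (∂_{timeDir d} φ)) ht
  rw [deriv_invFourierTime] at h1 h2
  rw [coe_invFourierTime] at h1 h2
  rcases ceil_eq_one_or_two hα₀ hα₂ with h | h
  · rw [h]
    simp only [timeDeriv, Nat.cast_one, Function.iterate_one, pow_one]
    rw [h1]
    ring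
  · rw [h]
    have : ((2 : ℕ) : ℝ) = 1 + 1 := by norm_num
    simp only [timeDeriv, this, Function.iterate_succ, Function.iterate_zero, Function.comp_apply, id]
    rw [h2, h1]
    ring

theorem eq_of_invFourier_eq {φ ψ : TestFn d} {t : ℝ} (h : ∀ y, invFourier φ t y = invFourier ψ t y)
    (x : EuclideanSpace ℝ (Fin d)) : φ (t, x) = ψ (t, x) := by
  have : (φ (t, x) : ℂ) = ψ (t, x) := by
    rw [← integral_exp_mul_invFourier, ← integral_exp_mul_invFourier]
    simp only [h]
  exact_mod_cast this

theorem invFourier_congr {φ ψ : TestFn d} {t : ℝ} (h : ∀ x, φ (t, x) = ψ (t, x))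
    (y : EuclideanSpace ℝ (Fin d)) : invFourier φ t y = invFourier ψ t y := by
  simp only [invFourier_eq_integral, h]

theorem lagIntegral_congr {k : ℝ → ℝ} {h₁ h₂ : ℝ → ℂ} {t : ℝ} (h : ∀ s > t, h₁ s = h₂ s) :
    lagIntegral k h₁ t = lagIntegral k h₂ t := by
  refine setIntegral_congr_fun measurableSet_Ioi fun τ hτ => ?_
  have : 0 < τ := hτ
  rw [h (t + τ) (by linarith)]

theorem invFourier_duhamel_eq_lagIntegral (hα₀ : 0 < α) (hα₂ : α < 2) (hlam : 0 < lam)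
    (φ : TestFn d) {t : ℝ} (ht : -1 ≤ t) (y : EuclideanSpace ℝ (Fin d)) :
    invFourier (duhamel d hα₀ hα₂ hlam φ) t y =
      lagIntegral (mlKernel α α (lam * ‖y‖ ^ 2)) (fun s => invFourier φ s y) t :=
  invFourier_duhamel hα₀ hα₂ hlam φ ht y

theorem hasDerivAt_lagIntegral {k : ℝ → ℝ} (hk : IsLagKernel k) (f : 𝓢(ℝ, ℂ)) {t : ℝ} (ht : 0 < t) :
    HasDerivAt (lagIntegral k f) (lagIntegral k (deriv f) t) t := by
  obtain ⟨N, hN⟩ := exists_integrableOn_majorant hk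
  have hf' := rapidDecay_schwartz (SchwartzMap.derivCLM ℝ ℂ f)
  obtain ⟨C, hC, hb⟩ := hf'.bound N
  have m1 := hk.measurable
  have m2 := f.continuous.measurable
  refine (hasDerivAt_integral_of_dominated_loc_of_deriv_le (μ := volume.restrict (Ioi 0))
    (F := fun s τ => (k τ : ℂ) * f (s + τ)) (F' := fun s τ => (k τ : ℂ) * deriv f (s + τ))
    (bound := fun τ => C * ‖k τ * ((1 + τ) ^ N)⁻¹‖) (Ioi_mem_nhds ht)
    (Eventually.of_forall fun s =>
      (by fun_prop : Measurable fun τ => (k τ : ℂ) * f (s + τ)).aestronglyMeasurable)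
    (integrableOn_lag hk ((rapidDecay_schwartz f).comp_add ht.le))
    (integrableOn_lag hk (hf'.comp_add ht.le)).aestronglyMeasurable ?_ (hN.norm.const_mul C) ?_).2
  · refine (ae_restrict_iff' measurableSet_Ioi).mpr (Eventually.of_forall fun τ hτ s hs => ?_)
    have hτ' : 0 < τ := hτ
    have hs' : 0 < s := hs
    have h1 : ‖deriv f (s + τ)‖ ≤ C * ((1 + (s + τ)) ^ N)⁻¹ := hb (s + τ) (by positivity)
    rw [norm_mul, norm_mul, Complex.norm_real, Real.norm_of_nonneg (r := ((1 + τ) ^ N)⁻¹)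
      (by positivity)]
    calc ‖k τ‖ * ‖deriv f (s + τ)‖ ≤ ‖k τ‖ * (C * ((1 + τ) ^ N)⁻¹) := by
          gcongr
          refine h1.trans ?_
          gcongr
          linarith
      _ = _ := by ring
  · exact Eventually.of_forall fun τ s _ =>
      (HasDerivAt.comp_add_const s τ f.differentiableAt.hasDerivAt).const_mul _

/-- Time derivatives commute with the lag integral. The induction compares derivatives of functions
that agree near `t`, hence the open condition `0 < t`. -/
theorem invFourier_timeDeriv_duhamel (hα₀ : 0 < α) (hα₂ : α < 2) (hlam : 0 < lam) (n : ℕ)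
    (φ : TestFn d) {t : ℝ} (ht : 0 < t) (y : EuclideanSpace ℝ (Fin d)) :
    invFourier (timeDeriv n (duhamel d hα₀ hα₂ hlam φ)) t y =
      lagIntegral (mlKernel α α (lam * ‖y‖ ^ 2)) (fun s => invFourier (timeDeriv n φ) s y) t := by
  induction n generalizing t with
  | zero => exact invFourier_duhamel_eq_lagIntegral hα₀ hα₂ hlam φ (by linarith) y
  | succ n ih =>
    have e : ∀ φ : TestFn d, timeDeriv (n + 1) φ = ∂_{timeDir d} (timeDeriv n φ) := fun φ => by
      rw [timeDeriv, Function.iterate_succ_apply']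
      rfl
    have h1 := hasDerivAt_invFourier (timeDeriv n (duhamel d hα₀ hα₂ hlam φ)) t y
    have h2 := hasDerivAt_lagIntegral (isLagKernel_mlKernel hα₀ hα₂ hα₀
      (show 0 ≤ lam * ‖y‖ ^ 2 by positivity)) (invFourierTime y (timeDeriv n φ)) ht
    rw [deriv_invFourierTime, coe_invFourierTime, ← e] at h2
    rw [← e] at h1
    refine h1.unique (h2.congr_of_eventuallyEq ?_)
    filter_upwards [eventually_gt_nhds ht] with s hs using ih hs

theorem invFourier_weylDeriv_duhamel (hα₀ : 0 < α) (hα₂ : α < 2) (hlam : 0 < lam)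
    (φ : TestFn d) {t : ℝ} (ht : 0 < t) (y : EuclideanSpace ℝ (Fin d)) :
    invFourier (weylDeriv α (duhamel d hα₀ hα₂ hlam φ)) t y =
      invFourier (φ + lam • laplacianTest d (duhamel d hα₀ hα₂ hlam φ)) t y := by
  have hμ : 0 ≤ lam * ‖y‖ ^ 2 := by positivity
  have hlast : invFourier (φ + lam • laplacianTest d (duhamel d hα₀ hα₂ hlam φ)) t y =
      invFourier φ t y - ((lam * ‖y‖ ^ 2 : ℝ) : ℂ) * lagIntegral (mlKernel α α (lam * ‖y‖ ^ 2))
        (fun s => invFourier φ s y) t := by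
    rw [invFourier_add, invFourier_smul, invFourier_laplacianTest,
      invFourier_duhamel_eq_lagIntegral hα₀ hα₂ hlam φ (by linarith)]
    push_cast
    ring
  rw [hlast, ← lagIntegral_timeDeriv hα₀ hα₂ hμ φ ht.le y, weylDeriv, invFourier_smul]
  push_cast
  congr 1
  have hc := Nat.le_ceil α
  -- Equality means `α = 1`, with no fractional integral left. Otherwise the fractional integral of
  -- order `⌈α⌉ - α` raises the parameter of the kernel from `α` to `⌈α⌉`.
  rcases hc.eq_or_lt with hc | hc
  · rw [← hc, sub_self, weylIntegral, dif_neg (lt_irrefl _),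
      invFourier_timeDeriv_duhamel hα₀ hα₂ hlam _ φ ht]
  · rw [invFourier_weylIntegral hα₀ (sub_pos.mpr hc) _ ht.le,
      lagIntegral_congr (fun s hs => invFourier_timeDeriv_duhamel hα₀ hα₂ hlam _ φ (ht.trans hs) y)]
    have := lagIntegral_mlKernel_zero_mlKernel hα₀ hα₂ hα₀ (sub_pos.mpr hc) hμ
      (rapidDecay_invFourier (timeDeriv ⌈α⌉₊ φ) y) ht.le
    rw [add_sub_cancel] at this
    exact this

/-- `duhamel` solves the dual fractional heat equation. -/
theorem rightFracDeriv_duhamel (hα₀ : 0 < α) (hα₂ : α < 2) (hlam : 0 < lam)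
    (φ : TestFn d) {p : TimeSpace d} (hp : 0 ≤ p.1) :
    (φ + lam • laplacianTest d (duhamel d hα₀ hα₂ hlam φ)) p =
      rightFracDeriv α (duhamel d hα₀ hα₂ hlam φ) p := by
  rw [← weylDeriv_apply _ hp]
  set u := φ + lam • laplacianTest d (duhamel d hα₀ hα₂ hlam φ)
  set v := weylDeriv α (duhamel d hα₀ hα₂ hlam φ)
  have hpos : ∀ q ∈ {q : TimeSpace d | 0 < q.1}, u q = v q := fun q hq =>
    (eq_of_invFourier_eq (fun y => invFourier_weylDeriv_duhamel hα₀ hα₂ hlam φ hq y) q.2).symm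
  -- The definition of the Caputo derivative prescribes `ψ` at `t = 0` too; this boundary is reached
  -- by continuity.
  have hcl : p ∈ closure {q : TimeSpace d | 0 < q.1} := by
    have h1 : {q : TimeSpace d | 0 < q.1} = Ioi 0 ×ˢ univ := by ext; simp
    rw [h1, closure_prod_eq, closure_Ioi, closure_univ]
    exact ⟨hp, trivial⟩
  exact (EqOn.closure hpos u.continuous v.continuous) hcl

/-- `duhamel` inverts the dual fractional heat operator. -/
theorem duhamel_rightFracDeriv_sub (hα₀ : 0 < α) (hα₂ : α < 2) (hlam : 0 < lam)
    {φ ψ : TestFn d} (h : ∀ p : TimeSpace d, 0 ≤ p.1 → ψ p = rightFracDeriv α φ p)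
    {p : TimeSpace d} (hp : 0 ≤ p.1) :
    duhamel d hα₀ hα₂ hlam (ψ - lam • laplacianTest d φ) p = φ p := by
  refine eq_of_invFourier_eq (fun y => ?_) p.2
  have hμ : 0 ≤ lam * ‖y‖ ^ 2 := by positivity
  have hψ : ∀ s ≥ 0, invFourier ψ s y = invFourier (weylDeriv α φ) s y := fun s hs =>
    invFourier_congr (fun x => by rw [h (s, x) hs, weylDeriv_apply φ hs]) y
  have hmain : lagIntegral (mlKernel α α (lam * ‖y‖ ^ 2))
      (fun s => invFourier (weylDeriv α φ) s y) p.1 = invFourier φ p.1 y -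
        ((lam * ‖y‖ ^ 2 : ℝ) : ℂ) * lagIntegral (mlKernel α α (lam * ‖y‖ ^ 2))
          (fun s => invFourier φ s y) p.1 := by
    rw [← lagIntegral_timeDeriv hα₀ hα₂ hμ φ hp y]
    have e1 : lagIntegral (mlKernel α α (lam * ‖y‖ ^ 2))
        (fun s => invFourier (weylDeriv α φ) s y) p.1 = (-1) ^ ⌈α⌉₊ *
        lagIntegral (mlKernel α α (lam * ‖y‖ ^ 2))
          (fun s => invFourier (weylIntegral (⌈α⌉₊ - α) (timeDeriv ⌈α⌉₊ φ)) s y) p.1 := by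
      rw [lagIntegral, lagIntegral, ← integral_const_mul]
      refine integral_congr_ae (Eventually.of_forall fun τ => ?_)
      simp only [weylDeriv, invFourier_smul]
      push_cast
      ring
    rw [e1]
    congr 1
    have hc := Nat.le_ceil α
    rcases hc.eq_or_lt with hc | hc
    · rw [← hc, sub_self, weylIntegral, dif_neg (lt_irrefl _)]
    · rw [lagIntegral_congr (fun s hs => invFourier_weylIntegral hα₀ (sub_pos.mpr hc) _
        (hp.trans hs.le) y)]
      have := lagIntegral_mlKernel_mlKernel_zero hα₀ hα₂ hα₀ (sub_pos.mpr hc) hμ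
        (rapidDecay_invFourier (timeDeriv ⌈α⌉₊ φ) y) hp
      rw [add_sub_cancel] at this
      exact this
  rw [invFourier_duhamel_eq_lagIntegral hα₀ hα₂ hlam _ (by linarith)]
  have i1 := integrableOn_lagIntegrand hα₀ hα₂ hα₀ hμ (rapidDecay_invFourier (weylDeriv α φ) y) hp
  have i2 := integrableOn_lagIntegrand hα₀ hα₂ hα₀ hμ (rapidDecay_invFourier φ y) hp
  have e2 : lagIntegral (mlKernel α α (lam * ‖y‖ ^ 2))
      (fun s => invFourier (ψ - lam • laplacianTest d φ) s y) p.1 =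
      lagIntegral (mlKernel α α (lam * ‖y‖ ^ 2)) (fun s => invFourier (weylDeriv α φ) s y) p.1 +
        ((lam * ‖y‖ ^ 2 : ℝ) : ℂ) * lagIntegral (mlKernel α α (lam * ‖y‖ ^ 2))
          (fun s => invFourier φ s y) p.1 := by
    simp only [lagIntegral]
    rw [← integral_const_mul, ← integral_add i1 (i2.const_mul _)]
    refine setIntegral_congr_fun measurableSet_Ioi fun τ hτ => ?_
    have hτ' : 0 < τ := hτ
    have e3 : ψ - lam • laplacianTest d φ = ψ + (-lam) • laplacianTest d φ := by
      rw [neg_smul, sub_eq_add_neg]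
    rw [e3, invFourier_add, invFourier_smul, invFourier_laplacianTest, hψ _ (by linarith)]
    push_cast
    ring
  rw [e2, hmain]
  ring

/-! ### The deterministic part of the solution -/

section Deterministic

variable {d : ℕ} {α lam : ℝ}

theorem halfVolume_eq_prod (d : ℕ) : halfVolume d =
    (volume.restrict (Ioi (0 : ℝ))).prod (volume : Measure (EuclideanSpace ℝ (Fin d))) := by
  rw [Measure.restrict_prod_eq_prod_univ, halfVolume, Measure.volume_eq_prod]
  congr 1
  ext p
  simp

theorem ae_halfVolume_pos (d : ℕ) : ∀ᵐ q ∂(halfVolume d), 0 < q.1 :=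
  ae_restrict_mem (measurableSet_lt measurable_const measurable_fst)

/-- The majorant is kept apart from the kernel because it increases with `c`, and so also dominates
in the limit `ε → 0`. -/
theorem integrable_majorant_mul_invFourier {β c r : ℝ} (hβ : 0 < β) (hc : 0 ≤ c) (hr : 0 ≤ r)
    (k : ℕ) (φ : TestFn d) : Integrable (fun q : TimeSpace d => (1 + c * ‖q.2‖ ^ 2) ^ k *
      (q.1 ^ (β - 1) * (1 + q.1) ^ (2 * k)) * ‖invFourier φ (r + q.1) q.2‖) (halfVolume d) := by
  obtain ⟨n, hn⟩ := exists_nat_gt β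
  set N := Module.finrank ℝ (EuclideanSpace ℝ (Fin d)) + 1
  obtain ⟨C, hC, h⟩ := exists_norm_invFourier_le (2 * k + n) (k + N) φ
  have hb : Integrable (fun q : TimeSpace d => (C * (1 + c) ^ k * 2 ^ N) *
      (q.1 ^ (β - 1) * ((1 + q.1) ^ n)⁻¹ * ((1 + ‖q.2‖) ^ N)⁻¹)) (halfVolume d) := by
    rw [halfVolume_eq_prod]
    have h1 : IntegrableOn (fun τ : ℝ => τ ^ (β - 1) * ((1 + τ) ^ n)⁻¹) (Ioi 0) :=
      integrableOn_rpow_mul_one_add_pow_inv hβ hn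
    have h2 : Integrable fun y : EuclideanSpace ℝ (Fin d) => ((1 + ‖y‖) ^ N)⁻¹ :=
      integrable_inv_one_add_norm_pow volume (Nat.lt_succ_self _)
    exact (h1.mul_prod h2).const_mul _
  refine hb.mono' ?_ ?_
  · have h1 := (continuous_invFourier φ).comp (f := fun q : TimeSpace d => (r + q.1, q.2))
      (by fun_prop)
    exact (Measurable.mul (by fun_prop) h1.norm.measurable).aestronglyMeasurable
  · filter_upwards [ae_halfVolume_pos d] with q hq
    have h0 : 0 ≤ q.1 ^ (β - 1) := Real.rpow_nonneg hq.le _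
    have h1 := h (r + q.1) q.2
    rw [Real.norm_of_nonneg (by positivity)] at h1
    have h2 : 1 + c * ‖q.2‖ ^ 2 ≤ (1 + c) * (1 + ‖q.2‖ ^ 2) := by nlinarith [sq_nonneg ‖q.2‖]
    have h3 : 1 + ‖q.2‖ ≤ 2 * (1 + ‖q.2‖ ^ 2) := by nlinarith [sq_nonneg (‖q.2‖ - 1)]
    have h4 : ((1 + ‖q.2‖ ^ 2) ^ N)⁻¹ ≤ 2 ^ N * ((1 + ‖q.2‖) ^ N)⁻¹ := by
      rw [← div_eq_mul_inv, inv_le_iff_one_le_mul₀ (by positivity), div_mul_eq_mul_div,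
        one_le_div (by positivity), ← mul_pow]
      gcongr
    rw [Real.norm_of_nonneg (by positivity)]
    calc (1 + c * ‖q.2‖ ^ 2) ^ k * (q.1 ^ (β - 1) * (1 + q.1) ^ (2 * k)) *
          ‖invFourier φ (r + q.1) q.2‖
        ≤ ((1 + c) * (1 + ‖q.2‖ ^ 2)) ^ k * (q.1 ^ (β - 1) * (1 + q.1) ^ (2 * k)) *
          (C * (((1 + q.1) ^ (2 * k + n))⁻¹ * ((1 + ‖q.2‖ ^ 2) ^ (k + N))⁻¹)) := by
          gcongr
          refine h1.trans ?_
          gcongr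
          linarith
      _ = (C * (1 + c) ^ k) * (q.1 ^ (β - 1) * ((1 + q.1) ^ n)⁻¹ * ((1 + ‖q.2‖ ^ 2) ^ N)⁻¹) := by
          rw [pow_add, pow_add, mul_pow]
          field_simp
      _ ≤ (C * (1 + c) ^ k) * (q.1 ^ (β - 1) * ((1 + q.1) ^ n)⁻¹ *
          (2 ^ N * ((1 + ‖q.2‖) ^ N)⁻¹)) := by gcongr
      _ = _ := by ring

theorem integrable_mlKernel_mul_invFourier (hα₀ : 0 < α) (hα₂ : α < 2) {β r : ℝ} (hβ : 0 < β)
    (hlam : 0 ≤ lam) (hr : 0 ≤ r) (φ : TestFn d) :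
    Integrable (fun q : TimeSpace d => (mlKernel α β (lam * ‖q.2‖ ^ 2) q.1 : ℂ) *
      invFourier φ (r + q.1) q.2) (halfVolume d) := by
  obtain ⟨k, C, hC, h⟩ := exists_abs_mlKernel_le hα₀ hα₂ β
  refine ((integrable_majorant_mul_invFourier hβ hlam hr k φ).const_mul C).mono' ?_ ?_
  · have h1 := (continuous_invFourier φ).comp (f := fun q : TimeSpace d => (r + q.1, q.2))
      (by fun_prop)
    exact ((Complex.measurable_ofReal.comp ((measurable_mlKernel hα₀ β).comp
      (f := fun q : TimeSpace d => (lam * ‖q.2‖ ^ 2, q.1)) (by fun_prop))).mul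
        h1.measurable).aestronglyMeasurable
  · filter_upwards [ae_halfVolume_pos d] with q hq
    rw [norm_mul, Complex.norm_real, Real.norm_eq_abs]
    calc _ ≤ C * (1 + lam * ‖q.2‖ ^ 2) ^ k * (q.1 ^ (β - 1) * (1 + q.1) ^ (2 * k)) *
          ‖invFourier φ (r + q.1) q.2‖ := by
          gcongr
          exact h _ (by positivity) _ hq
      _ = _ := by ring

theorem I2Integrand_add (φ : TestFn d) (p q : TimeSpace d) :
    I2Integrand α lam φ p ((p.1, 0) + q) = Complex.exp (-(Complex.I * (inner ℝ p.2 q.2 : ℝ))) *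
      ((mlKernel α α (lam * ‖q.2‖ ^ 2) q.1 : ℂ) * invFourier φ (p.1 + q.1) q.2) := by
  have e1 : ((p.1, 0) + q : TimeSpace d).1 = p.1 + q.1 := rfl
  have e2 : ((p.1, 0) + q : TimeSpace d).2 = q.2 := zero_add _
  rw [I2Integrand, e1, e2, add_sub_cancel_left, mlKernel,
    show lam * q.1 ^ α * ‖q.2‖ ^ 2 = lam * ‖q.2‖ ^ 2 * q.1 ^ α by ring]
  push_cast
  ring

/-- The kernel of the Duhamel formula. -/
theorem duhamel_eq_integral (hα₀ : 0 < α) (hα₂ : α < 2) (hlam : 0 < lam) (φ : TestFn d)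
    {p : TimeSpace d} (hp : 0 < p.1) :
    IntegrableOn (I2Integrand α lam φ p) {q | p.1 < q.1} ∧
      (duhamel d hα₀ hα₂ hlam φ p : ℂ) = ∫ q in {q : TimeSpace d | p.1 < q.1},
        I2Integrand α lam φ p q := by
  have hmp := measurePreserving_add_left (volume : Measure (TimeSpace d)) (p.1, 0)
  have hemb := (MeasurableEquiv.addLeft ((p.1, 0) : TimeSpace d)).measurableEmbedding
  have hpre : (fun q : TimeSpace d => (p.1, 0) + q) ⁻¹' {q | p.1 < q.1} = {q | 0 < q.1} := by
    ext q
    simp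
  have hi : Integrable (fun q : TimeSpace d => Complex.exp (-(Complex.I * (inner ℝ p.2 q.2 : ℝ))) *
      ((mlKernel α α (lam * ‖q.2‖ ^ 2) q.1 : ℂ) * invFourier φ (p.1 + q.1) q.2)) (halfVolume d) := by
    refine (integrable_mlKernel_mul_invFourier hα₀ hα₂ hα₀ hlam.le hp.le φ).bdd_mul
      (c := 1) ?_ (Eventually.of_forall fun q => ?_)
    · exact (by fun_prop : Continuous fun q : TimeSpace d =>
        Complex.exp (-(Complex.I * (inner ℝ p.2 q.2 : ℝ)))).aestronglyMeasurable
    · rw [show -(Complex.I * ((inner ℝ p.2 q.2 : ℝ) : ℂ)) = ((-inner ℝ p.2 q.2 : ℝ) : ℂ) * Complex.I by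
        push_cast; ring, Complex.norm_exp_ofReal_mul_I]
  constructor
  · rw [← hmp.integrableOn_comp_preimage hemb, hpre]
    exact hi.congr (Eventually.of_forall fun q => (I2Integrand_add φ p q).symm)
  · rw [← hmp.setIntegral_preimage_emb hemb, hpre]
    change _ = ∫ q, _ ∂(halfVolume d)
    simp only [I2Integrand_add]
    rw [halfVolume_eq_prod] at hi ⊢
    -- Integrating over the lag first leaves the spatial transform of `duhamel φ`, and Fourier
    -- inversion recovers its value at `p`.
    rw [integral_prod_symm _ hi, ← integral_exp_mul_invFourier]
    refine integral_congr_ae (Eventually.of_forall fun y => ?_)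
    simp only
    rw [invFourier_duhamel hα₀ hα₂ hlam φ (by linarith), ← integral_const_mul]

/-- The initial value `δ_0`, as a tempered distribution on time-space. -/
def deltaInitialCLM (d : ℕ) : TDist d :=
  (SchwartzMap.integralCLM ℝ (volume.restrict (Ioi (0 : ℝ)))).comp (sliceFst 0)

theorem deltaInitialCLM_apply (φ : TestFn d) : deltaInitialCLM d φ = deltaInitial φ := by
  rw [deltaInitialCLM, ContinuousLinearMap.comp_apply, SchwartzMap.integralCLM_apply]
  rfl

/-- The deterministic part of the solution of the fractional heat equation. -/
def meanSolution (d : ℕ) (hα₀ : 0 < α) (hα₂ : α < 2) (hlam : 0 < lam) : TDist d :=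
  (deltaInitialCLM d).comp (ContinuousLinearMap.id ℝ _ +
    lam • (laplacianTest d).comp (duhamel d hα₀ hα₂ hlam))

theorem meanSolution_apply (hα₀ : 0 < α) (hα₂ : α < 2) (hlam : 0 < lam) (φ : TestFn d) :
    meanSolution d hα₀ hα₂ hlam φ =
      deltaInitial (φ + lam • laplacianTest d (duhamel d hα₀ hα₂ hlam φ)) := by
  rw [← deltaInitialCLM_apply]
  rfl

theorem integrable_invFourier_halfVolume (φ : TestFn d) :
    Integrable (fun q : TimeSpace d => invFourier φ q.1 q.2) (halfVolume d) := by
  -- With `λ = 0` and `α = β = 1` the kernel is identically `1` on `t > 0`.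
  have h := integrable_mlKernel_mul_invFourier (lam := 0) one_pos one_lt_two one_pos le_rfl le_rfl φ
  simpa [mlKernel_zero] using h

theorem deltaInitial_eq_integral (φ : TestFn d) :
    (deltaInitial φ : ℂ) = ∫ q, invFourier φ q.1 q.2 ∂(halfVolume d) := by
  have h := integrable_invFourier_halfVolume φ
  rw [halfVolume_eq_prod] at h ⊢
  rw [integral_prod _ h, deltaInitial, ← integral_complex_ofReal]
  refine integral_congr_ae (Eventually.of_forall fun t => ?_)
  simp only
  rw [← integral_exp_mul_invFourier]
  simp

theorem I1Integrand_eq (φ : TestFn d) (q : TimeSpace d) : I1Integrand α lam φ q =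
    (mlKernel α 1 (lam * ‖q.2‖ ^ 2) q.1 : ℂ) * invFourier φ q.1 q.2 := by
  rw [I1Integrand, mlKernel, show lam * q.1 ^ α * ‖q.2‖ ^ 2 = lam * ‖q.2‖ ^ 2 * q.1 ^ α by ring]
  simp

/-- For fixed `y` the Volterra equation reads `E_α(-μ t^α) = 1 - μ J¹(t^(α-1) E_{α,α}(-μ t^α))`.
Paired with the transform of `φ` this is the time integral of the transform of `φ + λΔKφ`, and
integrating over `y` evaluates at `x = 0`. -/
theorem isI1_meanSolution (hα₀ : 0 < α) (hα₂ : α < 2) (hlam : 0 < lam) :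
    IsI1 α lam (meanSolution d hα₀ hα₂ hlam) := by
  intro φ
  have hi : Integrable (I1Integrand α lam φ) (halfVolume d) := by
    have h := integrable_mlKernel_mul_invFourier hα₀ hα₂ one_pos hlam.le le_rfl φ
    refine h.congr (Eventually.of_forall fun q => ?_)
    simp only
    rw [I1Integrand_eq, zero_add]
  refine ⟨hi, ?_⟩
  rw [meanSolution_apply, deltaInitial_eq_integral]
  set ψ := φ + lam • laplacianTest d (duhamel d hα₀ hα₂ hlam φ) with hψ
  have hi' := integrable_invFourier_halfVolume ψ
  rw [halfVolume_eq_prod] at hi hi' ⊢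
  rw [integral_prod_symm _ hi, integral_prod_symm _ hi']
  refine integral_congr_ae (Eventually.of_forall fun y => ?_)
  simp only [I1Integrand_eq]
  have hμ : 0 ≤ lam * ‖y‖ ^ 2 := by positivity
  have hd := rapidDecay_invFourier φ y
  have h1 := lagIntegral_mlKernel_eq_sub hα₀ hα₂ one_pos hμ hd le_rfl
  rw [add_comm α 1, ← add_comm α 1, ← lagIntegral_mlKernel_zero_mlKernel hα₀ hα₂ hα₀ one_pos hμ hd
    le_rfl, lagIntegral_mlKernel_one_zero hα₀, lagIntegral_mlKernel_one_zero hα₀] at h1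
  rw [lagIntegral] at h1
  simp only [zero_add] at h1
  rw [h1, ← integral_const_mul]
  have e : ∀ t > 0, invFourier ψ t y = invFourier φ t y - ((lam * ‖y‖ ^ 2 : ℝ) : ℂ) *
      lagIntegral (mlKernel α α (lam * ‖y‖ ^ 2)) (fun s => invFourier φ s y) t := fun t ht => by
    rw [hψ, invFourier_add, invFourier_smul, invFourier_laplacianTest,
      invFourier_duhamel_eq_lagIntegral hα₀ hα₂ hlam φ (by linarith)]
    push_cast
    ring
  have iφ : IntegrableOn (fun t => invFourier φ t y) (Ioi 0) := by
    rw [← coe_invFourierTime]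
    exact (invFourierTime y φ).integrable.integrableOn
  have iψ : IntegrableOn (fun t => invFourier ψ t y) (Ioi 0) := by
    rw [← coe_invFourierTime]
    exact (invFourierTime y ψ).integrable.integrableOn
  rw [← integral_sub iφ]
  · exact setIntegral_congr_fun measurableSet_Ioi fun t ht => e t ht
  · refine (iφ.sub iψ).congr_fun (fun t ht => ?_) measurableSet_Ioi
    rw [Pi.sub_apply, e t ht]
    ring

theorem invFourier_timeConcentrate {ε : ℝ} (hε : ε ≠ 0) (φ : TestFn d) (t : ℝ)
    (y : EuclideanSpace ℝ (Fin d)) :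
    invFourier (timeConcentrate ε φ) t y = (ε : ℂ)⁻¹ * invFourier φ (t / ε) y := by
  simp only [invFourier_eq_integral, timeConcentrate_apply hε]
  rw [← integral_const_mul]
  refine integral_congr_ae (Eventually.of_forall fun x => ?_)
  simp only [Complex.real_smul]
  push_cast
  ring

theorem invFourier_spaceShift (a : EuclideanSpace ℝ (Fin d)) (φ : TestFn d) (t : ℝ)
    (y : EuclideanSpace ℝ (Fin d)) :
    invFourier (spaceShift a φ) t y =
      Complex.exp (Complex.I * (inner ℝ a y : ℝ)) * invFourier φ t y := by
  simp only [invFourier_eq_integral, spaceShift, SchwartzMap.compSubConstCLM_apply]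
  rw [← integral_const_mul]
  refine Eq.trans ?_ (integral_sub_right_eq_self (fun x =>
    Complex.exp (Complex.I * (inner ℝ a y : ℝ)) * φ (t, x) • fourierWeight y x) a)
  refine integral_congr_ae (Eventually.of_forall fun x => ?_)
  simp only [Prod.mk_sub_mk, sub_zero, Complex.real_smul, fourierWeight]
  have : inner ℝ x y = inner ℝ a y + inner ℝ (x - a) y := by
    rw [← inner_add_left, add_sub_cancel]
  rw [this]
  push_cast
  rw [mul_add, Complex.exp_add]
  ring

/-- By self-similarity, compressing time by `ε` amounts to replacing `λ` by `λ ε^α`. -/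
theorem meanSolution_timeConcentrate (hα₀ : 0 < α) (hα₂ : α < 2) (hlam : 0 < lam) {ε : ℝ}
    (hε : 0 < ε) (φ : TestFn d) :
    (meanSolution d hα₀ hα₂ hlam (timeConcentrate ε φ) : ℂ) =
      ∫ q, (mlKernel α 1 (lam * ε ^ α * ‖q.2‖ ^ 2) q.1 : ℂ) * invFourier φ q.1 q.2
        ∂(halfVolume d) := by
  have hlamε : 0 ≤ lam * ε ^ α := mul_nonneg hlam.le (Real.rpow_nonneg hε.le _)
  obtain ⟨hi, h⟩ := isI1_meanSolution (d := d) hα₀ hα₂ hlam (timeConcentrate ε φ)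
  have hi' := integrable_mlKernel_mul_invFourier hα₀ hα₂ one_pos hlamε le_rfl φ
  simp only [zero_add] at hi'
  rw [h]
  rw [halfVolume_eq_prod] at hi hi' ⊢
  rw [integral_prod _ hi, integral_prod _ hi']
  have hs := integral_comp_mul_left_Ioi (fun t => ∫ y : EuclideanSpace ℝ (Fin d),
    I1Integrand α lam (timeConcentrate ε φ) (t, y)) 0 hε
  rw [mul_zero, eq_inv_smul_iff₀ hε.ne'] at hs
  rw [← hs, ← integral_smul]
  refine setIntegral_congr_fun measurableSet_Ioi fun t ht => ?_
  have ht' : 0 < t := ht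
  simp only
  rw [← integral_smul]
  refine integral_congr_ae (Eventually.of_forall fun y => ?_)
  simp only [I1Integrand_eq, invFourier_timeConcentrate hε.ne', mul_div_cancel_left₀ t hε.ne']
  have hk : mlKernel α 1 (lam * ‖y‖ ^ 2) (ε * t) = mlKernel α 1 (lam * ε ^ α * ‖y‖ ^ 2) t := by
    rw [mlKernel, mlKernel, Real.mul_rpow (z := α) hε.le ht'.le]
    simp only [sub_self, Real.rpow_zero]
    congr 2
    ring
  rw [hk, Complex.real_smul]
  have : (ε : ℂ) ≠ 0 := by exact_mod_cast hε.ne'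
  field_simp

theorem tendsto_meanSolution_timeConcentrate (hα₀ : 0 < α) (hα₂ : α < 2) (hlam : 0 < lam)
    (φ : TestFn d) : Tendsto (fun ε : ℝ => meanSolution d hα₀ hα₂ hlam (timeConcentrate ε φ))
      (𝓝[>] 0) (𝓝 (deltaInitial φ)) := by
  have hsmall : ∀ᶠ ε : ℝ in 𝓝[>] 0, 0 < ε ∧ ε ≤ 1 := by
    filter_upwards [Ioc_mem_nhdsGT (zero_lt_one' ℝ)] with ε hε using hε
  have key : Tendsto (fun ε : ℝ => ∫ q, (mlKernel α 1 (lam * ε ^ α * ‖q.2‖ ^ 2) q.1 : ℂ) *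
      invFourier φ q.1 q.2 ∂(halfVolume d)) (𝓝[>] 0)
      (𝓝 (∫ q, invFourier φ q.1 q.2 ∂(halfVolume d))) := by
    obtain ⟨k, C, hC, h⟩ := exists_abs_mlKernel_le hα₀ hα₂ 1
    refine tendsto_integral_filter_of_dominated_convergence _ ?_ ?_
      ((integrable_majorant_mul_invFourier one_pos hlam.le le_rfl k φ).const_mul C) ?_
    · filter_upwards [hsmall] with ε hε
      have hlamε : 0 ≤ lam * ε ^ α := mul_nonneg hlam.le (Real.rpow_nonneg hε.1.le _)
      have hi' := integrable_mlKernel_mul_invFourier hα₀ hα₂ one_pos hlamε le_rfl φ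
      simp only [zero_add] at hi'
      exact hi'.aestronglyMeasurable
    · filter_upwards [hsmall] with ε hε
      filter_upwards [ae_halfVolume_pos d] with q hq
      have h0 : 0 ≤ ε ^ α := Real.rpow_nonneg hε.1.le _
      have h1 : ε ^ α ≤ 1 := Real.rpow_le_one hε.1.le hε.2 hα₀.le
      have h2 : lam * ε ^ α ≤ lam := mul_le_of_le_one_right hlam.le h1
      rw [norm_mul, Complex.norm_real, Real.norm_eq_abs, zero_add]
      have h3 : 0 ≤ q.1 ^ ((1 : ℝ) - 1) := Real.rpow_nonneg hq.le _
      calc _ ≤ C * (1 + lam * ε ^ α * ‖q.2‖ ^ 2) ^ k * (q.1 ^ ((1 : ℝ) - 1) *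
            (1 + q.1) ^ (2 * k)) * ‖invFourier φ q.1 q.2‖ := by
            gcongr
            exact h _ (by positivity) _ hq
        _ ≤ C * (1 + lam * ‖q.2‖ ^ 2) ^ k * (q.1 ^ ((1 : ℝ) - 1) *
            (1 + q.1) ^ (2 * k)) * ‖invFourier φ q.1 q.2‖ := by
            gcongr
        _ = _ := by ring
    · filter_upwards [ae_halfVolume_pos d] with q hq
      -- Pointwise the kernel tends to its value for `λ = 0`, which is `E_α(0) = 1`.
      have h1 : Tendsto (fun ε : ℝ => mlKernel α 1 (lam * ε ^ α * ‖q.2‖ ^ 2) q.1) (𝓝 0) (𝓝 1) := by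
        have hc : Continuous fun ε : ℝ => mlKernel α 1 (lam * ε ^ α * ‖q.2‖ ^ 2) q.1 := by
          have := Real.continuous_rpow_const (q := α) hα₀.le
          have := continuous_mittagLeffler hα₀ 1
          unfold mlKernel
          fun_prop
        have h2 := hc.tendsto 0
        simp only [Real.zero_rpow hα₀.ne', mul_zero, zero_mul] at h2
        rw [mlKernel_zero hα₀] at h2
        simpa using h2
      have h2 := ((Complex.continuous_ofReal.tendsto 1).comp h1).mul_const (invFourier φ q.1 q.2)
      rw [Complex.ofReal_one, one_mul] at h2
      exact h2.mono_left nhdsWithin_le_nhds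
  rw [← deltaInitial_eq_integral] at key
  have h := (Complex.continuous_re.tendsto _).comp key
  rw [Complex.ofReal_re] at h
  refine h.congr' ?_
  filter_upwards [hsmall] with ε hε
  rw [Function.comp_apply, ← meanSolution_timeConcentrate hα₀ hα₂ hlam hε.1, Complex.ofReal_re]

/-- A shift by `a` multiplies the transform by `e^{i a·y}`, so the pairing is a Fourier integral at
a frequency proportional to `a`, and the Riemann-Lebesgue lemma applies. -/
theorem tendsto_meanSolution_spaceShift (hα₀ : 0 < α) (hα₂ : α < 2) (hlam : 0 < lam)
    (φ : TestFn d) : Tendsto (fun a => meanSolution d hα₀ hα₂ hlam (spaceShift a φ))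
      (cocompact (EuclideanSpace ℝ (Fin d))) (𝓝 0) := by
  set G : EuclideanSpace ℝ (Fin d) → ℂ := fun y => ∫ t in Ioi 0, I1Integrand α lam φ (t, y) with hG
  have hI : ∀ a, (meanSolution d hα₀ hα₂ hlam (spaceShift a φ) : ℂ) =
      ∫ y, Real.fourierChar (-(inner ℝ y (-((2 * Real.pi)⁻¹ • a)))) • G y := fun a => by
    obtain ⟨hi, h⟩ := isI1_meanSolution (d := d) hα₀ hα₂ hlam (spaceShift a φ)
    rw [h]
    rw [halfVolume_eq_prod] at hi ⊢
    rw [integral_prod_symm _ hi]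
    refine integral_congr_ae (Eventually.of_forall fun y => ?_)
    simp only [hG, I1Integrand, invFourier_spaceShift]
    rw [Circle.smul_def, Real.fourierChar_apply, smul_eq_mul, ← integral_const_mul]
    refine integral_congr_ae (Eventually.of_forall fun t => ?_)
    simp only
    have : 2 * Real.pi * -(inner ℝ y (-((2 * Real.pi)⁻¹ • a))) = inner ℝ a y := by
      rw [inner_neg_right, inner_smul_right, real_inner_comm]
      field_simp
    rw [this, mul_comm Complex.I]
    ring
  have hne : -(2 * Real.pi)⁻¹ ≠ 0 := neg_ne_zero.mpr (inv_ne_zero (by positivity))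
  have h1 := (tendsto_integral_exp_inner_smul_cocompact G).comp
    (Homeomorph.smulOfNeZero (-(2 * Real.pi)⁻¹) hne :
      EuclideanSpace ℝ (Fin d) ≃ₜ EuclideanSpace ℝ (Fin d)).isClosedEmbedding.tendsto_cocompact
  have h2 := (Complex.continuous_re.tendsto _).comp h1
  refine h2.congr fun a => ?_
  simp only [Function.comp_apply, Homeomorph.smulOfNeZero_apply, neg_smul]
  rw [← hI, Complex.ofReal_re]

end Deterministic

/-! ### The functions `theta` -/

theorem measurable_theta : Measurable fun q : ℝ × ℝ => theta q.1 q.2 := by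
  unfold theta
  refine Measurable.ite ?_ measurable_const (Measurable.ite ?_ measurable_const measurable_const)
  · exact (measurableSet_lt measurable_const measurable_snd).inter
      (measurableSet_le measurable_snd measurable_fst)
  · exact (measurableSet_lt measurable_fst measurable_snd).inter
      (measurableSet_le measurable_snd measurable_const)

theorem abs_theta_le_one (a s : ℝ) : |theta a s| ≤ 1 := by
  unfold theta
  split_ifs <;> simp

theorem abs_theta (a s : ℝ) : |theta a s| = (uIoc 0 a).indicator (fun _ => (1 : ℝ)) s := by
  rcases le_total 0 a with h | h
  · rw [uIoc_of_le h, theta, indicator]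
    simp only [mem_Ioc]
    by_cases h1 : 0 < s ∧ s ≤ a
    · simp [h1]
    · rw [if_neg h1, if_neg h1, if_neg (by rintro ⟨h2, h3⟩; linarith), abs_zero]
  · rw [uIoc_of_ge h, theta, indicator]
    simp only [mem_Ioc]
    rw [if_neg (by rintro ⟨h2, h3⟩; linarith)]
    split_ifs <;> simp

theorem integrable_theta (a : ℝ) : Integrable (theta a) := by
  have h1 : Integrable ((uIoc 0 a).indicator fun _ => (1 : ℝ)) :=
    (integrable_indicator_iff measurableSet_uIoc).mpr (integrableOn_const (by simp [uIoc]))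
  refine h1.mono' (measurable_theta.comp (f := fun s : ℝ => (a, s)) (by fun_prop)).aestronglyMeasurable
    (Eventually.of_forall fun s => ?_)
  rw [Real.norm_eq_abs, abs_theta]

theorem integral_abs_theta (a : ℝ) : ∫ s, |theta a s| = |a| := by
  simp_rw [abs_theta]
  rw [integral_indicator measurableSet_uIoc]
  rcases le_total 0 a with h | h
  · simp [h, abs_of_nonneg]
  · simp [h, abs_of_nonpos]

theorem theta_mul_self (a s : ℝ) : theta a s * theta a s = |theta a s| := by
  unfold theta
  split_ifs <;> simp

/-- As a function of `a`, `θ_a(s)` is the indicator of `a ≥ s` if `s > 0` and minus the indicator of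
`a < s` if `s ≤ 0`. Either way its derivative is the point mass at `s`. -/
theorem integral_theta_mul_deriv (f : 𝓢(ℝ, ℝ)) (s : ℝ) : ∫ a, theta a s * deriv f a = -f s := by
  have hi : Integrable (deriv f) := (SchwartzMap.derivCLM ℝ ℝ f).integrable
  have hd : ∀ a, HasDerivAt f (deriv f a) a := fun a => f.differentiableAt.hasDerivAt
  rcases lt_or_ge 0 s with hs | hs
  · have h1 : ∀ a, theta a s * deriv f a = (Ici s).indicator (deriv f) a := fun a => by
      rw [theta, indicator]
      by_cases h : s ≤ a
      · simp [h, hs]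
      · simp [h, hs.not_ge]
    simp_rw [h1]
    rw [integral_indicator measurableSet_Ici, integral_Ici_eq_integral_Ioi,
      integral_Ioi_of_hasDerivAt_of_tendsto' (fun a _ => hd a) hi.integrableOn
        (f.tendsto_cocompact.mono_left atTop_le_cocompact), zero_sub]
  · have h1 : ∀ a, theta a s * deriv f a = -(Iio s).indicator (deriv f) a := fun a => by
      rw [theta, indicator]
      by_cases h : a < s
      · simp [h, hs, hs.not_gt]
      · simp [h, hs.not_gt]
    simp_rw [h1]
    rw [integral_neg, integral_indicator measurableSet_Iio, ← integral_Iic_eq_integral_Iio,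
      integral_Iic_of_hasDerivAt_of_tendsto' (fun a _ => hd a) hi.integrableOn
        (f.tendsto_cocompact.mono_left atBot_le_cocompact), sub_zero]

/-! ### Line derivatives under linear changes of variables and slicing -/

section Pullback

variable {E F V : Type*} [NormedAddCommGroup E] [NormedSpace ℝ E] [NormedAddCommGroup F]
  [NormedSpace ℝ F] [NormedAddCommGroup V] [NormedSpace ℝ V]

theorem lineDerivOp_compCLMOfContinuousLinearEquiv (L : E ≃L[ℝ] F) (φ : 𝓢(F, V)) (v : E) :
    ∂_{v} (SchwartzMap.compCLMOfContinuousLinearEquiv ℝ L φ) =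
      SchwartzMap.compCLMOfContinuousLinearEquiv ℝ L (∂_{L v} φ) := by
  ext x
  simp [SchwartzMap.lineDerivOp_apply, lineDeriv]

theorem iteratedLineDerivOp_compCLMOfContinuousLinearEquiv (L : E ≃L[ℝ] F) {n : ℕ} (v : Fin n → E)
    (φ : 𝓢(F, V)) : ∂^{v} (SchwartzMap.compCLMOfContinuousLinearEquiv ℝ L φ) =
      SchwartzMap.compCLMOfContinuousLinearEquiv ℝ L (∂^{fun i => L (v i)} φ) := by
  induction n with
  | zero => rfl
  | succ n ih =>
    rw [LineDeriv.iteratedLineDerivOp_succ_left, ih, lineDerivOp_compCLMOfContinuousLinearEquiv,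
      LineDeriv.iteratedLineDerivOp_succ_left]
    rfl

theorem iteratedLineDerivOp_sliceSnd (x : E) {n : ℕ} (v : Fin n → F) (φ : 𝓢(E × F, V)) :
    ∂^{v} (sliceSnd x φ) = sliceSnd x (∂^{fun i => ((0, v i) : E × F)} φ) := by
  induction n with
  | zero => rfl
  | succ n ih =>
    rw [LineDeriv.iteratedLineDerivOp_succ_left, ih, lineDerivOp_sliceSnd,
      LineDeriv.iteratedLineDerivOp_succ_left]
    rfl

end Pullback

theorem abs_prod_theta_le_one {ι : Type*} (I : Finset ι) (a s : ι → ℝ) :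
    |∏ i ∈ I, theta (a i) (s i)| ≤ 1 := by
  rw [Finset.abs_prod]
  exact Finset.prod_le_one (fun i _ => abs_nonneg _) fun i _ => abs_theta_le_one _ _

theorem measurable_theta_left (s : ℝ) : Measurable fun a => theta a s :=
  measurable_theta.comp (f := fun a : ℝ => (a, s)) (by fun_prop)

/-- The product of the functions `theta` represents the inverse of the mixed derivative. -/
theorem integral_prod_theta_mul_iteratedLineDerivOp {n : ℕ} (s : Fin n → ℝ)
    (φ : 𝓢(Fin n → ℝ, ℝ)) :
    ∫ a, (∏ i, theta (a i) (s i)) * (∂^{fun i => (Pi.single i 1 : Fin n → ℝ)} φ) a =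
      (-1) ^ n * φ s := by
  induction n with
  | zero =>
    rw [volume_pi, Measure.pi_of_empty _ s, integral_dirac]
    simp
  | succ n ih =>
    set C := Fin.consEquivL ℝ fun _ : Fin (n + 1) => ℝ with hC
    have hCapp : ∀ z : ℝ × (Fin n → ℝ), C z = Fin.cons z.1 z.2 := fun z => rfl
    set φ' : 𝓢(ℝ × (Fin n → ℝ), ℝ) := SchwartzMap.compCLMOfContinuousLinearEquiv ℝ C φ with hφ'
    set e : Fin n → ℝ × (Fin n → ℝ) := fun i => (0, Pi.single i 1) with he
    set ψ : 𝓢(ℝ × (Fin n → ℝ), ℝ) := ∂^{e} φ' with hψ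
    have hd : ∀ z, (∂^{fun i => (Pi.single i 1 : Fin (n + 1) → ℝ)} φ) (C z) =
        (∂_{((1, 0) : ℝ × (Fin n → ℝ))} ψ) z := by
      intro z
      have h1 : (fun i => (Pi.single i 1 : Fin (n + 1) → ℝ)) = fun i =>
          C ((Fin.cons ((1, 0) : ℝ × (Fin n → ℝ)) e : Fin (n + 1) → ℝ × (Fin n → ℝ)) i) := by
        ext i j
        refine Fin.cases ?_ (fun i => ?_) i <;> refine Fin.cases ?_ (fun j => ?_) j <;>
          simp [hCapp, he, Pi.single_apply, Fin.succ_ne_zero]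
      have h2 : ∂_{((1, 0) : ℝ × (Fin n → ℝ))} ψ =
          ∂^{(Fin.cons ((1, 0) : ℝ × (Fin n → ℝ)) e : Fin (n + 1) → ℝ × (Fin n → ℝ))} φ' := by
        rw [LineDeriv.iteratedLineDerivOp_succ_left]
        rfl
      rw [h2, hφ', iteratedLineDerivOp_compCLMOfContinuousLinearEquiv, ← h1]
      rfl
    have hmp : MeasurePreserving C (volume : Measure (ℝ × (Fin n → ℝ))) volume := by
      have h := (volume_preserving_piFinSuccAbove (fun _ : Fin (n + 1) => ℝ) 0).symm
      have hfun : ⇑C = ⇑(MeasurableEquiv.piFinSuccAbove (fun _ : Fin (n + 1) => ℝ) 0).symm := by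
        ext z i
        simp [hCapp]
      rw [hfun]
      exact h
    have : (volume : Measure (ℝ × (Fin n → ℝ))).IsAddHaarMeasure :=
      Measure.prod.instIsAddHaarMeasure _ _
    rw [← hmp.integral_comp C.toHomeomorph.measurableEmbedding]
    simp only [hd]
    have hi : Integrable (fun z : ℝ × (Fin n → ℝ) => (∏ i, theta (C z i) (s i)) *
        (∂_{((1, 0) : ℝ × (Fin n → ℝ))} ψ) z) (volume.prod volume) := by
      rw [← Measure.volume_eq_prod]
      refine ((∂_{((1, 0) : ℝ × (Fin n → ℝ))} ψ).integrable (μ := volume)).bdd_mul (c := 1) ?_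
        (Eventually.of_forall fun z => abs_prod_theta_le_one _ _ _)
      refine (Finset.measurable_prod _ fun i _ => (measurable_theta_left (s i)).comp ?_).aestronglyMeasurable
      exact ((continuous_apply i).comp C.continuous).measurable
    rw [Measure.volume_eq_prod, integral_prod_symm _ hi]
    -- The coordinate `0` is removed by the one-dimensional identity; the induction hypothesis then
    -- applies to the slice of `φ` at `s 0`.
    have hstep : ∀ a' : Fin n → ℝ, ∫ a₀, (∏ i, theta (C (a₀, a') i) (s i)) *
        (∂_{((1, 0) : ℝ × (Fin n → ℝ))} ψ) (a₀, a') =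
        -((∏ i, theta (a' i) (s i.succ)) * ψ (s 0, a')) := by
      intro a'
      have h1 := integral_theta_mul_deriv (sliceFst a' ψ) (s 0)
      have h2 : ∀ a₀, deriv (sliceFst a' ψ) a₀ = (∂_{((1, 0) : ℝ × (Fin n → ℝ))} ψ) (a₀, a') := by
        intro a₀
        rw [← fderiv_apply_one_eq_deriv, ← SchwartzMap.lineDerivOp_apply_eq_fderiv,
          lineDerivOp_sliceFst]
        rfl
      simp only [h2, sliceFst_apply] at h1
      rw [neg_mul_eq_mul_neg, ← h1, ← integral_const_mul]
      refine integral_congr_ae (Eventually.of_forall fun a₀ => ?_)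
      simp only [Fin.prod_univ_succ, hCapp, Fin.cons_zero, Fin.cons_succ]
      ring
    simp only [hstep]
    rw [integral_neg]
    have h3 := ih (fun i => s i.succ) (sliceSnd (s 0) φ')
    rw [iteratedLineDerivOp_sliceSnd] at h3
    simp only [sliceSnd_apply] at h3
    rw [h3]
    have h4 : φ' (s 0, fun i => s i.succ) = φ s := by
      rw [hφ', SchwartzMap.compCLMOfContinuousLinearEquiv_apply, Function.comp_apply, hCapp]
      congr 1
      exact Fin.cons_self_tail s
    rw [h4, pow_succ]
    ring

/-! ### The kernel of the Brownian sheet -/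

section SheetKernel

variable {d : ℕ}

/-- The function `θ_t ⊗ θ_{x_1} ⊗ ⋯ ⊗ θ_{x_d}` on time-space, for `p = (t, x)`. -/
def sheetKernel (p v : TimeSpace d) : ℝ := theta p.1 v.1 * ∏ i, theta (p.2 i) (v.2 i)

theorem abs_sheetKernel_le_one (p v : TimeSpace d) : |sheetKernel p v| ≤ 1 := by
  rw [sheetKernel, abs_mul]
  exact mul_le_one₀ (abs_theta_le_one _ _) (abs_nonneg _) (abs_prod_theta_le_one _ _ _)

theorem measurable_sheetKernel :
    Measurable fun q : TimeSpace d × TimeSpace d => sheetKernel q.1 q.2 := by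
  refine (measurable_theta.comp (f := fun q : TimeSpace d × TimeSpace d => (q.1.1, q.2.1))
    (by fun_prop)).mul (Finset.measurable_fun_prod _ fun i _ => ?_)
  exact measurable_theta.comp (f := fun q : TimeSpace d × TimeSpace d => (q.1.2 i, q.2.2 i))
    (by fun_prop)

theorem integral_mul_prod (f : ℝ → ℝ) (g : Fin d → ℝ → ℝ) :
    ∫ v : TimeSpace d, f v.1 * ∏ i, g i (v.2 i) = (∫ s, f s) * ∏ i, ∫ s, g i s := by
  rw [Measure.volume_eq_prod, integral_prod_mul f fun x : EuclideanSpace ℝ (Fin d) => ∏ i, g i (x i),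
    ← integral_fintype_prod_volume_eq_prod, ← (PiLp.volume_preserving_ofLp (Fin d)).integral_comp
      (MeasurableEquiv.toLp 2 (Fin d → ℝ)).symm.measurableEmbedding]

theorem integral_sheetKernel_mul (p q : TimeSpace d) :
    ∫ v, sheetKernel p v * sheetKernel q v = (∫ s, theta p.1 s * theta q.1 s) *
      ∏ i, ∫ s, theta (p.2 i) s * theta (q.2 i) s := by
  rw [← integral_mul_prod]
  refine integral_congr_ae (Eventually.of_forall fun v => ?_)
  simp only [sheetKernel, Finset.prod_mul_distrib]
  ring

theorem integral_abs_sheetKernel (p : TimeSpace d) :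
    ∫ v, |sheetKernel p v| = |p.1| * ∏ i, |p.2 i| := by
  have h := integral_mul_prod (fun s => |theta p.1 s|) fun i s => |theta (p.2 i) s|
  simp only [integral_abs_theta] at h
  rw [← h]
  simp only [sheetKernel, abs_mul, Finset.abs_prod]

theorem integrable_sheetKernel (p : TimeSpace d) : Integrable (sheetKernel p) := by
  have h2 : Integrable fun x : EuclideanSpace ℝ (Fin d) => ∏ i, theta (p.2 i) (x i) :=
    ((PiLp.volume_preserving_ofLp (Fin d)).integrable_comp_emb
      (MeasurableEquiv.toLp 2 (Fin d → ℝ)).symm.measurableEmbedding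
      (g := fun x : Fin d → ℝ => ∏ i, theta (p.2 i) (x i))).mpr
      (Integrable.fintype_prod fun i => integrable_theta (p.2 i))
  exact (integrable_theta p.1).mul_prod h2

theorem abs_mul_prod_abs_le (p : TimeSpace d) : |p.1| * ∏ i, |p.2 i| ≤ (1 + ‖p‖) ^ (d + 1) := by
  have h1 : |p.1| ≤ 1 + ‖p‖ := (norm_fst_le p).trans (by linarith)
  have h2 : ∏ i, |p.2 i| ≤ (1 + ‖p‖) ^ d := by
    calc ∏ i, |p.2 i| ≤ ∏ _i : Fin d, (1 + ‖p‖) :=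
          Finset.prod_le_prod (fun i _ => abs_nonneg _) fun i _ =>
            (PiLp.norm_apply_le p.2 i).trans ((norm_snd_le p).trans (by linarith))
      _ = _ := by simp
  rw [pow_succ']
  gcongr

/-- The directions of the mixed derivative. -/
def mixedDir (d : ℕ) : Fin (d + 1) → TimeSpace d := Fin.cons (timeDir d) fun i : Fin d => spaceDir i

theorem integral_sheetKernel_mul_mixedDeriv (v : TimeSpace d) (φ : TestFn d) :
    ∫ p, sheetKernel p v * (∂^{mixedDir d} φ) p = (-1) ^ (d + 1) * φ v := by
  set A : (Fin (d + 1) → ℝ) ≃L[ℝ] TimeSpace d := (Fin.consEquivL ℝ fun _ : Fin (d + 1) => ℝ).symm.trans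
    ((ContinuousLinearEquiv.refl ℝ ℝ).prodCongr (EuclideanSpace.equiv (Fin d) ℝ).symm) with hA
  have hA1 : ∀ a, (A a).1 = a 0 := fun a => rfl
  have hA2 : ∀ a i, (A a).2 i = a i.succ := fun a i => rfl
  have hmp : MeasurePreserving A volume volume := by
    have h1 := volume_preserving_piFinSuccAbove (fun _ : Fin (d + 1) => ℝ) 0
    have h2 := (MeasurePreserving.id (volume : Measure ℝ)).prod (PiLp.volume_preserving_toLp (Fin d))
    exact h2.comp h1
  have h := integral_prod_theta_mul_iteratedLineDerivOp (A.symm v)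
    (SchwartzMap.compCLMOfContinuousLinearEquiv ℝ A φ)
  rw [iteratedLineDerivOp_compCLMOfContinuousLinearEquiv] at h
  have hdir : (fun i => A (Pi.single i 1)) = mixedDir d := by
    funext i
    refine Fin.cases ?_ (fun i => ?_) i
    · refine Prod.ext ?_ ?_
      · simp [hA1, mixedDir, timeDir]
      · ext j
        simp [hA2, mixedDir, timeDir]
    · refine Prod.ext ?_ ?_
      · simp [hA1, mixedDir, spaceDir]
      · ext j
        simp [hA2, mixedDir, spaceDir, Pi.single_apply]
  rw [hdir] at h
  rw [← hmp.integral_comp A.toHomeomorph.measurableEmbedding]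
  have hv : ∀ i : Fin d, A.symm v i.succ = v.2 i := fun i => by
    rw [← hA2 (A.symm v), A.apply_symm_apply]
  have hv0 : A.symm v 0 = v.1 := by
    rw [← hA1 (A.symm v), A.apply_symm_apply]
  simp only [SchwartzMap.compCLMOfContinuousLinearEquiv_apply, Function.comp_apply,
    ContinuousLinearEquiv.apply_symm_apply, Fin.prod_univ_succ, hv, hv0] at h
  simp only [sheetKernel, hA1, hA2]
  exact h

end SheetKernel

/-! ### Second moments of integrals of random fields -/

section Moments

variable {d : ℕ}

theorem integrable_inv_one_add_norm_pow_halfVolume :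
    Integrable (fun p : TimeSpace d => ((1 + ‖p‖) ^ (d + 2))⁻¹) (halfVolume d) := by
  refine (integrable_inv_one_add_norm_pow volume ?_).integrableOn
  rw [Module.finrank_prod, finrank_euclideanSpace_fin, Module.finrank_self]
  omega

theorem exists_norm_le_inv_one_add_norm_pow (N : ℕ) : ∃ (s : Finset (ℕ × ℕ)) (C : ℝ), 0 ≤ C ∧
    ∀ (φ : TestFn d) (p : TimeSpace d), |φ p| ≤
      C * s.sup (schwartzSeminormFamily ℝ (TimeSpace d) ℝ) φ * ((1 + ‖p‖) ^ N)⁻¹ := by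
  refine ⟨Finset.Iic (N, 0), 2 ^ N, by positivity, fun φ p => ?_⟩
  have h := SchwartzMap.one_add_le_sup_seminorm_apply (𝕜 := ℝ) (m := (N, 0)) le_rfl le_rfl φ p
  rw [norm_iteratedFDeriv_zero, Real.norm_eq_abs] at h
  rw [← div_eq_mul_inv, le_div_iff₀ (by positivity), mul_comm]
  exact h

theorem integrable_one_add_norm_pow_mul_abs (N : ℕ) (φ : TestFn d) :
    Integrable (fun p => (1 + ‖p‖) ^ N * |φ p|) (halfVolume d) := by
  obtain ⟨s, C, hC, h⟩ := exists_norm_le_inv_one_add_norm_pow (d := d) (N + (d + 2))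
  refine (integrable_inv_one_add_norm_pow_halfVolume.const_mul
    (C * s.sup (schwartzSeminormFamily ℝ (TimeSpace d) ℝ) φ)).mono' ?_
    (Eventually.of_forall fun p => ?_)
  · have := φ.continuous
    exact (by fun_prop : Continuous fun p => (1 + ‖p‖) ^ N * |φ p|).aestronglyMeasurable
  · rw [Real.norm_of_nonneg (by positivity)]
    refine (mul_le_mul_of_nonneg_left (h φ p) (by positivity)).trans (le_of_eq ?_)
    rw [pow_add]
    field_simp

/-- A measurable field on the half space whose second moments grow at most polynomially. -/
structure IsPolynomialField {T : Type*} [MeasurableSpace T] (k : TimeSpace d → T → ℝ)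
    (μ : Measure T) : Prop where
  stronglyMeasurable : StronglyMeasurable fun q : TimeSpace d × T => k q.1 q.2
  memLp : ∀ p : TimeSpace d, 0 ≤ p.1 → MemLp (k p) 2 μ
  bound : ∀ p : TimeSpace d, 0 ≤ p.1 → ∫ v, k p v ^ 2 ∂μ ≤ (1 + ‖p‖) ^ (d + 1)

theorem ae_halfVolume_prod_pos (d : ℕ) :
    ∀ᵐ q : TimeSpace d × TimeSpace d ∂((halfVolume d).prod (halfVolume d)), 0 < q.1.1 ∧ 0 < q.2.1 :=
  (Measure.quasiMeasurePreserving_fst.ae (ae_halfVolume_pos d)).and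
    (Measure.quasiMeasurePreserving_snd.ae (ae_halfVolume_pos d))

instance sFinite_halfVolume (d : ℕ) : SFinite (halfVolume d) := by
  unfold halfVolume
  infer_instance

theorem sq_integral_eq_integral_prod (k ψ : TimeSpace d → ℝ) :
    (∫ p, k p * ψ p ∂(halfVolume d)) ^ 2 = ∫ q : TimeSpace d × TimeSpace d,
      k q.1 * k q.2 * (ψ q.1 * ψ q.2) ∂((halfVolume d).prod (halfVolume d)) := by
  rw [sq, ← integral_prod_mul]
  refine integral_congr_ae (Eventually.of_forall fun q => ?_)
  simp only
  ring

namespace IsPolynomialField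

variable {T : Type*} [MeasurableSpace T] {μ : Measure T} [SFinite μ] {k : TimeSpace d → T → ℝ}

theorem integrable_prod (hk : IsPolynomialField k μ) (ψ : TestFn d) :
    Integrable (fun z : (TimeSpace d × TimeSpace d) × T =>
      k z.1.1 z.2 * k z.1.2 z.2 * (ψ z.1.1 * ψ z.1.2)) (((halfVolume d).prod (halfVolume d)).prod μ) := by
  have hm : StronglyMeasurable fun z : (TimeSpace d × TimeSpace d) × T =>
      k z.1.1 z.2 * k z.1.2 z.2 * (ψ z.1.1 * ψ z.1.2) := by
    have h1 := hk.stronglyMeasurable.measurable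
    have h2 := ψ.continuous.measurable
    have h3 : Measurable fun z : (TimeSpace d × TimeSpace d) × T => k z.1.1 z.2 :=
      h1.comp (f := fun z : (TimeSpace d × TimeSpace d) × T => (z.1.1, z.2)) (by fun_prop)
    have h4 : Measurable fun z : (TimeSpace d × TimeSpace d) × T => k z.1.2 z.2 :=
      h1.comp (f := fun z : (TimeSpace d × TimeSpace d) × T => (z.1.2, z.2)) (by fun_prop)
    exact ((h3.mul h4).mul ((h2.comp (by fun_prop)).mul (h2.comp (by fun_prop)))).stronglyMeasurable
  refine (integrable_prod_iff hm.aestronglyMeasurable).mpr ⟨?_, ?_⟩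
  · filter_upwards [ae_halfVolume_prod_pos d] with q hq
    exact ((hk.memLp _ hq.1.le).integrable_mul (hk.memLp _ hq.2.le)).mul_const _
  · have hw := integrable_one_add_norm_pow_mul_abs (d + 1) ψ
    refine (hw.mul_prod hw).mono' hm.norm.integral_prod_right'.aestronglyMeasurable ?_
    filter_upwards [ae_halfVolume_prod_pos d] with q hq
    have hp := hk.memLp _ hq.1.le
    have hq' := hk.memLp _ hq.2.le
    rw [Real.norm_of_nonneg (integral_nonneg fun _ => norm_nonneg _)]
    simp only [norm_mul, Real.norm_eq_abs]
    rw [integral_mul_const]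
    have h1 : ∫ v, |k q.1 v| * |k q.2 v| ∂μ ≤ (1 + ‖q.1‖) ^ (d + 1) * (1 + ‖q.2‖) ^ (d + 1) := by
      have i1 : Integrable (fun v => |k q.1 v| * |k q.2 v|) μ :=
        (hp.integrable_mul hq').norm.congr (Eventually.of_forall fun v => by simp)
      have e1 : ∫ v, |k q.1 v| * |k q.2 v| ∂μ ≤ ∫ v, (k q.1 v ^ 2 + k q.2 v ^ 2) / 2 ∂μ := by
        refine integral_mono i1 ((hp.integrable_sq.add hq'.integrable_sq).div_const 2) fun v => ?_
        simp only
        nlinarith [sq_nonneg (|k q.1 v| - |k q.2 v|), sq_abs (k q.1 v), sq_abs (k q.2 v)]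
      rw [integral_div, integral_add hp.integrable_sq hq'.integrable_sq] at e1
      have e2 := hk.bound _ hq.1.le
      have e3 := hk.bound _ hq.2.le
      have e4 : 1 ≤ (1 + ‖q.1‖) ^ (d + 1) := one_le_pow₀ (by linarith [norm_nonneg q.1])
      have e5 : 1 ≤ (1 + ‖q.2‖) ^ (d + 1) := one_le_pow₀ (by linarith [norm_nonneg q.2])
      nlinarith
    calc _ ≤ (1 + ‖q.1‖) ^ (d + 1) * (1 + ‖q.2‖) ^ (d + 1) * (|ψ q.1| * |ψ q.2|) := by gcongr
      _ = _ := by ring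

theorem integrable_sq_integral (hk : IsPolynomialField k μ) (ψ : TestFn d) :
    Integrable (fun v => (∫ p, k p v * ψ p ∂(halfVolume d)) ^ 2) μ := by
  simp only [sq_integral_eq_integral_prod]
  exact (hk.integrable_prod ψ).integral_prod_right

theorem integral_sq_integral (hk : IsPolynomialField k μ) (ψ : TestFn d) :
    ∫ v, (∫ p, k p v * ψ p ∂(halfVolume d)) ^ 2 ∂μ = ∫ q : TimeSpace d × TimeSpace d,
      (∫ v, k q.1 v * k q.2 v ∂μ) * (ψ q.1 * ψ q.2) ∂((halfVolume d).prod (halfVolume d)) := by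
  simp only [sq_integral_eq_integral_prod]
  rw [← integral_prod_symm _ (hk.integrable_prod ψ), integral_prod _ (hk.integrable_prod ψ)]
  simp only [integral_mul_const]

theorem memLp_integral (hk : IsPolynomialField k μ) (ψ : TestFn d) :
    MemLp (fun v => ∫ p, k p v * ψ p ∂(halfVolume d)) 2 μ := by
  have hm : StronglyMeasurable fun z : T × TimeSpace d => k z.2 z.1 * ψ z.2 :=
    ((hk.stronglyMeasurable.measurable.comp measurable_swap).mul
      (ψ.continuous.measurable.comp measurable_snd)).stronglyMeasurable
  exact (memLp_two_iff_integrable_sq hm.integral_prod_right'.aestronglyMeasurable).mpr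
    (hk.integrable_sq_integral ψ)

theorem integrable_mul_of_integrable [IsProbabilityMeasure μ] (hk : IsPolynomialField k μ)
    {w : TimeSpace d → ℝ} (hw : Measurable w)
    (hi : Integrable (fun p => (1 + ‖p‖) ^ (d + 1) * |w p|) (halfVolume d)) :
    Integrable (fun z : TimeSpace d × T => k z.1 z.2 * w z.1) ((halfVolume d).prod μ) := by
  have hm : StronglyMeasurable fun z : TimeSpace d × T => k z.1 z.2 * w z.1 :=
    (hk.stronglyMeasurable.measurable.mul (hw.comp measurable_fst)).stronglyMeasurable
  refine (integrable_prod_iff hm.aestronglyMeasurable).mpr ⟨?_, ?_⟩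
  · filter_upwards [ae_halfVolume_pos d] with p hp
    exact ((hk.memLp p hp.le).integrable one_le_two).mul_const _
  · refine (hi.const_mul 2).mono' hm.norm.integral_prod_right'.aestronglyMeasurable ?_
    filter_upwards [ae_halfVolume_pos d] with p hp
    have h2 := hk.memLp p hp.le
    rw [Real.norm_of_nonneg (integral_nonneg fun _ => norm_nonneg _)]
    simp only [norm_mul, Real.norm_eq_abs]
    rw [integral_mul_const]
    have h1 : ∫ v, |k p v| ∂μ ≤ 2 * (1 + ‖p‖) ^ (d + 1) := by
      have e1 : ∫ v, |k p v| ∂μ ≤ ∫ v, (1 + k p v ^ 2) ∂μ := by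
        refine integral_mono (h2.integrable one_le_two).norm
          ((integrable_const 1).add h2.integrable_sq) fun v => ?_
        nlinarith [sq_nonneg (|k p v| - 1), sq_abs (k p v), abs_nonneg (k p v)]
      rw [integral_add (integrable_const 1) h2.integrable_sq] at e1
      simp only [integral_const, probReal_univ, smul_eq_mul, mul_one] at e1
      have e2 := hk.bound p hp.le
      have e4 : 1 ≤ (1 + ‖p‖) ^ (d + 1) := one_le_pow₀ (by linarith [norm_nonneg p])
      linarith
    calc _ ≤ 2 * (1 + ‖p‖) ^ (d + 1) * |w p| := by gcongr
      _ = _ := by ring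

theorem integral_integral_eq_zero [IsProbabilityMeasure μ] (hk : IsPolynomialField k μ)
    (h0 : ∀ p : TimeSpace d, 0 ≤ p.1 → ∫ v, k p v ∂μ = 0) (ψ : TestFn d) :
    ∫ v, ∫ p, k p v * ψ p ∂(halfVolume d) ∂μ = 0 := by
  have hi := hk.integrable_mul_of_integrable ψ.continuous.measurable
    (integrable_one_add_norm_pow_mul_abs (d + 1) ψ)
  rw [← integral_prod_symm _ hi, integral_prod _ hi]
  refine integral_eq_zero_of_ae ?_
  filter_upwards [ae_halfVolume_pos d] with p hp
  rw [integral_mul_const, h0 p hp.le, zero_mul, Pi.zero_apply]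

end IsPolynomialField

/-- The kernel is itself a field, over time-space with Lebesgue measure, and has the covariance of
the Brownian sheet. The moment formulas serve for both. -/
theorem isPolynomialField_sheetKernel (d : ℕ) :
    IsPolynomialField (sheetKernel (d := d)) (volume : Measure (TimeSpace d)) where
  stronglyMeasurable := measurable_sheetKernel.stronglyMeasurable
  memLp p _ := by
    refine (memLp_two_iff_integrable_sq (integrable_sheetKernel p).aestronglyMeasurable).mpr ?_
    refine (integrable_sheetKernel p).mono
      ((integrable_sheetKernel p).aestronglyMeasurable.pow 2) (Eventually.of_forall fun v => ?_)
    rw [Real.norm_eq_abs, Real.norm_eq_abs, sq, abs_mul]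
    exact mul_le_of_le_one_left (abs_nonneg _) (abs_sheetKernel_le_one _ _)
  bound p _ := by
    have h : ∀ v, sheetKernel p v ^ 2 = |sheetKernel p v| := fun v => by
      rw [sheetKernel, sq, mul_mul_mul_comm, ← Finset.prod_mul_distrib, abs_mul, Finset.abs_prod]
      simp only [theta_mul_self]
    simp only [h]
    rw [integral_abs_sheetKernel]
    exact abs_mul_prod_abs_le p

/-- Cutting to the half space is harmless, since `θ_t(s) ≠ 0` forces `t` and `s` onto the same side
of `0`. -/
theorem setIntegral_sheetKernel_mul_mixedDeriv (v : TimeSpace d) (φ : TestFn d) :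
    ∫ p, sheetKernel p v * (∂^{mixedDir d} φ) p ∂(halfVolume d) =
      {p : TimeSpace d | 0 < p.1}.indicator (fun v => (-1) ^ (d + 1) * φ v) v := by
  have hms : MeasurableSet {p : TimeSpace d | 0 < p.1} :=
    measurableSet_lt measurable_const measurable_fst
  rw [halfVolume, ← integral_indicator hms]
  by_cases hv : 0 < v.1
  · rw [indicator_of_mem (show v ∈ {p : TimeSpace d | 0 < p.1} from hv),
      ← integral_sheetKernel_mul_mixedDeriv]
    refine integral_congr_ae (Eventually.of_forall fun p => ?_)
    simp only [indicator, mem_ofPred_eq]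
    split_ifs with hp
    · rfl
    · have : theta p.1 v.1 = 0 := by
        rw [theta, if_neg (by rintro ⟨_, h⟩; linarith), if_neg (by rintro ⟨_, h⟩; linarith)]
      rw [sheetKernel, this, zero_mul, zero_mul]
  · rw [indicator_of_notMem (show v ∉ {p : TimeSpace d | 0 < p.1} from hv)]
    refine integral_eq_zero_of_ae (Eventually.of_forall fun p => ?_)
    simp only [indicator, mem_ofPred_eq, Pi.zero_apply]
    split_ifs with hp
    · have : theta p.1 v.1 = 0 := by
        rw [theta, if_neg (by rintro ⟨h, _⟩; linarith), if_neg (by rintro ⟨h, _⟩; linarith)]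
      rw [sheetKernel, this, zero_mul, zero_mul]
    · rfl

/-- The isometry property of white noise. -/
theorem integral_sq_integral_mixedDeriv {T : Type*} [MeasurableSpace T] {μ : Measure T} [SFinite μ]
    {k : TimeSpace d → T → ℝ} (hk : IsPolynomialField k μ)
    (hcov : ∀ p q : TimeSpace d, 0 ≤ p.1 → 0 ≤ q.1 →
      ∫ v, k p v * k q v ∂μ = ∫ v, sheetKernel p v * sheetKernel q v) (φ : TestFn d) :
    ∫ v, (∫ p, k p v * (∂^{mixedDir d} φ) p ∂(halfVolume d)) ^ 2 ∂μ =
      ∫ p, φ p ^ 2 ∂(halfVolume d) := by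
  -- The second moment depends on the field only through its covariance, so the field may be
  -- replaced by `sheetKernel`, for which the inner integral is known exactly.
  have h1 := (isPolynomialField_sheetKernel d).integral_sq_integral (∂^{mixedDir d} φ)
  have h2 := hk.integral_sq_integral (∂^{mixedDir d} φ)
  have h3 : ∫ q : TimeSpace d × TimeSpace d, (∫ v, k q.1 v * k q.2 v ∂μ) *
      ((∂^{mixedDir d} φ) q.1 * (∂^{mixedDir d} φ) q.2) ∂((halfVolume d).prod (halfVolume d)) =
      ∫ q : TimeSpace d × TimeSpace d, (∫ v, sheetKernel q.1 v * sheetKernel q.2 v) *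
      ((∂^{mixedDir d} φ) q.1 * (∂^{mixedDir d} φ) q.2) ∂((halfVolume d).prod (halfVolume d)) := by
    refine integral_congr_ae ?_
    filter_upwards [ae_halfVolume_prod_pos d] with q hq
    rw [hcov _ _ hq.1.le hq.2.le]
  rw [h2, h3, ← h1]
  simp only [setIntegral_sheetKernel_mul_mixedDeriv]
  rw [halfVolume, ← integral_indicator (measurableSet_lt measurable_const measurable_fst)]
  refine integral_congr_ae (Eventually.of_forall fun v => ?_)
  simp only [indicator]
  split_ifs
  · rw [mul_pow, ← pow_mul, mul_comm (d + 1), pow_mul]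
    norm_num
  · norm_num

end Moments

/-! ### White noise -/

section WhiteNoise

variable {d : ℕ}

theorem integrable_mul_schwartz {b : TimeSpace d → ℝ} {N : ℕ}
    (hb : Integrable (fun p => b p * ((1 + ‖p‖) ^ N)⁻¹) (halfVolume d)) (φ : TestFn d) :
    Integrable (fun p => b p * φ p) (halfVolume d) := by
  obtain ⟨s, C, hC, h⟩ := exists_norm_le_inv_one_add_norm_pow (d := d) N
  have h1 : (fun p => b p * φ p) = fun p =>
      ((1 + ‖p‖) ^ N * φ p) * (b p * ((1 + ‖p‖) ^ N)⁻¹) := by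
    ext p
    have : (1 + ‖p‖) ^ N ≠ 0 := by positivity
    field_simp
  rw [h1]
  refine hb.bdd_mul (c := C * s.sup (schwartzSeminormFamily ℝ (TimeSpace d) ℝ) φ) ?_
    (Eventually.of_forall fun p => ?_)
  · have := φ.continuous
    exact (by fun_prop : Continuous fun p => (1 + ‖p‖) ^ N * φ p).aestronglyMeasurable
  · rw [norm_mul, Real.norm_of_nonneg (by positivity), Real.norm_eq_abs]
    refine (mul_le_mul_of_nonneg_left (h φ p) (by positivity)).trans (le_of_eq ?_)
    have : (1 + ‖p‖) ^ N ≠ 0 := by positivity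
    field_simp

/-- A function on the half space of moderate growth, as a tempered distribution. It is `0` for other
functions. -/
def pathDistribution (N : ℕ) (b : TimeSpace d → ℝ) : TDist d := by
  classical
  exact if hb : Integrable (fun p => b p * ((1 + ‖p‖) ^ N)⁻¹) (halfVolume d) then
    SchwartzMap.mkCLMtoNormedSpace (fun φ => ∫ p, b p * φ p ∂(halfVolume d))
      (fun φ ψ => by
        simp only [add_apply, mul_add]
        exact integral_add (integrable_mul_schwartz hb φ) (integrable_mul_schwartz hb ψ))
      (fun c φ => by
        simp only [smul_apply, smul_eq_mul, RingHom.id_apply]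
        rw [← integral_const_mul]
        refine integral_congr_ae (Eventually.of_forall fun p => ?_)
        simp only
        ring)
      (by
        obtain ⟨s, C, hC, h⟩ := exists_norm_le_inv_one_add_norm_pow (d := d) N
        refine ⟨s, (∫ p, ‖b p * ((1 + ‖p‖) ^ N)⁻¹‖ ∂(halfVolume d)) * C,
          mul_nonneg (integral_nonneg fun _ => norm_nonneg _) hC, fun φ => ?_⟩
        rw [mul_assoc, ← integral_mul_const]
        refine norm_integral_le_of_norm_le (hb.norm.mul_const _) (Eventually.of_forall fun p => ?_)
        rw [norm_mul, norm_mul, norm_inv, Real.norm_eq_abs (φ p),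
          Real.norm_of_nonneg (r := (1 + ‖p‖) ^ N) (by positivity)]
        calc ‖b p‖ * |φ p| ≤ ‖b p‖ * (C * s.sup (schwartzSeminormFamily ℝ (TimeSpace d) ℝ) φ *
              ((1 + ‖p‖) ^ N)⁻¹) := by
              gcongr
              exact h φ p
          _ = _ := by ring)
  else 0

theorem pathDistribution_apply {N : ℕ} {b : TimeSpace d → ℝ}
    (hb : Integrable (fun p => b p * ((1 + ‖p‖) ^ N)⁻¹) (halfVolume d)) (φ : TestFn d) :
    pathDistribution N b φ = ∫ p, b p * φ p ∂(halfVolume d) := by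
  rw [pathDistribution, dif_pos hb]
  rfl

theorem pathDistribution_congr (N : ℕ) (b : TimeSpace d → ℝ) {φ ψ : TestFn d}
    (h : ∀ p : TimeSpace d, 0 < p.1 → φ p = ψ p) :
    pathDistribution N b φ = pathDistribution N b ψ := by
  by_cases hb : Integrable (fun p => b p * ((1 + ‖p‖) ^ N)⁻¹) (halfVolume d)
  · rw [pathDistribution_apply hb, pathDistribution_apply hb]
    refine integral_congr_ae ?_
    filter_upwards [ae_halfVolume_pos d] with p hp
    rw [h p hp]
  · rw [pathDistribution, dif_neg hb]
    rfl

theorem mixedDeriv_apply (T : TDist d) (φ : TestFn d) :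
    mixedDeriv T φ = (-1) ^ (d + 1) * T (∂^{mixedDir d} φ) := rfl

theorem iteratedLineDerivOp_congr {E F : Type*} [NormedAddCommGroup E] [NormedSpace ℝ E]
    [NormedAddCommGroup F] [NormedSpace ℝ F] {U : Set E} (hU : IsOpen U) {φ ψ : 𝓢(E, F)}
    (h : EqOn φ ψ U) {n : ℕ} (v : Fin n → E) : EqOn (∂^{v} φ : 𝓢(E, F)) (∂^{v} ψ : 𝓢(E, F)) U := by
  induction n with
  | zero => exact h
  | succ n ih =>
    intro x hx
    rw [LineDeriv.iteratedLineDerivOp_succ_left, LineDeriv.iteratedLineDerivOp_succ_left,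
      SchwartzMap.lineDerivOp_apply_eq_fderiv, SchwartzMap.lineDerivOp_apply_eq_fderiv,
      ((ih (Fin.tail v)).eventuallyEq_of_mem (hU.mem_nhds hx)).fderiv_eq]

/-- Derivatives are local, and the path is integrated over the open half space only. This is the
sole property of the noise that existence requires, and it holds for every path. -/
theorem mixedDeriv_pathDistribution_congr (N : ℕ) (b : TimeSpace d → ℝ) {φ ψ : TestFn d}
    (h : ∀ p : TimeSpace d, 0 < p.1 → φ p = ψ p) :
    mixedDeriv (pathDistribution N b) φ = mixedDeriv (pathDistribution N b) ψ := by
  rw [mixedDeriv_apply, mixedDeriv_apply]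
  congr 1
  exact pathDistribution_congr N b fun p hp =>
    iteratedLineDerivOp_congr (U := {p : TimeSpace d | 0 < p.1})
      (isOpen_lt continuous_const continuous_fst) (fun p hp => h p hp) (mixedDir d) hp

/-! ### White noise of a Brownian sheet with regularized paths -/

section Model

variable {Ω : Type*} [MeasurableSpace Ω] {P : Measure Ω}
  {B : TimeSpace d → Ω → ℝ}

/-- A Brownian sheet has a modification with continuous paths and measurable values. -/
theorem IsBrownianSheet.exists_modification (hB : IsBrownianSheet B P) :
    ∃ u : TimeSpace d → Ω → ℝ, (∀ ω, Continuous fun p => u p ω) ∧ (∀ p, Measurable (u p)) ∧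
      ∀ᵐ ω ∂P, ∀ p : TimeSpace d, 0 ≤ p.1 → u p ω = B p ω := by
  classical
  -- Composing with the retraction onto `t ≥ 0` makes the modification continuous on all of
  -- time-space.
  set pr : TimeSpace d → TimeSpace d := fun p => (max p.1 0, p.2) with hpr
  have hpr0 : ∀ p, 0 ≤ (pr p).1 := fun p => le_max_right _ _
  have hprc : Continuous pr := by fun_prop
  set x := TopologicalSpace.denseSeq (TimeSpace d)
  have hmeas : ∀ n, AEMeasurable (B (pr (x n))) P := fun n =>
    hB.gaussian.aemeasurable ⟨pr (x n), hpr0 _⟩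
  have hgood : ∀ᵐ ω ∂P, ContinuousOn (fun p => B p ω) {p | 0 ≤ p.1} ∧
      ∀ n, B (pr (x n)) ω = (hmeas n).mk _ ω :=
    hB.continuousPaths.and (ae_all_iff.mpr fun n => (hmeas n).ae_eq_mk)
  obtain ⟨N, hN, hNm, hN0⟩ := exists_measurable_superset_of_null (ae_iff.mp hgood)
  have hNgood : ∀ ω ∉ N, ContinuousOn (fun p => B p ω) {p | 0 ≤ p.1} ∧
      ∀ n, B (pr (x n)) ω = (hmeas n).mk _ ω := fun ω hω => by
    by_contra h
    exact hω (hN h)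
  set u : TimeSpace d → Ω → ℝ := fun p ω => if ω ∈ N then 0 else B (pr p) ω with hu
  have hcont : ∀ ω, Continuous fun p => u p ω := fun ω => by
    by_cases hω : ω ∈ N
    · simp only [hu, hω, if_true]
      exact continuous_const
    · simp only [hu, hω, if_false]
      exact (hNgood ω hω).1.comp_continuous hprc hpr0
  refine ⟨u, hcont, fun p => ?_, ?_⟩
  -- Off the null set `N` the values at a dense sequence agree with measurable versions; continuity
  -- carries measurability to all other points.
  · have hseq : ∀ n, Measurable (u (x n)) := fun n => by
      have : u (x n) = fun ω => if ω ∈ N then 0 else (hmeas n).mk _ ω := by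
        ext ω
        by_cases hω : ω ∈ N
        · simp only [hu, hω, if_true]
        · simp only [hu, hω, if_false]
          exact (hNgood ω hω).2 n
      rw [this]
      exact Measurable.ite hNm measurable_const (hmeas n).measurable_mk
    obtain ⟨z, hz, hlim⟩ := mem_closure_iff_seq_limit.mp
      (TopologicalSpace.denseRange_denseSeq (TimeSpace d) p)
    choose m hm using hz
    refine measurable_of_tendsto_metrizable (f := fun n => u (z n)) (fun n => ?_) ?_
    · rw [← hm n]
      exact hseq _
    · exact tendsto_pi_nhds.mpr fun ω => ((hcont ω).tendsto p).comp hlim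
  · filter_upwards [measure_eq_zero_iff_ae_notMem.mp hN0] with ω hω p hp
    simp only [hu, hω, if_false, hpr]
    rw [max_eq_left hp]

variable {u : TimeSpace d → Ω → ℝ}

theorem IsBrownianSheet.integral_mul_eq (hB : IsBrownianSheet B P)
    (hu : ∀ᵐ ω ∂P, ∀ p : TimeSpace d, 0 ≤ p.1 → u p ω = B p ω) (p q : TimeSpace d)
    (hp : 0 ≤ p.1) (hq : 0 ≤ q.1) :
    ∫ ω, u p ω * u q ω ∂P = ∫ v, sheetKernel p v * sheetKernel q v := by
  rw [integral_sheetKernel_mul, ← hB.covariance p q hp hq]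
  refine integral_congr_ae ?_
  filter_upwards [hu] with ω hω
  rw [hω p hp, hω q hq]

theorem IsBrownianSheet.isPolynomialField (hB : IsBrownianSheet B P)
    (hc : ∀ ω, Continuous fun p => u p ω) (hm : ∀ p, Measurable (u p))
    (hu : ∀ᵐ ω ∂P, ∀ p : TimeSpace d, 0 ≤ p.1 → u p ω = B p ω) : IsPolynomialField u P where
  stronglyMeasurable := stronglyMeasurable_uncurry_of_continuous_of_stronglyMeasurable hc
    fun p => (hm p).stronglyMeasurable
  memLp p hp := by
    have h := (hB.gaussian.hasGaussianLaw_eval ⟨p, hp⟩).memLp_two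
    refine h.ae_eq ?_
    filter_upwards [hu] with ω hω
    exact (hω p hp).symm
  bound p hp := by
    have h1 := hB.integral_mul_eq hu p p hp hp
    have h2 := (isPolynomialField_sheetKernel d).bound p hp
    simp only [sq] at h2 ⊢
    rw [h1]
    exact h2

variable [IsProbabilityMeasure P]

variable (u) in
/-- The white noise of a random field with continuous paths. -/
def whiteNoise (ω : Ω) : TDist d := mixedDeriv (pathDistribution (2 * d + 3) fun p => u p ω)

/-- The exponent `2d + 3` is `(d + 1) + (d + 2)`: the first part compensates the growth of the
second moments, the second makes the weight integrable in dimension `d + 1`. -/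
theorem ae_integrable_path (hk : IsPolynomialField u P) :
    ∀ᵐ ω ∂P, Integrable (fun p => u p ω * ((1 + ‖p‖) ^ (2 * d + 3))⁻¹) (halfVolume d) := by
  refine (hk.integrable_mul_of_integrable (w := fun p => ((1 + ‖p‖) ^ (2 * d + 3))⁻¹)
    (by fun_prop) ?_).prod_left_ae
  refine integrable_inv_one_add_norm_pow_halfVolume.congr (Eventually.of_forall fun p => ?_)
  simp only
  rw [abs_of_nonneg (by positivity), show 2 * d + 3 = (d + 1) + (d + 2) by ring,
    pow_add _ (d + 1) (d + 2), mul_inv, mul_inv_cancel_left₀ (by positivity)]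

theorem ae_whiteNoise_apply (hk : IsPolynomialField u P) (φ : TestFn d) :
    (fun ω => whiteNoise u ω φ) =ᵐ[P] fun ω =>
      (-1) ^ (d + 1) * ∫ p, u p ω * (∂^{mixedDir d} φ) p ∂(halfVolume d) := by
  filter_upwards [ae_integrable_path hk] with ω hω
  rw [whiteNoise, mixedDeriv_apply, pathDistribution_apply hω]

theorem memLp_whiteNoise (hk : IsPolynomialField u P) (φ : TestFn d) :
    MemLp (fun ω => whiteNoise u ω φ) 2 P :=
  ((hk.memLp_integral (∂^{mixedDir d} φ)).const_mul ((-1) ^ (d + 1))).ae_eq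
    (ae_whiteNoise_apply hk φ).symm

theorem IsBrownianSheet.ae_isWhiteNoise (hB : IsBrownianSheet B P)
    (hc : ∀ ω, Continuous fun p => u p ω) (hm : ∀ p, Measurable (u p))
    (hu : ∀ᵐ ω ∂P, ∀ p : TimeSpace d, 0 ≤ p.1 → u p ω = B p ω) :
    ∀ᵐ ω ∂P, IsWhiteNoise (fun p => B p ω) (whiteNoise u ω) := by
  filter_upwards [ae_integrable_path (hB.isPolynomialField hc hm hu), hu] with ω hω huω
  refine ⟨pathDistribution (2 * d + 3) fun p => u p ω, fun φ => ?_, rfl⟩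
  have hae : (fun p => u p ω * φ p) =ᵐ[halfVolume d] fun p => B p ω * φ p := by
    filter_upwards [ae_halfVolume_pos d] with p hp
    rw [huω p hp.le]
  exact ⟨(integrable_mul_schwartz hω φ).congr hae, by
    rw [pathDistribution_apply hω, integral_congr_ae hae]⟩

theorem IsBrownianSheet.integral_whiteNoise (hB : IsBrownianSheet B P)
    (hc : ∀ ω, Continuous fun p => u p ω) (hm : ∀ p, Measurable (u p))
    (hu : ∀ᵐ ω ∂P, ∀ p : TimeSpace d, 0 ≤ p.1 → u p ω = B p ω) (φ : TestFn d) :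
    ∫ ω, whiteNoise u ω φ ∂P = 0 := by
  have hk := hB.isPolynomialField hc hm hu
  rw [integral_congr_ae (ae_whiteNoise_apply hk φ), integral_const_mul,
    hk.integral_integral_eq_zero (fun p hp => ?_), mul_zero]
  rw [← hB.centred p hp]
  refine integral_congr_ae ?_
  filter_upwards [hu] with ω hω using hω p hp

theorem IsBrownianSheet.eLpNorm_whiteNoise (hB : IsBrownianSheet B P)
    (hc : ∀ ω, Continuous fun p => u p ω) (hm : ∀ p, Measurable (u p))
    (hu : ∀ᵐ ω ∂P, ∀ p : TimeSpace d, 0 ≤ p.1 → u p ω = B p ω) (φ : TestFn d) :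
    eLpNorm (fun ω => whiteNoise u ω φ) 2 P = eLpNorm φ 2 (halfVolume d) := by
  have hk := hB.isPolynomialField hc hm hu
  have hsq : ∫ ω, whiteNoise u ω φ ^ 2 ∂P = ∫ p, φ p ^ 2 ∂(halfVolume d) := by
    rw [← integral_sq_integral_mixedDeriv hk (hB.integral_mul_eq hu)]
    refine integral_congr_ae ?_
    filter_upwards [ae_whiteNoise_apply hk φ] with ω hω
    rw [hω, mul_pow, ← pow_mul, mul_comm (d + 1), pow_mul]
    norm_num
  have hφ : MemLp φ 2 (halfVolume d) := φ.memLp 2 (volume.restrict _)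
  rw [(memLp_whiteNoise hk φ).eLpNorm_eq_integral_rpow_norm two_ne_zero ENNReal.ofNat_ne_top,
    hφ.eLpNorm_eq_integral_rpow_norm two_ne_zero ENNReal.ofNat_ne_top]
  simp only [ENNReal.toReal_ofNat, Real.rpow_two, Real.norm_eq_abs, sq_abs, hsq]

/-- By linearity, the isometry applied to `ψ n - φ` turns `L²` convergence of test functions into
`L²(P)` convergence. -/
theorem IsBrownianSheet.isWienerIntegral_whiteNoise (hB : IsBrownianSheet B P)
    (hc : ∀ ω, Continuous fun p => u p ω) (hm : ∀ p, Measurable (u p))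
    (hu : ∀ᵐ ω ∂P, ∀ p : TimeSpace d, 0 ≤ p.1 → u p ω = B p ω) (φ : TestFn d) :
    IsWienerIntegral (whiteNoise u) P φ fun ω => whiteNoise u ω φ := by
  refine ⟨φ.memLp 2 (volume.restrict _), memLp_whiteNoise (hB.isPolynomialField hc hm hu) φ,
    fun ψ hψ => hψ.congr fun n => ?_⟩
  have h := hB.eLpNorm_whiteNoise hc hm hu (ψ n - φ)
  simp only [map_sub] at h
  rw [h]
  rfl

end Model

end WhiteNoise

/-! ### Solutions of the fractional heat equation -/

section Solution

variable {d : ℕ} {α lam : ℝ}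

theorem eq_zero_of_tsupport_subset {φ : TestFn d} (h : tsupport φ ⊆ {p : TimeSpace d | p.1 < 0})
    {p : TimeSpace d} (hp : 0 ≤ p.1) : φ p = 0 :=
  image_eq_zero_of_notMem_tsupport fun hmem => (h hmem).not_ge hp

theorem invFourier_eq_zero {φ : TestFn d} {t : ℝ} (h : ∀ x, φ (t, x) = 0)
    (y : EuclideanSpace ℝ (Fin d)) : invFourier φ t y = 0 := by
  simp only [invFourier_eq_integral, h, zero_smul, integral_zero]

theorem duhamel_eq_zero (hα₀ : 0 < α) (hα₂ : α < 2) (hlam : 0 < lam) {φ : TestFn d}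
    (h : ∀ p : TimeSpace d, 0 ≤ p.1 → φ p = 0) {p : TimeSpace d} (hp : 0 ≤ p.1) :
    duhamel d hα₀ hα₂ hlam φ p = 0 := by
  have h1 : ∀ y, invFourier (duhamel d hα₀ hα₂ hlam φ) p.1 y = invFourier (0 : TestFn d) p.1 y := by
    intro y
    rw [invFourier_duhamel hα₀ hα₂ hlam φ (by linarith), invFourier_eq_zero fun _ => rfl]
    refine setIntegral_eq_zero_of_forall_eq_zero fun τ hτ => ?_
    have hτ' : 0 < τ := hτ
    rw [invFourier_eq_zero fun x => h (p.1 + τ, x) (by positivity), mul_zero]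
  exact eq_of_invFourier_eq h1 p.2

/-- The spatial Laplacian sees one time slice only, so it may be applied to identities that hold
only for `t ≥ 0`. -/
theorem laplacianTest_congr {φ ψ : TestFn d} {t : ℝ} (h : ∀ x, φ (t, x) = ψ (t, x))
    (x : EuclideanSpace ℝ (Fin d)) : laplacianTest d φ (t, x) = laplacianTest d ψ (t, x) :=
  eq_of_invFourier_eq (fun y => by
    rw [invFourier_laplacianTest, invFourier_laplacianTest, invFourier_congr h]) x

theorem deltaInitial_congr {φ ψ : TestFn d} (h : ∀ p : TimeSpace d, 0 < p.1 → φ p = ψ p) :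
    deltaInitial φ = deltaInitial ψ :=
  setIntegral_congr_fun measurableSet_Ioi fun t ht => h (t, 0) ht

theorem meanSolution_eq_zero (hα₀ : 0 < α) (hα₂ : α < 2) (hlam : 0 < lam) {φ : TestFn d}
    (h : ∀ p : TimeSpace d, 0 ≤ p.1 → φ p = 0) : meanSolution d hα₀ hα₂ hlam φ = 0 := by
  have h1 : (meanSolution d hα₀ hα₂ hlam φ : ℂ) = 0 := by
    rw [(isI1_meanSolution (d := d) hα₀ hα₂ hlam φ).2]
    refine integral_eq_zero_of_ae ?_
    filter_upwards [ae_halfVolume_pos d] with q hq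
    rw [I1Integrand, invFourier_eq_zero fun x => h (q.1, x) hq.le, mul_zero, Pi.zero_apply]
  exact_mod_cast h1

/-- The initial value and a forcing term `w` that lives on `t ≥ 0` determine a solution. -/
theorem isSolution_meanSolution_add (hα₀ : 0 < α) (hα₂ : α < 2) (hlam : 0 < lam) (σ : ℝ)
    {w : TDist d} (hw : ∀ φ ψ : TestFn d, (∀ p : TimeSpace d, 0 < p.1 → φ p = ψ p) → w φ = w ψ) :
    IsSolution α lam σ w (meanSolution d hα₀ hα₂ hlam + σ • w.comp (duhamel d hα₀ hα₂ hlam)) where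
  vanishing φ hφ := by
    have h0 : ∀ p : TimeSpace d, 0 ≤ p.1 → φ p = 0 := fun p hp => eq_zero_of_tsupport_subset hφ hp
    have h1 : w (duhamel d hα₀ hα₂ hlam φ) = w 0 :=
      hw _ _ fun p hp => duhamel_eq_zero hα₀ hα₂ hlam h0 hp.le
    rw [add_apply, smul_apply, ContinuousLinearMap.comp_apply, h1, map_zero,
      meanSolution_eq_zero hα₀ hα₂ hlam h0, smul_zero, add_zero]
  equation φ ψ h := by
    set K := duhamel d hα₀ hα₂ hlam with hKdef
    -- `ρ` is the dual operator applied to `φ`; the equation is equivalent to `Y ρ = U ψ + σ w φ`.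
    set ρ := ψ - lam • laplacianTest d φ with hρ
    have hK : ∀ p : TimeSpace d, 0 ≤ p.1 → K ρ p = φ p := fun p hp =>
      duhamel_rightFracDeriv_sub hα₀ hα₂ hlam h hp
    have h1 : w (K ρ) = w φ := hw _ _ fun p hp => hK p hp.le
    have h2 : meanSolution d hα₀ hα₂ hlam ρ = deltaInitial ψ := by
      rw [meanSolution_apply]
      refine deltaInitial_congr fun p hp => ?_
      have h3 : laplacianTest d (K ρ) p = laplacianTest d φ p := laplacianTest_congr
        (fun x => hK (p.1, x) (le_of_lt hp)) p.2
      have h4 : ρ p = ψ p - lam * laplacianTest d φ p := by rw [hρ]; rfl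
      rw [← hKdef, add_apply, smul_apply, h3, h4, smul_eq_mul]
      ring
    have h4 : meanSolution d hα₀ hα₂ hlam ρ = meanSolution d hα₀ hα₂ hlam ψ -
        lam * meanSolution d hα₀ hα₂ hlam (laplacianTest d φ) := by
      rw [hρ, map_sub, map_smul, smul_eq_mul]
    have h5 : w (K ρ) = w (K ψ) - lam * w (K (laplacianTest d φ)) := by
      rw [hρ, map_sub, map_smul, map_sub, map_smul, smul_eq_mul]
    simp only [add_apply, smul_apply, laplacian, ContinuousLinearMap.comp_apply, smul_eq_mul]
    linear_combination h4 - h2 + σ * h5 - σ * h1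

/-- Testing with `Kη`, whose dual derivative is `η + λΔKη`, cancels the Laplacian terms and leaves
`Y η` in terms of the data. -/
theorem IsSolution.eq_meanSolution_add (hα₀ : 0 < α) (hα₂ : α < 2) (hlam : 0 < lam) {σ : ℝ}
    {w Y : TDist d} (hY : IsSolution α lam σ w Y) :
    Y = meanSolution d hα₀ hα₂ hlam + σ • w.comp (duhamel d hα₀ hα₂ hlam) := by
  ext η
  set K := duhamel d hα₀ hα₂ hlam
  have h := hY.equation (K η) (η + lam • laplacianTest d (K η)) fun p hp =>
    rightFracDeriv_duhamel hα₀ hα₂ hlam η hp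
  have h1 := meanSolution_apply hα₀ hα₂ hlam η
  simp only [add_apply, smul_apply, laplacian, ContinuousLinearMap.comp_apply, smul_eq_mul, map_add,
    map_smul] at h ⊢
  linarith

/-- The integrand `σ Kφ` is a Schwartz function, so its Wiener integral is the pairing of the noise
with it, path by path. -/
theorem isI2_duhamel {Ω : Type*} [MeasurableSpace Ω] {P : Measure Ω} [IsProbabilityMeasure P]
    {B u : TimeSpace d → Ω → ℝ} (hB : IsBrownianSheet B P) (hc : ∀ ω, Continuous fun p => u p ω)
    (hm : ∀ p, Measurable (u p)) (hu : ∀ᵐ ω ∂P, ∀ p : TimeSpace d, 0 ≤ p.1 → u p ω = B p ω)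
    (hα₀ : 0 < α) (hα₂ : α < 2) (hlam : 0 < lam) (σ : ℝ) :
    IsI2 α lam σ (whiteNoise u) P
      fun ω => σ • (whiteNoise u ω).comp (duhamel d hα₀ hα₂ hlam) := by
  intro φ
  refine ⟨(σ • duhamel d hα₀ hα₂ hlam φ : TestFn d), fun p hp => ?_, ?_⟩
  · obtain ⟨h1, h2⟩ := duhamel_eq_integral hα₀ hα₂ hlam φ hp
    refine ⟨h1, ?_⟩
    rw [← h2, smul_apply, smul_eq_mul, Complex.ofReal_mul]
  · have h := hB.isWienerIntegral_whiteNoise hc hm hu (σ • duhamel d hα₀ hα₂ hlam φ)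
    simp only [map_smul] at h
    exact h

end Solution

end FracHeat

end

/-! ### The main theorem -/

theorem theorem6p1 {Ω : Type*} [MeasurableSpace Ω] (P : Measure Ω) [IsProbabilityMeasure P]
    (d : ℕ) (hd : 1 ≤ d) (α lam σ : ℝ) (hα₀ : 0 < α) (hα₂ : α < 2) (hlam : 0 < lam)
    (B : FracHeat.TimeSpace d → Ω → ℝ) (hB : FracHeat.IsBrownianSheet B P) :
    ∃ (W : Ω → FracHeat.TDist d) (I₁ : FracHeat.TDist d) (I₂ : Ω → FracHeat.TDist d),
      (∀ᵐ ω ∂P, FracHeat.IsWhiteNoise (fun p => B p ω) (W ω)) ∧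
      FracHeat.IsI1 α lam I₁ ∧
      FracHeat.IsI2 α lam σ W P I₂ ∧
      (∀ᵐ ω ∂P, FracHeat.IsSolution α lam σ (W ω) (I₁ + I₂ ω) ∧
        ∀ Y : FracHeat.TDist d, FracHeat.IsSolution α lam σ (W ω) Y → Y = I₁ + I₂ ω) ∧
      (∀ φ : FracHeat.TestFn d,
        Tendsto (fun ε : ℝ => ∫ ω, (I₁ + I₂ ω) (FracHeat.timeConcentrate ε φ) ∂P) (𝓝[>] 0)
          (𝓝 (FracHeat.deltaInitial φ))) ∧
      (∀ φ : FracHeat.TestFn d,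
        Tendsto (fun a : EuclideanSpace ℝ (Fin d) =>
            ∫ ω, (I₁ + I₂ ω) (FracHeat.spaceShift a φ) ∂P)
          (cocompact (EuclideanSpace ℝ (Fin d))) (𝓝 0)) := by
  obtain ⟨u, hc, hm, hu⟩ := hB.exists_modification
  have hk := hB.isPolynomialField hc hm hu
  -- The noise has mean zero, so both boundary statements concern the deterministic part alone.
  have hmean : ∀ φ : FracHeat.TestFn d, ∫ ω, (FracHeat.meanSolution d hα₀ hα₂ hlam +
      σ • (FracHeat.whiteNoise u ω).comp (FracHeat.duhamel d hα₀ hα₂ hlam)) φ ∂P =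
      FracHeat.meanSolution d hα₀ hα₂ hlam φ := fun φ => by
    have hi : Integrable
        (fun ω => σ • FracHeat.whiteNoise u ω (FracHeat.duhamel d hα₀ hα₂ hlam φ)) P :=
      ((FracHeat.memLp_whiteNoise hk _).integrable one_le_two).smul σ
    simp only [add_apply, smul_apply, ContinuousLinearMap.comp_apply]
    rw [integral_add (integrable_const _) hi, integral_smul, hB.integral_whiteNoise hc hm hu]
    simp
  refine ⟨FracHeat.whiteNoise u, FracHeat.meanSolution d hα₀ hα₂ hlam,
    fun ω => σ • (FracHeat.whiteNoise u ω).comp (FracHeat.duhamel d hα₀ hα₂ hlam),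
    hB.ae_isWhiteNoise hc hm hu, FracHeat.isI1_meanSolution hα₀ hα₂ hlam,
    FracHeat.isI2_duhamel hB hc hm hu hα₀ hα₂ hlam σ, Eventually.of_forall fun ω => ⟨?_, ?_⟩, ?_, ?_⟩
  · exact FracHeat.isSolution_meanSolution_add hα₀ hα₂ hlam σ fun φ ψ h =>
      FracHeat.mixedDeriv_pathDistribution_congr _ _ h
  · exact fun Y hY => hY.eq_meanSolution_add hα₀ hα₂ hlam
  · simp only [hmean]
    exact FracHeat.tendsto_meanSolution_timeConcentrate hα₀ hα₂ hlam
  · simp only [hmean]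
    exact FracHeat.tendsto_meanSolution_spaceShift hα₀ hα₂ hlam
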